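/- Let $G$ be a compact Lie group, $H\subset G$ a closed subgroup, and $M=G/H$ with a non-zero finite $G$-invariant Borel measure $dx$ (the Riemannian volume, up to normalization). Let $T_1,\dots,T_N$ be a basis of the Lie algebra of $G$, with $[T_i,T_j]=C^k_{ij}T_k$ and $(C_i)^j_k=C^j_{ik}$, and assume that the Killing tensor $K_{ij}=-\mathrm{tr}\,C_iC_j$ is positive definite; let $K^{ij}$ be its inverse. Let $v_i$ be the vector fields on $M$ generating the action of $G$ on functions, $(v_if)(x)=\frac{d}{dt}\big|_{t=0}f(e^{-tT_i}x)$, so that $[v_i,v_j]=C^k_{ij}v_k$, and let $e^{\varphi^iv_i}$ be the translation operator $(e^{\varphi^iv_i}f)(x)=f(e^{-\varphi^iT_i}x)$, whose kernel is $\langle x|e^{\varphi^iv_i}|y\rangle=\delta(x-e^{\varphi^iT_i}y)$. On functions of $\varphi\in\mathbb R^N$ put $$u_i=\left(\frac{-\varphi^kC_k}{e^{-\varphi^kC_k}-1}\right)^j_i\frac{\partial}{\partial\varphi^j},$$ which is defined on the set $R\subset\mathbb R^N$ of those $\varphi$ for which the matrix $\frac{e^{-\varphi^kC_k}-1}{-\varphi^kC_k}=\sum_{n\ge0}\frac{(-\varphi^kC_k)^n}{(n+1)!}$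 is invertible. Let $\beta\in\mathbb R$, $J\in\mathbb R^N$ and let $f\in C^\infty(M)$ be a real test function (of $y$). Assume that the series $$\sum_{n=0}^\infty\frac1{n!}\,\langle x|e^{\varphi^iv_i}\left(-\tfrac12\beta K^{ij}v_iv_j\right)^n|y\rangle,\qquad\varphi=\beta J,$$ applied to $f(y)$, i.e. the series $\sum_n\frac1{n!}e^{\varphi^iv_i}(-\frac12\beta K^{ij}v_iv_j)^nf$, converges in the space $\mathcal D'(M)$ of distributions in $x$. Then, as distributions in $x$ after application to $f(y)$, $$\langle x|e^{-\beta(\frac12K^{ij}v_iv_j-J^iv_i)}|y\rangle=\left.e^{-\frac12\beta K^{ij}u_iu_j}\langle x|e^{\varphi^iv_i}|y\rangle\right|_{\varphi=\beta J}.$$ Precisely: (a) the left side is defined: with $A=\frac12K^{ij}v_iv_j-J^iv_i$, the problem $\frac{d}{ds}U(s)=-A\,U(s)$, $U(0)=f$, has a solution $U$ with values in $\mathcal D'(M)$ for $s$ between $0$ and $\beta$ (differentiability being understood after pairing with each test function), and $U(\beta)=:e^{-\beta A}f$ is the same for all solutions; (b) for every $h\in C^\infty(M)$ the function $\Psi_h(\varphi)=\int_Mh\,(e^{\varphi^iv_i}f)\,dx$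 is smooth on $\mathbb R^N$, the point $\beta J$ lies in the closure of $R$, for every $n$ the limit $$t_n(h)=\lim_{\varphi\to\beta J,\ \varphi\in R}\frac1{n!}\left(-\tfrac12\beta K^{ij}u_iu_j\right)^n\Psi_h(\varphi)$$ exists (it is the value at $\beta J$ if $\beta J\in R$), and $\langle e^{-\beta A}f,h\rangle=\sum_{n=0}^\infty t_n(h)$. -/

import Mathlib

open scoped Manifold ContDiff Topology

noncomputable section

namespace HomSpace

open MeasureTheory Filter

variable {E : Type*} [NormedAddCommGroup E] [NormedSpace ℝ E]
  {G : Type*} [TopologicalSpace G] [ChartedSpace E G] [Group G]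

/-- The exponential map of a Lie group: the value at time `1` of the integral curve through the
identity of the left-invariant vector field with value `X` at the identity. -/
def lieExp (X : GroupLieAlgebra 𝓘(ℝ, E) G) : G :=
  open Classical in
  if h : ∃ γ : ℝ → G, γ 0 = 1 ∧
      IsMIntegralCurve (I := 𝓘(ℝ, E)) γ (mulInvariantVectorField X)
  then h.choose 1 else 1

section Algebra

variable {ι : Type*} [Fintype ι] [DecidableEq ι]
  (T : Module.Basis ι ℝ (GroupLieAlgebra 𝓘(ℝ, E) G))

/-- The matrix `φ^k C_k`, where `[T_i, T_j] = C^k_{ij} T_k` and `(C_i)^j_k = C^j_{ik}`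
(upper index: row, lower right index: column). -/
def adMatrix (φ : ι → ℝ) : Matrix ι ι ℝ :=
  Matrix.of fun j l => ∑ k, φ k * T.repr ⁅T k, T l⁆ j

/-- The Killing tensor `K_{ij} = - tr (C_i C_j)`. -/
def killing : Matrix ι ι ℝ :=
  Matrix.of fun i j => -(adMatrix T (Pi.single i 1) * adMatrix T (Pi.single j 1)).trace

/-- The matrix `ω(φ) = (e^{-X} - 1) / (-X)` with `X = φ^k C_k`, i.e. the entire function
`(e^z - 1) / z = ∑ z^n / (n+1)!` at `z = -X`. -/
def omegaMatrix (φ : ι → ℝ) : Matrix ι ι ℝ :=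
  ∑' n : ℕ, (((n + 1).factorial : ℝ)⁻¹) • (-adMatrix T φ) ^ n

/-- The points `φ` at which `(-X) / (e^{-X} - 1)`, `X = φ^k C_k`, is not singular. -/
def regularSet : Set (ι → ℝ) := {φ | IsUnit (omegaMatrix T φ).det}

/-- The first order differential operator `u_i = ((-X) / (e^{-X} - 1))^j_i ∂/∂φ^j`,
`X = φ^k C_k`, on functions of `φ`. -/
def uOp (i : ι) (Ψ : (ι → ℝ) → ℝ) : (ι → ℝ) → ℝ := fun φ =>
  ∑ j, (omegaMatrix T φ)⁻¹ j i * fderiv ℝ Ψ φ (Pi.single j 1)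

/-- The second order operator `-(β/2) K^{ij} u_i u_j`. -/
def uCasimir (β : ℝ) (Ψ : (ι → ℝ) → ℝ) : (ι → ℝ) → ℝ := fun φ =>
  -(1 / 2) * β * ∑ i, ∑ j, (killing T)⁻¹ i j * uOp T i (uOp T j Ψ) φ

/-- `e^{-(β/2) K^{ij} u_i u_j} Ψ` at `φ = φ₀` equals `a`: the exponential is its power series, and
since the `u_i` may be singular at `φ₀`, the value at `φ₀` of each term is its limit along regular
points (which is its actual value if `φ₀` is regular). -/
def HasDerivativeExpansion (β : ℝ) (Ψ : (ι → ℝ) → ℝ) (φ₀ : ι → ℝ) (a : ℝ) : Prop :=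
  ContDiff ℝ ∞ Ψ ∧
  ∃ t : ℕ → ℝ,
    (∀ n, Tendsto (fun φ => (uCasimir T β)^[n] Ψ φ / (n.factorial : ℝ))
      (𝓝[regularSet T] φ₀) (𝓝 (t n))) ∧
    Tendsto (fun N => ∑ n ∈ Finset.range N, t n) atTop (𝓝 a)

end Algebra

section Functions

variable (E) in
/-- The smooth functions on `G/H`: those whose pullback to `G` is smooth. -/
def smoothFn (H : Subgroup G) : Submodule ℝ (G ⧸ H → ℝ) where
  carrier := {f | ContMDiff 𝓘(ℝ, E) 𝓘(ℝ, ℝ) ∞ fun g : G => f (g : G ⧸ H)}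
  add_mem' hf hg := by
    simp only [Set.mem_ofPred_eq] at *
    exact hf.add hg
  zero_mem' := by
    simp only [Set.mem_ofPred_eq, Pi.zero_apply]
    exact contMDiff_const
  smul_mem' c f hf := by
    simp only [Set.mem_ofPred_eq, Pi.smul_apply, smul_eq_mul] at *
    exact contMDiff_const.mul hf

variable [LieGroup 𝓘(ℝ, E) ∞ G] {H : Subgroup G}

/-- The translation `f ↦ f (g⁻¹ · )`. -/
def translate (g : G) : Module.End ℝ (smoothFn E H) where
  toFun f := ⟨fun x => (f : G ⧸ H → ℝ) (g⁻¹ • x), by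
    have hf : ContMDiff 𝓘(ℝ, E) 𝓘(ℝ, ℝ) ∞ fun a : G => (f : G ⧸ H → ℝ) (a : G ⧸ H) := f.2
    exact hf.comp (contMDiff_mul_left (I := 𝓘(ℝ, E)) (n := ∞) (a := g⁻¹))⟩
  map_add' _ _ := rfl
  map_smul' _ _ := rfl

theorem contMDiff_orbit (f : smoothFn E H) (x : G ⧸ H) :
    ContMDiff 𝓘(ℝ, E) 𝓘(ℝ, ℝ) ∞ fun a : G => (f : G ⧸ H → ℝ) (a • x) := by
  have hf : ContMDiff 𝓘(ℝ, E) 𝓘(ℝ, ℝ) ∞ fun a : G => (f : G ⧸ H → ℝ) (a : G ⧸ H) := f.2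
  induction x using QuotientGroup.induction_on with
  | H g => exact hf.comp (contMDiff_mul_right (I := 𝓘(ℝ, E)) (n := ∞) (a := g))

theorem contMDiff_orbit_deriv (f : smoothFn E H) (X : GroupLieAlgebra 𝓘(ℝ, E) G) :
    ContMDiff 𝓘(ℝ, E) 𝓘(ℝ, ℝ) ∞ fun g : G =>
      mvfderiv 𝓘(ℝ, E) (fun a : G => (f : G ⧸ H → ℝ) (a • (g : G ⧸ H))) 1 X := by
  have hf : ContMDiff 𝓘(ℝ, E) 𝓘(ℝ, ℝ) ∞ fun a : G => (f : G ⧸ H → ℝ) (a : G ⧸ H) := f.2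
  have : IsManifold 𝓘(ℝ, E) ∞ G := inferInstance
  have : IsManifold 𝓘(ℝ, E) 1 G := IsManifold.of_le (n := ∞) (by simp)
  intro g₀
  have hu : ContMDiff (𝓘(ℝ, E).prod 𝓘(ℝ, E)) 𝓘(ℝ, ℝ) ∞
      (Function.uncurry fun g a : G => (f : G ⧸ H → ℝ) (a • (g : G ⧸ H))) :=
    hf.comp (contMDiff_snd.mul contMDiff_fst)
  have key := ContMDiffAt.mfderiv_apply (m := ∞) (n := ∞) (x₀ := g₀)
    (fun g a : G => (f : G ⧸ H → ℝ) (a • (g : G ⧸ H))) (fun _ : G => (1 : G)) (id : G → G)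
    (fun _ : G => (show E from X)) hu.contMDiffAt
    contMDiffAt_const contMDiffAt_id contMDiffAt_const (by simp)
  refine key.congr_of_eventuallyEq (Eventually.of_forall fun g => ?_)
  have h0 := inTangentCoordinates_eq (I := 𝓘(ℝ, E)) (I' := 𝓘(ℝ, ℝ)) (fun _ : G => (1 : G))
    (fun g : G => (f : G ⧸ H → ℝ) ((1 : G) • (g : G ⧸ H)))
    (fun g : G => mfderiv 𝓘(ℝ, E) 𝓘(ℝ, ℝ) (fun a : G => (f : G ⧸ H → ℝ) (a • (g : G ⧸ H))) 1)
    (x₀ := g₀) (x := g) (mem_chart_source E (1 : G)) (by simp [chartAt_self_eq])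
  have h1 := (tangentBundleCore 𝓘(ℝ, E) G).coordChange_self (achart E (1 : G)) 1
    (mem_chart_source E (1 : G)) (show E from X)
  rw [tangentBundleCore_coordChange_model_space] at h0
  refine Eq.trans ?_ (DFunLike.congr_fun h0 (show E from X)).symm
  exact (congrArg (fun Y : E => (show E →L[ℝ] ℝ from
    mfderiv 𝓘(ℝ, E) 𝓘(ℝ, ℝ) (fun a : G => (f : G ⧸ H → ℝ) (a • (g : G ⧸ H))) 1) Y) h1).symm

/-- The vector field `v_X` on `G/H`, as a derivation of smooth functions:
`(v_X f)(x) = d/dt f (exp (-t X) x)` at `t = 0`, written as a derivative along the orbit map.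
These are the infinitesimal generators of the translations `translate (exp (t X))`, and
`[v_X, v_Y] = v_[X, Y]`. -/
def vf (X : GroupLieAlgebra 𝓘(ℝ, E) G) : Module.End ℝ (smoothFn E H) where
  toFun f := ⟨fun x => -mvfderiv 𝓘(ℝ, E) (fun a : G => (f : G ⧸ H → ℝ) (a • x)) 1 X,
    (contMDiff_orbit_deriv f X).neg⟩
  map_add' f g := by
    ext x
    have h := mvfderiv_fun_add
      ((contMDiff_orbit f x).mdifferentiableAt (x := 1) (by simp))
      ((contMDiff_orbit g x).mdifferentiableAt (x := 1) (by simp))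
    simp only [Submodule.coe_add, Pi.add_apply, h, add_apply]
    ring
  map_smul' c f := by
    ext x
    have h := mvfderiv_fun_smul (mdifferentiableAt_const (c := c))
      ((contMDiff_orbit f x).mdifferentiableAt (x := 1) (by simp))
    simp only [smul_eq_mul] at h
    simp [h, mvfderiv_const]

variable {ι : Type*} [Fintype ι] [DecidableEq ι]
  (T : Module.Basis ι ℝ (GroupLieAlgebra 𝓘(ℝ, E) G))

/-- The operator `e^{φ^i v_i}`: translation by `exp (φ^i T_i)`. -/
def expV (φ : ι → ℝ) : Module.End ℝ (smoothFn E H) := translate (lieExp (∑ i, φ i • T i))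

/-- The operator `K^{ij} v_i v_j`. -/
def casimir : Module.End ℝ (smoothFn E H) :=
  ∑ i, ∑ j, (killing T)⁻¹ i j • (vf (T i) * vf (T j))

/-- A linear functional on smooth functions is a distribution on the compact manifold `G/H` if it
is continuous for the `C^∞` topology, i.e. bounded by a multiple of the sup norms of finitely many
of the derivatives `v_{i_1} ⋯ v_{i_m} h` (the `v_i` span every tangent space). -/
def IsDistribution (U : smoothFn E H →ₗ[ℝ] ℝ) : Prop :=
  ∃ (k : ℕ) (C : ℝ), ∀ (h : smoothFn E H) (B : ℝ),
    (∀ w : List ι, w.length ≤ k → ∀ x : G ⧸ H,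
      |((w.map fun i => vf (T i)).prod h : G ⧸ H → ℝ) x| ≤ B) → |U h| ≤ C * B

/-- The action of the vector field `v_X` on distributions, `(v_X U)(h) = -U (v_X h)`. -/
def distVf (X : GroupLieAlgebra 𝓘(ℝ, E) G) (U : smoothFn E H →ₗ[ℝ] ℝ) :
    smoothFn E H →ₗ[ℝ] ℝ := -(U ∘ₗ vf X)

/-- The operator `(1/2) K^{ij} v_i v_j - J^i v_i` on distributions. -/
def distGenerator (J : ι → ℝ) (U : smoothFn E H →ₗ[ℝ] ℝ) : smoothFn E H →ₗ[ℝ] ℝ :=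
  (1 / 2 : ℝ) • ∑ i, ∑ j, (killing T)⁻¹ i j • distVf (T i) (distVf (T j) U)
    - ∑ i, J i • distVf (T i) U

variable [MeasurableSpace (G ⧸ H)] (μ : Measure (G ⧸ H))

/-- The pairing `∫ h f` of functions on `G/H`. -/
def pairing (h f : smoothFn E H) : ℝ :=
  ∫ x, (h : G ⧸ H → ℝ) x * (f : G ⧸ H → ℝ) x ∂μ

/-- `U s = e^{-s A} f` for `s` between `0` and `β`, where `A = (1/2) K^{ij} v_i v_j - J^i v_i`:
a curve of distributions with `U 0 = f` and `dU/ds = -A U`. The kernel `⟨x| e^{-β A} |y⟩`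
integrated against `f(y)` is the distribution `U β` in `x`. -/
structure IsShiftedHeatEvolution (β : ℝ) (J : ι → ℝ) (f : smoothFn E H)
    (U : ℝ → smoothFn E H →ₗ[ℝ] ℝ) : Prop where
  isDistribution : ∀ s ∈ Set.uIcc 0 β, IsDistribution T (U s)
  initial : ∀ h, U 0 h = pairing μ h f
  evolution : ∀ s ∈ Set.uIcc 0 β, ∀ h,
    HasDerivWithinAt (fun r => U r h) (-(distGenerator T J (U s) h)) (Set.uIcc 0 β) s

/-- The series `∑ ⟨x| e^{φ^i v_i} (-(β/2) K^{ij} v_i v_j)^n |y⟩ / n!`, integrated against `f(y)`,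
converges in the space of distributions in `x`. -/
def SeriesConverges (β : ℝ) (φ : ι → ℝ) (f : smoothFn E H) : Prop :=
  ∃ S : smoothFn E H →ₗ[ℝ] ℝ, IsDistribution T S ∧ ∀ h,
    Tendsto (fun N => ∑ n ∈ Finset.range N,
      pairing μ h (expV T φ ((((-(1 / 2) * β) • casimir T) ^ n : Module.End ℝ (smoothFn E H)) f)) / (n.factorial : ℝ))
      atTop (𝓝 (S h))

end Functions
end HomSpace
end

/- Translations by the one-parameter groups of `G` conjugate the vector fields `v_i` by the
exponential of the adjoint matrices, and the Killing tensor is invariant under these, so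
`K^{ij} v_i v_j` commutes with all translations and is symmetric for the invariant measure. A
pointwise bounded family of distributions has uniformly bounded order and constant, by
Banach-Steinhaus on the Fréchet space of smooth functions, whose seminorms are the sup norms of
the derivatives along words in the `v_i`.

Existence: convergence at `β`, tested against `(K^{ij} v_i v_j)^2 h` instead of `h`, makes the
terms `O(1/n^2)`, hence the series converges and may be differentiated termwise for all `s`
between `0` and `β`; translating by `e^{s J^i v_i}` turns the heat evolution into a solution of
the shifted equation.

Uniqueness: for a solution `W` with `W(0) = 0`, the integral of `W_s(g h) W_{a+b-s}(g h)` over `G`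
does not depend on `s` because the generator is symmetric. Comparing the endpoint with the
midpoint shows that `W` vanishes at the midpoint if it vanishes at `a`, and repeated halving
reaches `β`.

Derivative expansion: Duhamel's formula expresses `d(e^{φ^i v_i} f)` through the primitive of
`e^{-t φ^k C_k}`, which is the matrix that `u_i` inverts. On the regular set `u_i` applied to the
pairing is hence the pairing with `v_i f`. The regular set is dense since the determinant is
analytic along rays from `0`, so the limits exist and are the terms of the series. -/

noncomputable section

namespace HomSpace

open MeasureTheory Filter

theorem hasDerivAt_comp_isMIntegralCurve
    {E : Type*} [NormedAddCommGroup E] [NormedSpace ℝ E] {M : Type*} [TopologicalSpace M]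
    [ChartedSpace E M] {F : Type*} [NormedAddCommGroup F] [NormedSpace ℝ F] {Φ : M → F} {γ : ℝ → M}
    {v : (x : M) → TangentSpace 𝓘(ℝ, E) x} (hγ : IsMIntegralCurve γ v) {t : ℝ}
    (hΦ : MDifferentiableAt 𝓘(ℝ, E) 𝓘(ℝ, F) Φ (γ t)) :
    HasDerivAt (Φ ∘ γ) (mvfderiv 𝓘(ℝ, E) Φ (γ t) (v (γ t))) t := by
  have h : HasFDerivAt (Φ ∘ γ) (.toSpanSingleton ℝ (mvfderiv 𝓘(ℝ, E) Φ (γ t) (v (γ t)))) t := by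
    rw [← ContinuousLinearMap.comp_toSpanSingleton]
    exact (hΦ.hasMFDerivAt.comp t (hγ t)).hasFDerivAt
  simpa using h.hasDerivAt

section Exponential

variable {E : Type*} [NormedAddCommGroup E] [NormedSpace ℝ E]
  {G : Type*} [TopologicalSpace G] [ChartedSpace E G] [Group G]

theorem mulInvariantVectorField_one (X : GroupLieAlgebra 𝓘(ℝ, E) G) :
    mulInvariantVectorField X (1 : G) = X := by
  have h : HasMFDerivAt 𝓘(ℝ, E) 𝓘(ℝ, E) ((1 : G) * ·) 1 (.id ℝ E) :=
    (hasMFDerivAt_id 1).congr_of_eventuallyEq (.of_eq (funext one_mul))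
  exact DFunLike.congr_fun h.mfderiv X

variable [LieGroup 𝓘(ℝ, E) ∞ G]

theorem lieGroup_of_infty (n : ℕ) : LieGroup 𝓘(ℝ, E) n G :=
  LieGroup.of_le (n := ∞) (by exact_mod_cast le_top)

theorem isManifold_of_infty (n : ℕ) : IsManifold 𝓘(ℝ, E) n G :=
  IsManifold.of_le (n := ∞) (by exact_mod_cast le_top)

theorem mdifferentiableAt_mul_left (g a : G) :
    MDifferentiableAt 𝓘(ℝ, E) 𝓘(ℝ, E) (g * ·) a :=
  (contMDiff_mul_left (I := 𝓘(ℝ, E)) (n := ∞) (a := g)).mdifferentiableAt (by simp)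

theorem contMDiff_one_mulInvariantVectorField (X : GroupLieAlgebra 𝓘(ℝ, E) G) :
    ContMDiff 𝓘(ℝ, E) 𝓘(ℝ, E).tangent 1
      (fun g : G => (⟨g, mulInvariantVectorField X g⟩ : TangentBundle 𝓘(ℝ, E) G)) := by
  have : LieGroup 𝓘(ℝ, E) (minSmoothness ℝ 3) G := by simpa using lieGroup_of_infty 3
  refine (contMDiff_mulInvariantVectorField (I := 𝓘(ℝ, E)) X).of_le ?_
  rw [minSmoothness_of_isRCLikeNormedField]
  exact one_le_two

theorem mfderiv_mul_left_mulInvariantVectorField (X : GroupLieAlgebra 𝓘(ℝ, E) G) (g a : G) :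
    mfderiv 𝓘(ℝ, E) 𝓘(ℝ, E) (g * ·) a (mulInvariantVectorField X a)
      = mulInvariantVectorField X (g * a) := by
  have h := mfderiv_comp_apply_of_eq (x := (1 : G)) (mdifferentiableAt_mul_left (E := E) g a)
    (mdifferentiableAt_mul_left a 1) (mul_one a) X
  have hc : (g * ·) ∘ (a * ·) = (g * a * ·) := funext fun b => (mul_assoc g a b).symm
  rw [hc] at h
  exact h.symm

theorem isMIntegralCurveOn_mul_left {X : GroupLieAlgebra 𝓘(ℝ, E) G} {γ : ℝ → G} {s : Set ℝ}
    (hγ : IsMIntegralCurveOn (I := 𝓘(ℝ, E)) γ (mulInvariantVectorField X) s) (g : G) :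
    IsMIntegralCurveOn (I := 𝓘(ℝ, E)) (fun t => g * γ t) (mulInvariantVectorField X) s := by
  intro t ht
  refine ((mdifferentiableAt_mul_left g (γ t)).hasMFDerivAt.comp_hasMFDerivWithinAt t
    (hγ t ht)).congr_mfderiv ?_
  rw [← mfderiv_mul_left_mulInvariantVectorField X g (γ t)]
  exact ContinuousLinearMap.ext_ring (map_smul (mfderiv 𝓘(ℝ, E) 𝓘(ℝ, E) (g * ·) (γ t)) (1 : ℝ) _)

variable [T2Space G]

theorem isMIntegralCurve_mulInvariantVectorField_unique {X : GroupLieAlgebra 𝓘(ℝ, E) G}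
    {γ γ' : ℝ → G} (h : IsMIntegralCurve (I := 𝓘(ℝ, E)) γ (mulInvariantVectorField X))
    (h' : IsMIntegralCurve (I := 𝓘(ℝ, E)) γ' (mulInvariantVectorField X)) (h0 : γ 0 = γ' 0) :
    γ = γ' := by
  have := isManifold_of_infty (E := E) (G := G) 1
  exact isMIntegralCurve_Ioo_eq_of_contMDiff_boundaryless
    (contMDiff_one_mulInvariantVectorField X) h h' h0

variable [CompleteSpace E]

theorem exists_isMIntegralCurve_mulInvariantVectorField (X : GroupLieAlgebra 𝓘(ℝ, E) G) :
    ∃ γ : ℝ → G, γ 0 = 1 ∧ IsMIntegralCurve (I := 𝓘(ℝ, E)) γ (mulInvariantVectorField X) := by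
  have := isManifold_of_infty (E := E) (G := G) 1
  have hX := contMDiff_one_mulInvariantVectorField X
  obtain ⟨γ, hγ0, hγ⟩ := exists_isMIntegralCurveAt_of_contMDiffAt_boundaryless (t₀ := 0)
    (hX.contMDiffAt (x := (1 : G)))
  obtain ⟨ε, hε, hγ⟩ := isMIntegralCurveAt_iff'.1 hγ
  rw [Real.ball_eq_Ioo, zero_sub, zero_add] at hγ
  -- Left translates of `γ` start at every point and live for the same time `ε`.
  exact exists_isMIntegralCurve_of_isMIntegralCurveOn hX hε
    (fun g => ⟨fun t => g * γ t, by simp [hγ0], isMIntegralCurveOn_mul_left hγ g⟩) 1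

theorem exists_isMIntegralCurve_lieExp_eq (X : GroupLieAlgebra 𝓘(ℝ, E) G) :
    ∃ γ : ℝ → G, γ 0 = 1 ∧ IsMIntegralCurve (I := 𝓘(ℝ, E)) γ (mulInvariantVectorField X) ∧
      lieExp X = γ 1 := by
  have h := exists_isMIntegralCurve_mulInvariantVectorField X
  exact ⟨h.choose, h.choose_spec.1, h.choose_spec.2, by rw [lieExp, dif_pos h]⟩

theorem isMIntegralCurve_lieExp (X : GroupLieAlgebra 𝓘(ℝ, E) G) :
    IsMIntegralCurve (I := 𝓘(ℝ, E)) (fun t : ℝ => lieExp (t • X)) (mulInvariantVectorField X) := by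
  obtain ⟨γ, h0, hγ, -⟩ := exists_isMIntegralCurve_lieExp_eq X
  suffices h : (fun t : ℝ => lieExp (t • X)) = γ by rwa [h]
  ext t
  obtain ⟨γ', h0', hγ', h1⟩ := exists_isMIntegralCurve_lieExp_eq (t • X)
  have hγt := hγ.comp_mul t
  rw [← mulInvariantVectorField_smul] at hγt
  rw [h1, isMIntegralCurve_mulInvariantVectorField_unique hγ' hγt (by simp [h0, h0'])]
  simp

theorem lieExp_zero : lieExp (0 : GroupLieAlgebra 𝓘(ℝ, E) G) = 1 := by
  obtain ⟨γ, h0, hγ, h1⟩ := exists_isMIntegralCurve_lieExp_eq (0 : GroupLieAlgebra 𝓘(ℝ, E) G)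
  have hconst : IsMIntegralCurve (I := 𝓘(ℝ, E)) (fun _ : ℝ => (1 : G))
      (mulInvariantVectorField (0 : GroupLieAlgebra 𝓘(ℝ, E) G)) :=
    isMIntegralCurve_const (map_zero (mfderiv 𝓘(ℝ, E) 𝓘(ℝ, E) ((1 : G) * ·) 1))
  rw [h1, isMIntegralCurve_mulInvariantVectorField_unique hγ hconst h0]

theorem lieExp_add_smul (X : GroupLieAlgebra 𝓘(ℝ, E) G) (s t : ℝ) :
    lieExp ((s + t) • X) = lieExp (s • X) * lieExp (t • X) := by
  have hadd := (isMIntegralCurve_lieExp X).comp_add s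
  have hmul : IsMIntegralCurve (I := 𝓘(ℝ, E)) (fun t : ℝ => lieExp (s • X) * lieExp (t • X))
      (mulInvariantVectorField X) := by
    rw [isMIntegralCurve_iff_isMIntegralCurveOn]
    exact isMIntegralCurveOn_mul_left ((isMIntegralCurve_lieExp X).isMIntegralCurveOn _) _
  have := congrFun (isMIntegralCurve_mulInvariantVectorField_unique hadd hmul
    (by simp [lieExp_zero])) t
  simpa [add_comm] using this

theorem lieExp_neg (X : GroupLieAlgebra 𝓘(ℝ, E) G) : lieExp (-X) = (lieExp X)⁻¹ := by
  have := lieExp_add_smul X (-1) 1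
  rw [neg_add_cancel, zero_smul, lieExp_zero, neg_smul, one_smul] at this
  exact eq_inv_of_mul_eq_one_left this.symm

theorem continuous_lieExp_smul (X : GroupLieAlgebra 𝓘(ℝ, E) G) :
    Continuous fun t : ℝ => lieExp (t • X) :=
  (isMIntegralCurve_lieExp X).continuous

theorem hasDerivAt_comp_lieExp {F : Type*} [NormedAddCommGroup F] [NormedSpace ℝ F] {Φ : G → F}
    (hΦ : MDifferentiableAt 𝓘(ℝ, E) 𝓘(ℝ, F) Φ 1) (X : GroupLieAlgebra 𝓘(ℝ, E) G) :
    HasDerivAt (fun t : ℝ => Φ (lieExp (t • X))) (mvfderiv 𝓘(ℝ, E) Φ 1 X) 0 := by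
  have h0 : lieExp ((0 : ℝ) • X) = (1 : G) := by rw [zero_smul, lieExp_zero]
  have h := hasDerivAt_comp_isMIntegralCurve (isMIntegralCurve_lieExp X) (t := 0) (h0 ▸ hΦ)
  refine h.congr_deriv ?_
  rw [h0, mulInvariantVectorField_one]

end Exponential

section Translations

variable {E : Type*} [NormedAddCommGroup E] [NormedSpace ℝ E]
  {G : Type*} [TopologicalSpace G] [ChartedSpace E G] [Group G] [LieGroup 𝓘(ℝ, E) ∞ G]
  {H : Subgroup G}

theorem translate_apply (g : G) (f : smoothFn E H) (x : G ⧸ H) :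
    (translate g f : G ⧸ H → ℝ) x = (f : G ⧸ H → ℝ) (g⁻¹ • x) := rfl

theorem translate_mul (g g' : G) :
    translate (E := E) (H := H) (g * g') = translate g * translate g' := by
  ext f x
  simp [translate_apply, mul_smul]

theorem translate_one : translate (E := E) (H := H) (1 : G) = 1 := by
  ext f x
  simp [translate_apply]

theorem translate_inv_translate (g : G) (f : smoothFn E H) :
    translate g⁻¹ (translate g f) = f := by
  rw [← Module.End.mul_apply, ← translate_mul, inv_mul_cancel, translate_one, Module.End.one_apply]

theorem translate_translate_inv (g : G) (f : smoothFn E H) :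
    translate g (translate g⁻¹ f) = f := by
  rw [← Module.End.mul_apply, ← translate_mul, mul_inv_cancel, translate_one, Module.End.one_apply]

theorem vf_apply (X : GroupLieAlgebra 𝓘(ℝ, E) G) (f : smoothFn E H) (x : G ⧸ H) :
    (vf X f : G ⧸ H → ℝ) x
      = -mvfderiv 𝓘(ℝ, E) (fun a : G => (f : G ⧸ H → ℝ) (a • x)) 1 X := rfl

theorem mdifferentiableAt_orbit (f : smoothFn E H) (x : G ⧸ H) (a : G) :
    MDifferentiableAt 𝓘(ℝ, E) 𝓘(ℝ, ℝ) (fun a : G => (f : G ⧸ H → ℝ) (a • x)) a :=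
  (contMDiff_orbit f x).mdifferentiableAt (by simp)

variable [CompleteSpace E] [T2Space G]

theorem hasDerivAt_translate_lieExp (X : GroupLieAlgebra 𝓘(ℝ, E) G) (f : smoothFn E H)
    (x : G ⧸ H) (t : ℝ) :
    HasDerivAt (fun t : ℝ => (translate (lieExp (t • X)) f : G ⧸ H → ℝ) x)
      ((translate (lieExp (t • X)) (vf X f) : G ⧸ H → ℝ) x) t := by
  set y := (lieExp (t • X))⁻¹ • x with hy
  have hsub : ∀ s : ℝ, (lieExp (s • X) : G)⁻¹ • x = lieExp ((t - s) • X) • y := fun s => by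
    rw [hy, smul_smul, ← lieExp_neg, ← lieExp_neg, ← neg_smul, ← neg_smul, ← lieExp_add_smul]
    ring_nf
  have h := hasDerivAt_comp_lieExp (mdifferentiableAt_orbit f y 1) X
  rw [← sub_self t] at h
  simpa only [translate_apply, vf_apply, hsub, sub_self, zero_smul, lieExp_zero, one_smul]
    using h.comp_const_sub t t

end Translations

section Calculus

variable {E : Type*} [NormedAddCommGroup E] [NormedSpace ℝ E] {E' : Type*} [NormedAddCommGroup E']
  [NormedSpace ℝ E'] {F : Type*} [NormedAddCommGroup F] [NormedSpace ℝ F]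

theorem fderiv_fderiv_prod {n : E × E' → F} {p : E × E'} (hn : ContDiffAt ℝ 2 n p) (u : E)
    (v : E') :
    fderiv ℝ (fun y => fderiv ℝ (fun z => n (y, z)) p.2 v) p.1 u
      = fderiv ℝ (fderiv ℝ n) p (u, 0) (0, v) := by
  have hslice : HasFDerivAt (fun y : E => (y, p.2)) (.inl ℝ E E') p.1 :=
    hasFDerivAt_prodMk_left p.1 p.2
  have hev : (fun y => fderiv ℝ (fun z => n (y, z)) p.2 v) =ᶠ[𝓝 p.1]
      fun y => fderiv ℝ n (y, p.2) (0, v) := by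
    filter_upwards [hslice.continuousAt.eventually (hn.eventually (by simp))] with y hy
    have h := (hy.differentiableAt two_ne_zero).hasFDerivAt.comp p.2
      (hasFDerivAt_prodMk_right y p.2)
    exact DFunLike.congr_fun h.fderiv v
  have h2 : HasFDerivAt (fderiv ℝ n) (fderiv ℝ (fderiv ℝ n) p) (p.1, p.2) :=
    ((hn.fderiv_right (m := 1) one_add_one_eq_two.le).differentiableAt one_ne_zero).hasFDerivAt
  have h3 : HasFDerivAt (fun y => fderiv ℝ n (y, p.2) (0, v)) _ p.1 :=
    (h2.comp p.1 hslice).clm_apply (hasFDerivAt_const (0, v) p.1)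
  rw [hev.fderiv_eq, h3.fderiv]
  simp

theorem fderiv_fderiv_prod_comm {n : E × E' → F} {p : E × E'} (hn : ContDiffAt ℝ 2 n p) (u : E)
    (v : E') :
    fderiv ℝ (fun y => fderiv ℝ (fun z => n (y, z)) p.2 v) p.1 u
      = fderiv ℝ (fun z => fderiv ℝ (fun y => n (y, z)) p.1 u) p.2 v := by
  let e : (E' × E) ≃L[ℝ] E × E' := ContinuousLinearEquiv.prodComm ℝ E' E
  have h := fderiv_fderiv_prod (n := n ∘ e) (p := p.swap)
    (hn.comp p.swap e.contDiff.contDiffAt) v u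
  have hd : fderiv ℝ (n ∘ e) = fun q => (fderiv ℝ n (e q)).comp (e : E' × E →L[ℝ] E × E') :=
    funext fun q => e.comp_right_fderiv
  have h2 : HasFDerivAt (fderiv ℝ n) (fderiv ℝ (fderiv ℝ n) p) (e p.swap) :=
    ((hn.fderiv_right (m := 1) one_add_one_eq_two.le).differentiableAt one_ne_zero).hasFDerivAt
  have h3 : HasFDerivAt (fun q => (fderiv ℝ n (e q)).comp (e : E' × E →L[ℝ] E × E')) _ p.swap :=
    (h2.comp p.swap e.hasFDerivAt).clm_comp (hasFDerivAt_const _ p.swap)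
  rw [hd, h3.fderiv] at h
  rw [fderiv_fderiv_prod hn, (hn.isSymmSndFDerivAt (by simp)).eq (u, 0) (0, v)]
  refine Eq.trans ?_ h.symm
  simp [e]

end Calculus

section Manifold

variable {E : Type*} [NormedAddCommGroup E] [NormedSpace ℝ E] {M : Type*} [TopologicalSpace M]
  [ChartedSpace E M] {F : Type*} [NormedAddCommGroup F] [NormedSpace ℝ F]

theorem mvfderiv_eq_fderiv_comp_extChartAt_symm {Φ : M → F} {x : M}
    (hΦ : MDifferentiableAt 𝓘(ℝ, E) 𝓘(ℝ, F) Φ x) (X : TangentSpace 𝓘(ℝ, E) x) :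
    mvfderiv 𝓘(ℝ, E) Φ x X
      = fderiv ℝ (fun y => Φ ((extChartAt 𝓘(ℝ, E) x).symm y)) (extChartAt 𝓘(ℝ, E) x x) X := by
  refine (DFunLike.congr_fun hΦ.mfderiv X).trans ?_
  simp only [modelWithCornersSelf_coe, Set.range_id, fderivWithin_univ]
  rfl

theorem mvfderiv_diag {N : M → M → F} {x : M}
    (hN : MDifferentiableAt (𝓘(ℝ, E).prod 𝓘(ℝ, E)) 𝓘(ℝ, F) (Function.uncurry N) (x, x))
    (X : TangentSpace 𝓘(ℝ, E) x) :
    mvfderiv 𝓘(ℝ, E) (fun y => N y y) x X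
      = mvfderiv 𝓘(ℝ, E) (fun y => N y x) x X + mvfderiv 𝓘(ℝ, E) (fun y => N x y) x X := by
  have hdiag : HasMFDerivAt 𝓘(ℝ, E) (𝓘(ℝ, E).prod 𝓘(ℝ, E)) (fun y : M => (y, y)) x
      ((ContinuousLinearMap.id ℝ E).prod (.id ℝ E)) :=
    (hasMFDerivAt_id x).prodMk (hasMFDerivAt_id x)
  have h := mfderiv_comp_apply (I'' := 𝓘(ℝ, F)) (f := fun y : M => (y, y)) x hN
    hdiag.mdifferentiableAt X
  rw [hdiag.mfderiv] at h
  exact h.trans (mfderiv_prod_eq_add_apply hN)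

theorem fderiv_comp_extChartAt_symm_mpullback [IsManifold 𝓘(ℝ, E) 1 M]
    {Φ : M → F} {x : M} {y : E} (hy : y ∈ (extChartAt 𝓘(ℝ, E) x).target)
    (hΦ : MDifferentiableAt 𝓘(ℝ, E) 𝓘(ℝ, F) Φ ((extChartAt 𝓘(ℝ, E) x).symm y))
    (V : (x : M) → TangentSpace 𝓘(ℝ, E) x) :
    fderiv ℝ (Φ ∘ (extChartAt 𝓘(ℝ, E) x).symm) y
        (VectorField.mpullback 𝓘(ℝ, E) 𝓘(ℝ, E) (extChartAt 𝓘(ℝ, E) x).symm V y)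
      = mvfderiv 𝓘(ℝ, E) Φ ((extChartAt 𝓘(ℝ, E) x).symm y)
          (V ((extChartAt 𝓘(ℝ, E) x).symm y)) := by
  have hinv := isInvertible_mfderivWithin_extChartAt_symm hy
  rw [modelWithCornersSelf_coe, Set.range_id, mfderivWithin_univ] at hinv
  have hd : MDifferentiableAt 𝓘(ℝ, E) 𝓘(ℝ, E) (extChartAt 𝓘(ℝ, E) x).symm y :=
    mdifferentiableAt_of_isInvertible_mfderiv hinv
  rw [← mfderiv_eq_fderiv]
  refine (mfderiv_comp_apply y hΦ hd _).trans ?_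
  rw [VectorField.mpullback_apply, hinv.self_apply_inverse]
  rfl

theorem differentiableAt_mpullback_extChartAt_symm [CompleteSpace E] [IsManifold 𝓘(ℝ, E) 2 M]
    {x : M} {V : (x : M) → TangentSpace 𝓘(ℝ, E) x}
    (hV : MDifferentiableAt 𝓘(ℝ, E) 𝓘(ℝ, E).tangent
      (fun y => (⟨y, V y⟩ : TangentBundle 𝓘(ℝ, E) M)) x) :
    DifferentiableAt ℝ
      (VectorField.mpullback 𝓘(ℝ, E) 𝓘(ℝ, E) (extChartAt 𝓘(ℝ, E) x).symm V : E → E)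
      (extChartAt 𝓘(ℝ, E) x x) := by
  have h := hV.mdifferentiableWithinAt (s := Set.univ)
    |>.differentiableWithinAt_mpullbackWithin_vectorField
  simp only [modelWithCornersSelf_coe, Set.range_id, VectorField.mpullbackWithin_univ,
    Set.preimage_univ, Set.univ_inter] at h
  exact h.differentiableAt Filter.univ_mem

theorem fderiv_fderiv_comp_extChartAt_symm_mpullback [CompleteSpace E] [IsManifold 𝓘(ℝ, E) 1 M]
    {Φ : M → F} {x : M} (hΦ : MDifferentiable 𝓘(ℝ, E) 𝓘(ℝ, F) Φ)
    {V W : (x : M) → TangentSpace 𝓘(ℝ, E) x}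
    (hΦV : MDifferentiableAt 𝓘(ℝ, E) 𝓘(ℝ, F) (fun y => mvfderiv 𝓘(ℝ, E) Φ y (V y)) x) :
    fderiv ℝ (fun y => fderiv ℝ (Φ ∘ (extChartAt 𝓘(ℝ, E) x).symm) y
        (VectorField.mpullback 𝓘(ℝ, E) 𝓘(ℝ, E) (extChartAt 𝓘(ℝ, E) x).symm V y))
        (extChartAt 𝓘(ℝ, E) x x)
        (VectorField.mpullback 𝓘(ℝ, E) 𝓘(ℝ, E) (extChartAt 𝓘(ℝ, E) x).symm W
          (extChartAt 𝓘(ℝ, E) x x))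
      = mvfderiv 𝓘(ℝ, E) (fun y => mvfderiv 𝓘(ℝ, E) Φ y (V y)) x (W x) := by
  have hx := extChartAt_to_inv (I := 𝓘(ℝ, E)) x
  have hev : (fun y => fderiv ℝ (Φ ∘ (extChartAt 𝓘(ℝ, E) x).symm) y
        (VectorField.mpullback 𝓘(ℝ, E) 𝓘(ℝ, E) (extChartAt 𝓘(ℝ, E) x).symm V y))
      =ᶠ[𝓝 (extChartAt 𝓘(ℝ, E) x x)]
        (fun y => mvfderiv 𝓘(ℝ, E) Φ y (V y)) ∘ (extChartAt 𝓘(ℝ, E) x).symm := by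
    filter_upwards [extChartAt_target_mem_nhds x] with y hy
    exact fderiv_comp_extChartAt_symm_mpullback hy (hΦ _) V
  rw [hev.fderiv_eq, fderiv_comp_extChartAt_symm_mpullback (mem_extChartAt_target x)
    (hx.symm ▸ hΦV), hx]

theorem mvfderiv_mpullback_extChartAt [IsManifold 𝓘(ℝ, E) 1 M] {Φ : M → F} {x : M}
    (hΦ : DifferentiableAt ℝ (Φ ∘ (extChartAt 𝓘(ℝ, E) x).symm) (extChartAt 𝓘(ℝ, E) x x))
    (Z : (y : E) → TangentSpace 𝓘(ℝ, E) y) :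
    mvfderiv 𝓘(ℝ, E) Φ x
        (VectorField.mpullback 𝓘(ℝ, E) 𝓘(ℝ, E) (extChartAt 𝓘(ℝ, E) x) Z x)
      = fderiv ℝ (Φ ∘ (extChartAt 𝓘(ℝ, E) x).symm) (extChartAt 𝓘(ℝ, E) x x)
          (Z (extChartAt 𝓘(ℝ, E) x x)) := by
  have hinv := isInvertible_mfderiv_extChartAt (mem_extChartAt_source (I := 𝓘(ℝ, E)) x)
  have hev : Φ =ᶠ[𝓝 x] (Φ ∘ (extChartAt 𝓘(ℝ, E) x).symm) ∘ extChartAt 𝓘(ℝ, E) x := by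
    filter_upwards [extChartAt_source_mem_nhds (I := 𝓘(ℝ, E)) x] with y hy
    simp only [Function.comp_apply, PartialEquiv.left_inv _ hy]
  refine (DFunLike.congr_fun hev.mfderiv_eq _).trans ?_
  refine (mfderiv_comp_apply x hΦ.mdifferentiableAt
    (mdifferentiableAt_of_isInvertible_mfderiv hinv) _).trans ?_
  rw [VectorField.mpullback_apply, hinv.self_apply_inverse, mfderiv_eq_fderiv]
  rfl

theorem mvfderiv_mlieBracket [CompleteSpace E] [IsManifold 𝓘(ℝ, E) 2 M] {Φ : M → F} {x : M}
    (hΦ : ContMDiff 𝓘(ℝ, E) 𝓘(ℝ, F) 2 Φ) {V W : (x : M) → TangentSpace 𝓘(ℝ, E) x}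
    (hV : MDifferentiableAt 𝓘(ℝ, E) 𝓘(ℝ, E).tangent
      (fun y => (⟨y, V y⟩ : TangentBundle 𝓘(ℝ, E) M)) x)
    (hW : MDifferentiableAt 𝓘(ℝ, E) 𝓘(ℝ, E).tangent
      (fun y => (⟨y, W y⟩ : TangentBundle 𝓘(ℝ, E) M)) x)
    (hΦV : MDifferentiableAt 𝓘(ℝ, E) 𝓘(ℝ, F) (fun y => mvfderiv 𝓘(ℝ, E) Φ y (V y)) x)
    (hΦW : MDifferentiableAt 𝓘(ℝ, E) 𝓘(ℝ, F) (fun y => mvfderiv 𝓘(ℝ, E) Φ y (W y)) x) :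
    mvfderiv 𝓘(ℝ, E) Φ x (VectorField.mlieBracket 𝓘(ℝ, E) V W x)
      = mvfderiv 𝓘(ℝ, E) (fun y => mvfderiv 𝓘(ℝ, E) Φ y (W y)) x (V x)
        - mvfderiv 𝓘(ℝ, E) (fun y => mvfderiv 𝓘(ℝ, E) Φ y (V y)) x (W x) := by
  have : IsManifold 𝓘(ℝ, E) 1 M := .of_le (n := 2) one_le_two
  have hΦd : MDifferentiable 𝓘(ℝ, E) 𝓘(ℝ, F) Φ := hΦ.mdifferentiable two_ne_zero
  have hcd : ContDiffAt ℝ 2 (Φ ∘ (extChartAt 𝓘(ℝ, E) x).symm) (extChartAt 𝓘(ℝ, E) x x) :=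
    (hΦ.contMDiffAt.comp _ ((contMDiffOn_extChartAt_symm x).contMDiffAt
      (extChartAt_target_mem_nhds x))).contDiffAt
  have hbracket : VectorField.mlieBracket 𝓘(ℝ, E) V W x
      = VectorField.mpullback 𝓘(ℝ, E) 𝓘(ℝ, E) (extChartAt 𝓘(ℝ, E) x)
        (VectorField.lieBracket ℝ
          (VectorField.mpullback 𝓘(ℝ, E) 𝓘(ℝ, E) (extChartAt 𝓘(ℝ, E) x).symm V)
          (VectorField.mpullback 𝓘(ℝ, E) 𝓘(ℝ, E) (extChartAt 𝓘(ℝ, E) x).symm W)) x := by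
    rw [VectorField.mlieBracket, VectorField.mlieBracketWithin_apply]
    simp only [Set.preimage_univ, modelWithCornersSelf_coe, Set.range_id, Set.univ_inter,
      VectorField.mpullbackWithin_univ]
    exact congrArg (fun Z : E → E => (mfderiv 𝓘(ℝ, E) 𝓘(ℝ, E) (extChartAt 𝓘(ℝ, E) x) x).inverse
      (Z (extChartAt 𝓘(ℝ, E) x x))) VectorField.lieBracketWithin_univ
  refine (congrArg (mvfderiv 𝓘(ℝ, E) Φ x) hbracket).trans
    ((mvfderiv_mpullback_extChartAt (hcd.differentiableAt two_ne_zero) _).trans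
      ((VectorField.fderiv_apply_lieBracket hcd (by simp)
        (differentiableAt_mpullback_extChartAt_symm hW)
        (differentiableAt_mpullback_extChartAt_symm hV)).trans ?_))
  exact congrArg₂ (· - ·) (fderiv_fderiv_comp_extChartAt_symm_mpullback hΦd hΦW)
    (fderiv_fderiv_comp_extChartAt_symm_mpullback hΦd hΦV)

end Manifold

section MixedDerivative

variable {E : Type*} [NormedAddCommGroup E] [NormedSpace ℝ E] {M : Type*} [TopologicalSpace M]
  [ChartedSpace E M] [IsManifold 𝓘(ℝ, E) ∞ M]
  {F : Type*} [NormedAddCommGroup F] [NormedSpace ℝ F]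

theorem contMDiff_mvfderiv_param {EP HP P : Type*} [NormedAddCommGroup EP] [NormedSpace ℝ EP]
    [TopologicalSpace HP] {I : ModelWithCorners ℝ EP HP} [TopologicalSpace P] [ChartedSpace HP P]
    [IsManifold I ∞ P] {N : P → M → F}
    (hN : ContMDiff (I.prod 𝓘(ℝ, E)) 𝓘(ℝ, F) ∞ (Function.uncurry N)) (x : M)
    (X : TangentSpace 𝓘(ℝ, E) x) :
    ContMDiff I 𝓘(ℝ, F) ∞ fun p : P => mvfderiv 𝓘(ℝ, E) (N p) x X := by
  have : IsManifold 𝓘(ℝ, E) 1 M := .of_le (n := ∞) (by simp)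
  have : IsManifold I 1 P := .of_le (n := ∞) (by simp)
  intro p₀
  have hsmooth := ContMDiffAt.mfderiv_apply (m := ∞) (n := ∞) (x₀ := p₀)
    N (fun _ : P => x) (id : P → P) (fun _ : P => (show E from X)) hN.contMDiffAt
    contMDiffAt_const contMDiffAt_id contMDiffAt_const (by simp)
  refine hsmooth.congr_of_eventuallyEq (Eventually.of_forall fun p => ?_)
  have hcoord := inTangentCoordinates_eq (I := 𝓘(ℝ, E)) (I' := 𝓘(ℝ, F)) (fun _ : P => x)
    (fun p : P => N p x) (fun p : P => mfderiv 𝓘(ℝ, E) 𝓘(ℝ, F) (N p) x)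
    (x₀ := p₀) (x := p) (mem_chart_source E x) (by simp [chartAt_self_eq])
  rw [tangentBundleCore_coordChange_model_space] at hcoord
  have hself := (tangentBundleCore 𝓘(ℝ, E) M).coordChange_self (achart E x) x
    (mem_chart_source E x) (show E from X)
  refine Eq.trans ?_ (DFunLike.congr_fun hcoord (show E from X)).symm
  exact (congrArg (fun Y : E => (show E →L[ℝ] F from
    mfderiv 𝓘(ℝ, E) 𝓘(ℝ, F) (N p) x) Y) hself).symm

variable {E' : Type*} [NormedAddCommGroup E'] [NormedSpace ℝ E'] {M' : Type*} [TopologicalSpace M']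
  [ChartedSpace E' M'] [IsManifold 𝓘(ℝ, E') ∞ M']

theorem contDiffAt_comp_extChartAt_symm_prod {N : M × M' → F}
    (hN : ContMDiff (𝓘(ℝ, E).prod 𝓘(ℝ, E')) 𝓘(ℝ, F) ∞ N) (x : M) (y : M') :
    ContDiffAt ℝ ∞
      (fun p : E × E' => N ((extChartAt 𝓘(ℝ, E) x).symm p.1, (extChartAt 𝓘(ℝ, E') y).symm p.2))
      (extChartAt 𝓘(ℝ, E) x x, extChartAt 𝓘(ℝ, E') y y) := by
  have h1 := ((contMDiffOn_extChartAt_symm (I := 𝓘(ℝ, E)) (n := ∞) x).contMDiffAt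
    (extChartAt_target_mem_nhds x)).comp (extChartAt 𝓘(ℝ, E) x x, extChartAt 𝓘(ℝ, E') y y)
    (contDiff_fst (𝕜 := ℝ) (F := E')).contMDiff.contMDiffAt
  have h2 := ((contMDiffOn_extChartAt_symm (I := 𝓘(ℝ, E')) (n := ∞) y).contMDiffAt
    (extChartAt_target_mem_nhds y)).comp (extChartAt 𝓘(ℝ, E) x x, extChartAt 𝓘(ℝ, E') y y)
    (contDiff_snd (𝕜 := ℝ) (E := E)).contMDiff.contMDiffAt
  exact (hN.contMDiffAt.comp _ (h1.prodMk h2)).contDiffAt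

theorem mvfderiv_mvfderiv_eq_fderiv_fderiv {N : M → M' → F}
    (hN : ContMDiff (𝓘(ℝ, E).prod 𝓘(ℝ, E')) 𝓘(ℝ, F) ∞ (Function.uncurry N)) (x : M) (y : M')
    (X : TangentSpace 𝓘(ℝ, E) x) (Y : TangentSpace 𝓘(ℝ, E') y) :
    mvfderiv 𝓘(ℝ, E) (fun a => mvfderiv 𝓘(ℝ, E') (N a) y Y) x X
      = fderiv ℝ (fun a => fderiv ℝ (fun b => N ((extChartAt 𝓘(ℝ, E) x).symm a)
          ((extChartAt 𝓘(ℝ, E') y).symm b)) (extChartAt 𝓘(ℝ, E') y y) Y)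
          (extChartAt 𝓘(ℝ, E) x x) X := by
  have hslice (a : M) : ContMDiff 𝓘(ℝ, E') 𝓘(ℝ, F) ∞ (N a) :=
    hN.comp (contMDiff_const.prodMk contMDiff_id)
  rw [mvfderiv_eq_fderiv_comp_extChartAt_symm
    ((contMDiff_mvfderiv_param hN y Y).mdifferentiableAt (by simp))]
  simp only [fun a => mvfderiv_eq_fderiv_comp_extChartAt_symm
    ((hslice a).mdifferentiableAt (by simp)) Y]

theorem mvfderiv_mvfderiv_comm {N : M → M' → F}
    (hN : ContMDiff (𝓘(ℝ, E).prod 𝓘(ℝ, E')) 𝓘(ℝ, F) ∞ (Function.uncurry N)) (x : M) (y : M')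
    (X : TangentSpace 𝓘(ℝ, E) x) (Y : TangentSpace 𝓘(ℝ, E') y) :
    mvfderiv 𝓘(ℝ, E) (fun a => mvfderiv 𝓘(ℝ, E') (N a) y Y) x X
      = mvfderiv 𝓘(ℝ, E') (fun b => mvfderiv 𝓘(ℝ, E) (fun a => N a b) x X) y Y := by
  rw [mvfderiv_mvfderiv_eq_fderiv_fderiv hN, mvfderiv_mvfderiv_eq_fderiv_fderiv
    (N := fun b a => N a b) (hN.comp (contMDiff_snd.prodMk contMDiff_fst))]
  exact fderiv_fderiv_prod_comm
    ((contDiffAt_comp_extChartAt_symm_prod hN x y).of_le ENat.LEInfty.out) X Y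

end MixedDerivative

section Bracket

variable {E : Type*} [NormedAddCommGroup E] [NormedSpace ℝ E]
  {G : Type*} [TopologicalSpace G] [ChartedSpace E G] [Group G] [LieGroup 𝓘(ℝ, E) ∞ G]

theorem mvfderiv_mulInvariantVectorField {F : Type*} [NormedAddCommGroup F] [NormedSpace ℝ F]
    {Φ : G → F} {g : G} (hΦ : MDifferentiableAt 𝓘(ℝ, E) 𝓘(ℝ, F) Φ g)
    (X : GroupLieAlgebra 𝓘(ℝ, E) G) :
    mvfderiv 𝓘(ℝ, E) Φ g (mulInvariantVectorField X g)
      = mvfderiv 𝓘(ℝ, E) (fun b => Φ (g * b)) 1 X :=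
  (mfderiv_comp_apply_of_eq 1 hΦ (mdifferentiableAt_mul_left g 1) (mul_one g) X).symm

theorem mvfderiv_one_bracket [CompleteSpace E] {Φ : G → ℝ}
    (hΦ : ContMDiff 𝓘(ℝ, E) 𝓘(ℝ, ℝ) ∞ Φ) (X Y : GroupLieAlgebra 𝓘(ℝ, E) G) :
    mvfderiv 𝓘(ℝ, E) Φ 1 ⁅X, Y⁆
      = mvfderiv 𝓘(ℝ, E) (fun a => mvfderiv 𝓘(ℝ, E) (fun b => Φ (a * b)) 1 Y) 1 X
        - mvfderiv 𝓘(ℝ, E) (fun a => mvfderiv 𝓘(ℝ, E) (fun b => Φ (a * b)) 1 X) 1 Y := by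
  have := isManifold_of_infty (E := E) (G := G) 2
  have hinvariant (Z : GroupLieAlgebra 𝓘(ℝ, E) G) :
      (fun a => mvfderiv 𝓘(ℝ, E) (fun b => Φ (a * b)) 1 Z)
        = fun a => mvfderiv 𝓘(ℝ, E) Φ a (mulInvariantVectorField Z a) := funext fun a =>
    (mvfderiv_mulInvariantVectorField (hΦ.mdifferentiableAt (by simp)) Z).symm
  have hsmooth (Z : GroupLieAlgebra 𝓘(ℝ, E) G) : MDifferentiableAt 𝓘(ℝ, E) 𝓘(ℝ, ℝ)
      (fun a => mvfderiv 𝓘(ℝ, E) Φ a (mulInvariantVectorField Z a)) 1 := by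
    rw [← hinvariant]
    exact (contMDiff_mvfderiv_param (N := fun a b => Φ (a * b))
      (hΦ.comp (contMDiff_fst.mul contMDiff_snd)) 1 Z).mdifferentiableAt (by simp)
  have hfield (Z : GroupLieAlgebra 𝓘(ℝ, E) G) :=
    (contMDiff_one_mulInvariantVectorField Z).mdifferentiableAt (x := (1 : G)) (by simp)
  rw [hinvariant, hinvariant, GroupLieAlgebra.bracket_def,
    mvfderiv_mlieBracket (hΦ.of_le ENat.LEInfty.out) (hfield X) (hfield Y) (hsmooth X) (hsmooth Y),
    mulInvariantVectorField_one, mulInvariantVectorField_one]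

variable {H : Subgroup G}

theorem vf_vf_apply (X Y : GroupLieAlgebra 𝓘(ℝ, E) G) (f : smoothFn E H) (x : G ⧸ H) :
    (vf X (vf Y f) : G ⧸ H → ℝ) x = mvfderiv 𝓘(ℝ, E)
      (fun a => mvfderiv 𝓘(ℝ, E) (fun b => (f : G ⧸ H → ℝ) ((a * b) • x)) 1 X) 1 Y := by
  have hvf (a : G) : (vf Y f : G ⧸ H → ℝ) (a • x)
      = -mvfderiv 𝓘(ℝ, E) (fun b : G => (f : G ⧸ H → ℝ) ((b * a) • x)) 1 Y := by
    simp only [vf_apply, mul_smul]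
  rw [vf_apply]
  simp only [hvf]
  rw [mvfderiv_fun_neg]
  simp only [neg_apply, neg_neg]
  exact mvfderiv_mvfderiv_comm (N := fun a b => (f : G ⧸ H → ℝ) ((b * a) • x))
    ((contMDiff_orbit f x).comp (contMDiff_snd.mul contMDiff_fst)) 1 1 X Y

theorem vf_bracket [CompleteSpace E] (X Y : GroupLieAlgebra 𝓘(ℝ, E) G) :
    vf (H := H) ⁅X, Y⁆ = vf X * vf Y - vf Y * vf X := by
  ext f x
  simp only [LinearMap.sub_apply, Module.End.mul_apply, Submodule.coe_sub, Pi.sub_apply,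
    vf_vf_apply]
  rw [vf_apply, mvfderiv_one_bracket (contMDiff_orbit f x)]
  ring

theorem vf_add (X Y : GroupLieAlgebra 𝓘(ℝ, E) G) : vf (H := H) (X + Y) = vf X + vf Y := by
  ext f x
  simp only [LinearMap.add_apply, Submodule.coe_add, Pi.add_apply, vf_apply, map_add]
  ring

theorem vf_smul (c : ℝ) (X : GroupLieAlgebra 𝓘(ℝ, E) G) : vf (H := H) (c • X) = c • vf X := by
  ext f x
  simp only [LinearMap.smul_apply, Submodule.coe_smul, Pi.smul_apply, vf_apply, map_smul,
    smul_eq_mul]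
  ring

theorem vf_neg (X : GroupLieAlgebra 𝓘(ℝ, E) G) : vf (H := H) (-X) = -vf X := by
  ext f x
  simp only [LinearMap.neg_apply, Submodule.coe_neg, Pi.neg_apply, vf_apply, map_neg]

end Bracket

section Conjugation

variable {E : Type*} [NormedAddCommGroup E] [NormedSpace ℝ E] [CompleteSpace E]
  {G : Type*} [TopologicalSpace G] [ChartedSpace E G] [Group G] [LieGroup 𝓘(ℝ, E) ∞ G] [T2Space G]

theorem mvfderiv_one_inv {Φ : G → ℝ} (hΦ : MDifferentiableAt 𝓘(ℝ, E) 𝓘(ℝ, ℝ) Φ 1)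
    (X : GroupLieAlgebra 𝓘(ℝ, E) G) :
    mvfderiv 𝓘(ℝ, E) (fun g => Φ g⁻¹) 1 X = -mvfderiv 𝓘(ℝ, E) Φ 1 X := by
  have hΦinv : MDifferentiableAt 𝓘(ℝ, E) 𝓘(ℝ, ℝ) (fun g => Φ g⁻¹) 1 :=
    hΦ.comp_of_eq 1 ((contMDiff_inv 𝓘(ℝ, E) ∞).mdifferentiableAt (by simp)) inv_one
  have hleft := hasDerivAt_comp_lieExp hΦinv X
  simp only [← lieExp_neg, ← neg_smul] at hleft
  have hright : HasDerivAt (fun t : ℝ => Φ (lieExp (t • X))) (mvfderiv 𝓘(ℝ, E) Φ 1 X) (0 - 0) := by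
    rw [sub_zero]
    exact hasDerivAt_comp_lieExp hΦ X
  refine hleft.unique ?_
  simpa only [zero_sub] using hright.comp_const_sub 0 0

theorem mvfderiv_one_conj {Φ : G → ℝ} (hΦ : ContMDiff 𝓘(ℝ, E) 𝓘(ℝ, ℝ) ∞ Φ) (b : G)
    (X : GroupLieAlgebra 𝓘(ℝ, E) G) :
    mvfderiv 𝓘(ℝ, E) (fun g => Φ (g⁻¹ * b * g)) 1 X
      = mvfderiv 𝓘(ℝ, E) (fun g => Φ (b * g)) 1 X - mvfderiv 𝓘(ℝ, E) (fun g => Φ (g * b)) 1 X := by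
  have hprod : ContMDiff (𝓘(ℝ, E).prod 𝓘(ℝ, E)) 𝓘(ℝ, ℝ) ∞
      (Function.uncurry fun g g' : G => Φ (g⁻¹ * b * g')) :=
    hΦ.comp ((contMDiff_fst.inv.mul contMDiff_const).mul contMDiff_snd)
  have hright : ContMDiff 𝓘(ℝ, E) 𝓘(ℝ, ℝ) ∞ fun g => Φ (g * b) :=
    hΦ.comp (contMDiff_id.mul contMDiff_const)
  rw [mvfderiv_diag (hprod.mdifferentiableAt (by simp))]
  simp only [inv_one, one_mul, mul_one]
  rw [mvfderiv_one_inv (hright.mdifferentiableAt (by simp)), neg_add_eq_sub]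

variable {H : Subgroup G}

theorem hasDerivAt_conj_vf_zero (A Z : GroupLieAlgebra 𝓘(ℝ, E) G) (f : smoothFn E H) (x : G ⧸ H) :
    HasDerivAt (fun s : ℝ => (vf Z (translate (lieExp (s • A)) f) : G ⧸ H → ℝ) (lieExp (s • A) • x))
      (-(vf ⁅A, Z⁆ f : G ⧸ H → ℝ) x) 0 := by
  set Φ : G → ℝ := fun a => (f : G ⧸ H → ℝ) (a • x) with hΦ
  have hΦs : ContMDiff 𝓘(ℝ, E) 𝓘(ℝ, ℝ) ∞ Φ := contMDiff_orbit f x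
  have hconj : ContMDiff (𝓘(ℝ, E).prod 𝓘(ℝ, E)) 𝓘(ℝ, ℝ) ∞
      (Function.uncurry fun g b : G => Φ (g⁻¹ * b * g)) :=
    hΦs.comp ((contMDiff_fst.inv.mul contMDiff_snd).mul contMDiff_fst)
  have hmul : ContMDiff (𝓘(ℝ, E).prod 𝓘(ℝ, E)) 𝓘(ℝ, ℝ) ∞
      (Function.uncurry fun b g : G => Φ (b * g)) := hΦs.comp (contMDiff_fst.mul contMDiff_snd)
  have hmul' : ContMDiff (𝓘(ℝ, E).prod 𝓘(ℝ, E)) 𝓘(ℝ, ℝ) ∞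
      (Function.uncurry fun b g : G => Φ (g * b)) := hΦs.comp (contMDiff_snd.mul contMDiff_fst)
  have hvf : (fun s : ℝ =>
      (vf Z (translate (lieExp (s • A)) f) : G ⧸ H → ℝ) (lieExp (s • A) • x)) =
      fun s : ℝ => -mvfderiv 𝓘(ℝ, E)
        (fun b => Φ ((lieExp (s • A))⁻¹ * b * lieExp (s • A))) 1 Z := by
    ext s
    simp only [vf_apply, translate_apply, hΦ, mul_smul]
  rw [hvf]
  refine (hasDerivAt_comp_lieExp ((contMDiff_mvfderiv_param hconj 1 Z).mdifferentiableAt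
    (x := 1) (by simp)) A).neg.congr_deriv ?_
  rw [mvfderiv_mvfderiv_comm hconj 1 1 A Z]
  simp only [mvfderiv_one_conj hΦs _ A]
  rw [mvfderiv_fun_sub ((contMDiff_mvfderiv_param hmul 1 A).mdifferentiableAt (by simp))
    ((contMDiff_mvfderiv_param hmul' 1 A).mdifferentiableAt (by simp)), vf_bracket]
  simp only [sub_apply, LinearMap.sub_apply, Module.End.mul_apply,
    Submodule.coe_sub, Pi.sub_apply, vf_vf_apply]
  rw [mvfderiv_mvfderiv_comm hmul' 1 1 Z A]

theorem hasDerivAt_conj_vf (A Z : GroupLieAlgebra 𝓘(ℝ, E) G) (f : smoothFn E H) (x : G ⧸ H)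
    (t : ℝ) :
    HasDerivAt (fun s : ℝ => (vf Z (translate (lieExp (s • A)) f) : G ⧸ H → ℝ) (lieExp (s • A) • x))
      (-(vf ⁅A, Z⁆ (translate (lieExp (t • A)) f) : G ⧸ H → ℝ) (lieExp (t • A) • x)) t := by
  have h := hasDerivAt_conj_vf_zero A Z (translate (lieExp (t • A)) f) (lieExp (t • A) • x)
  rw [← sub_self t] at h
  refine (h.comp_sub_const t t).congr_of_eventuallyEq (Eventually.of_forall fun s => ?_)
  simp only [← Module.End.mul_apply, ← translate_mul, ← lieExp_add_smul, ← mul_smul, sub_add_cancel]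

end Conjugation

section MatrixODE

open scoped Matrix.Norms.Operator Matrix

variable {ι : Type*} [Fintype ι] [DecidableEq ι]

theorem hasDerivAt_exp_smul_apply (X : Matrix ι ι ℝ) (k j : ι) (t : ℝ) :
    HasDerivAt (fun t : ℝ => NormedSpace.exp (t • X) k j)
      ((X * NormedSpace.exp (t • X)) k j) t :=
  (LinearMap.toContinuousLinearMap (Matrix.entryLinearMap ℝ ℝ k j)).hasFDerivAt.comp_hasDerivAt t
    (hasDerivAt_exp_smul_const' X t)

theorem exp_mul_exp_neg (X : Matrix ι ι ℝ) : NormedSpace.exp X * NormedSpace.exp (-X) = 1 := by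
  rw [← Matrix.exp_add_of_commute _ _ (Commute.neg_right (Commute.refl X)), add_neg_cancel,
    NormedSpace.exp_zero]

theorem eq_vecMul_exp_of_hasDerivAt {X : Matrix ι ι ℝ} {y : ℝ → ι → ℝ}
    (hy : ∀ t j, HasDerivAt (fun t => y t j) (-(y t ᵥ* X) j) t) (t : ℝ) :
    y t = y 0 ᵥ* NormedSpace.exp (t • -X) := by
  have hderiv (j : ι) (t : ℝ) :
      HasDerivAt (fun t => (y t ᵥ* NormedSpace.exp (t • X)) j) 0 t := by
    have h : HasDerivAt (fun t => ∑ k, y t k * NormedSpace.exp (t • X) k j)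
        (-((y t ᵥ* X) ᵥ* NormedSpace.exp (t • X)) j
          + (y t ᵥ* (X * NormedSpace.exp (t • X))) j) t := by
      refine (HasDerivAt.fun_sum fun k _ =>
        (hy t k).mul (hasDerivAt_exp_smul_apply X k j t)).congr_deriv ?_
      simp only [Finset.sum_add_distrib, neg_mul, Finset.sum_neg_distrib]
      rfl
    exact h.congr_deriv (by rw [Matrix.vecMul_vecMul, neg_add_cancel])
  have hconst : y t ᵥ* NormedSpace.exp (t • X) = y 0 := by
    ext j
    simpa using is_const_of_deriv_eq_zero (fun t => (hderiv j t).differentiableAt)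
      (fun t => (hderiv j t).deriv) t 0
  rw [← hconst, Matrix.vecMul_vecMul, smul_neg, exp_mul_exp_neg, Matrix.vecMul_one]

end MatrixODE

section AdjointAction

variable {E : Type*} [NormedAddCommGroup E] [NormedSpace ℝ E]
  {G : Type*} [TopologicalSpace G] [ChartedSpace E G] [Group G] {ι : Type*} [Fintype ι]

/-- The element `φ^i T_i` of the Lie algebra, so that `expV T φ` is translation by
`lieExp (lieVec T φ)`. -/
def lieVec (T : Module.Basis ι ℝ (GroupLieAlgebra 𝓘(ℝ, E) G)) (φ : ι → ℝ) :
    GroupLieAlgebra 𝓘(ℝ, E) G := ∑ i, φ i • T i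

variable (T : Module.Basis ι ℝ (GroupLieAlgebra 𝓘(ℝ, E) G))

theorem lieVec_add (φ ψ : ι → ℝ) : lieVec T (φ + ψ) = lieVec T φ + lieVec T ψ := by
  simp [lieVec, add_smul, Finset.sum_add_distrib]

theorem lieVec_smul (c : ℝ) (φ : ι → ℝ) : lieVec T (c • φ) = c • lieVec T φ := by
  simp [lieVec, mul_smul, Finset.smul_sum]

theorem lieVec_neg (φ : ι → ℝ) : lieVec T (-φ) = -lieVec T φ := by
  simp [lieVec, Finset.sum_neg_distrib]

variable [LieGroup 𝓘(ℝ, E) ∞ G] {H : Subgroup G}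

theorem vf_sum {κ : Type*} (s : Finset κ) (X : κ → GroupLieAlgebra 𝓘(ℝ, E) G) :
    vf (H := H) (∑ i ∈ s, X i) = ∑ i ∈ s, vf (X i) :=
  map_sum (AddMonoidHom.mk' (vf (H := H)) vf_add) X s

theorem vf_lieVec (φ : ι → ℝ) : vf (H := H) (lieVec T φ) = ∑ i, φ i • vf (T i) := by
  simp [lieVec, vf_sum, vf_smul]

variable [CompleteSpace E]

theorem lieVec_bracket (φ : ι → ℝ) (j : ι) :
    ⁅lieVec T φ, T j⁆ = ∑ k, adMatrix T φ k j • T k := by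
  have : LieGroup 𝓘(ℝ, E) (minSmoothness ℝ 3) G := by simpa using lieGroup_of_infty 3
  rw [lieVec, sum_lie]
  simp only [smul_lie]
  rw [← T.sum_repr (∑ i, φ i • ⁅T i, T j⁆)]
  refine Finset.sum_congr rfl fun k _ => ?_
  simp [adMatrix]

theorem vf_lieVec_vf (φ : ι → ℝ) (j : ι) (f : smoothFn E H) :
    vf (lieVec T φ) (vf (T j) f)
      = vf (T j) (vf (lieVec T φ) f) + ∑ k, adMatrix T φ k j • vf (T k) f := by
  have h := LinearMap.congr_fun (vf_bracket (H := H) (lieVec T φ) (T j)) f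
  simp only [lieVec_bracket, vf_sum, vf_smul, LinearMap.sum_apply, LinearMap.smul_apply,
    LinearMap.sub_apply, Module.End.mul_apply] at h
  rw [h, add_sub_cancel]

theorem vf_translate_lieExp [DecidableEq ι] [T2Space G] (φ : ι → ℝ) (t : ℝ) (j : ι)
    (f : smoothFn E H) :
    vf (T j) (translate (lieExp (t • lieVec T φ)) f)
      = ∑ k, NormedSpace.exp (t • -adMatrix T φ) k j •
        translate (lieExp (t • lieVec T φ)) (vf (T k) f) := by
  ext x
  obtain ⟨x, rfl⟩ := MulAction.surjective (lieExp (t • lieVec T φ)) x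
  refine (congrFun (eq_vecMul_exp_of_hasDerivAt (X := adMatrix T φ)
    (y := fun s j => (vf (T j) (translate (lieExp (s • lieVec T φ)) f) : G ⧸ H → ℝ)
      (lieExp (s • lieVec T φ) • x))
    (fun s j => (hasDerivAt_conj_vf (lieVec T φ) (T j) f x s).congr_deriv ?_) t) j).trans ?_
  · simp [lieVec_bracket, vf_sum, vf_smul, Matrix.vecMul, dotProduct, mul_comm]
  · simp [Matrix.vecMul, dotProduct, lieExp_zero, translate_one, translate_apply, mul_comm]

end AdjointAction

section SupNorm

theorem hasDerivAt_continuousMap {M : Type*} [TopologicalSpace M] [CompactSpace M]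
    {F : Type*} [NormedAddCommGroup F] [NormedSpace ℝ F] {u u' : ℝ → C(M, F)}
    (hu : ∀ x t, HasDerivAt (fun t => u t x) (u' t x) t) (hu' : Continuous u') (t : ℝ) :
    HasDerivAt u (u' t) t := by
  rw [hasDerivAt_iff_isLittleO, Asymptotics.isLittleO_iff]
  intro ε hε
  obtain ⟨δ, hδ, hball⟩ := Metric.continuousAt_iff.1 hu'.continuousAt ε hε
  filter_upwards [Metric.ball_mem_nhds t hδ] with s hs
  rw [ContinuousMap.norm_le _ (by positivity)]
  intro x
  have hderiv (r : ℝ) : HasDerivAt (fun r => u r x - r • u' t x) (u' r x - u' t x) r := by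
    exact ((hu x r).fun_sub ((hasDerivAt_id r).smul_const (u' t x))).congr_deriv (by simp)
  have hbound : ∀ r ∈ Metric.ball t δ, ‖u' r x - u' t x‖ ≤ ε := fun r hr =>
    ((u' r - u' t).norm_coe_le_norm x).trans ((dist_eq_norm _ _).symm.trans_lt (hball hr)).le
  refine le_of_eq_of_le (congrArg norm ?_)
    ((convex_ball t δ).norm_image_sub_le_of_norm_hasDerivWithin_le
      (fun r _ => (hderiv r).hasDerivWithinAt) hbound (Metric.mem_ball_self hδ) hs)
  simp only [ContinuousMap.sub_apply, ContinuousMap.smul_apply, sub_smul]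
  abel

variable {E : Type*} [NormedAddCommGroup E] [NormedSpace ℝ E]
  {G : Type*} [TopologicalSpace G] [ChartedSpace E G] [Group G] {H : Subgroup G}

theorem continuous_smoothFn (f : smoothFn E H) : Continuous (f : G ⧸ H → ℝ) := by
  have hf : ContMDiff 𝓘(ℝ, E) 𝓘(ℝ, ℝ) ∞ fun a : G => (f : G ⧸ H → ℝ) (a : G ⧸ H) := f.2
  exact continuous_coinduced_dom.2 hf.continuous

/-- The inclusion of the smooth functions into `C(G ⧸ H, ℝ)`; for compact `G` it gives access to
the sup norm. -/
def toC : smoothFn E H →ₗ[ℝ] C(G ⧸ H, ℝ) where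
  toFun f := ⟨f, continuous_smoothFn f⟩
  map_add' _ _ := rfl
  map_smul' _ _ := rfl

/-- A family of smooth functions on `G/H` depending smoothly on a parameter in `G`, in the sense
that the pullback to `G × G` is jointly smooth. -/
def SmoothFamily (q : G → smoothFn E H) : Prop :=
  ContMDiff (𝓘(ℝ, E).prod 𝓘(ℝ, E)) 𝓘(ℝ, ℝ) ∞
    fun p : G × G => (q p.1 : G ⧸ H → ℝ) (p.2 : G ⧸ H)

variable [LieGroup 𝓘(ℝ, E) ∞ G]

theorem smoothFamily_translate (f : smoothFn E H) :
    SmoothFamily fun g : G => translate g f := by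
  have hf : ContMDiff 𝓘(ℝ, E) 𝓘(ℝ, ℝ) ∞ fun a : G => (f : G ⧸ H → ℝ) (a : G ⧸ H) := f.2
  exact hf.comp (contMDiff_fst.inv.mul contMDiff_snd)

theorem SmoothFamily.vf {q : G → smoothFn E H} (hq : SmoothFamily q)
    (X : GroupLieAlgebra 𝓘(ℝ, E) G) : SmoothFamily fun g => vf X (q g) := by
  have hmul : ContMDiff ((𝓘(ℝ, E).prod 𝓘(ℝ, E)).prod 𝓘(ℝ, E)) (𝓘(ℝ, E).prod 𝓘(ℝ, E)) ∞
      fun p : (G × G) × G => (p.1.1, p.2 * p.1.2) :=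
    (contMDiff_fst.comp contMDiff_fst).prodMk
      (contMDiff_snd.mul (contMDiff_snd.comp contMDiff_fst))
  have horbit : ContMDiff ((𝓘(ℝ, E).prod 𝓘(ℝ, E)).prod 𝓘(ℝ, E)) 𝓘(ℝ, ℝ) ∞
      (Function.uncurry fun (p : G × G) (b : G) =>
        (q p.1 : G ⧸ H → ℝ) ((b * p.2 : G) : G ⧸ H)) :=
    ContMDiff.comp (g := fun p : G × G => (q p.1 : G ⧸ H → ℝ) (p.2 : G ⧸ H)) hq hmul
  exact (contMDiff_mvfderiv_param horbit 1 X).neg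

theorem SmoothFamily.continuous_toC {q : G → smoothFn E H} (hq : SmoothFamily q) :
    Continuous fun g => toC (q g) := by
  have : IsTopologicalGroup G := topologicalGroup_of_lieGroup 𝓘(ℝ, E) ∞
  refine ContinuousMap.continuous_of_continuous_uncurry _ ?_
  have hquot : IsOpenQuotientMap (Prod.map (id : G → G) (QuotientGroup.mk : G → G ⧸ H)) :=
    IsOpenQuotientMap.id.prodMap ⟨QuotientGroup.mk_surjective, QuotientGroup.continuous_mk,
      QuotientGroup.isOpenMap_coe⟩
  exact hquot.isQuotientMap.continuous_iff.2 hq.continuous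

section Words

variable {ι : Type*} (T : Module.Basis ι ℝ (GroupLieAlgebra 𝓘(ℝ, E) G))

/-- The differential operator `v_{i_1} ⋯ v_{i_m}` attached to the word `i_1 ⋯ i_m`. The sup norms
of all `wordOp T w f` define the `C^∞` topology. -/
def wordOp (w : List ι) : Module.End ℝ (smoothFn E H) := (w.map fun i => vf (T i)).prod

@[simp]
theorem wordOp_nil : wordOp (H := H) T [] = 1 := rfl

@[simp]
theorem wordOp_cons (i : ι) (w : List ι) :
    wordOp (H := H) T (i :: w) = vf (T i) * wordOp T w := by simp [wordOp]

theorem wordOp_append (w w' : List ι) :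
    wordOp (H := H) T (w ++ w') = wordOp T w * wordOp T w' := by simp [wordOp]

theorem continuous_toC_wordOp_translate (w : List ι) (f : smoothFn E H) :
    Continuous fun g : G => toC (wordOp T w (translate g f)) := by
  refine SmoothFamily.continuous_toC ?_
  induction w with
  | nil => exact smoothFamily_translate f
  | cons i w ih => simpa using ih.vf (T i)

end Words

variable [CompactSpace G]

theorem norm_toC_translate (g : G) (f : smoothFn E H) :
    ‖toC (translate g f)‖ = ‖toC f‖ := by
  have hle (g : G) (f : smoothFn E H) : ‖toC (translate g f)‖ ≤ ‖toC f‖ :=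
    (ContinuousMap.norm_le _ (norm_nonneg _)).2 fun x => (toC f).norm_coe_le_norm (g⁻¹ • x)
  refine le_antisymm (hle g f) ?_
  conv_lhs => rw [← translate_inv_translate g f]
  exact hle _ _

variable [T2Space G] [CompleteSpace E]

theorem hasDerivAt_toC_translate (A : GroupLieAlgebra 𝓘(ℝ, E) G) (f : smoothFn E H) (t : ℝ) :
    HasDerivAt (fun t : ℝ => toC (translate (lieExp (t • A)) f))
      (toC (translate (lieExp (t • A)) (vf A f))) t :=
  hasDerivAt_continuousMap (u' := fun t => toC (translate (lieExp (t • A)) (vf A f)))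
    (fun x t => hasDerivAt_translate_lieExp A f x t)
    ((smoothFamily_translate (vf A f)).continuous_toC.comp (continuous_lieExp_smul A)) t

theorem vf_translate_lieExp_self (X : GroupLieAlgebra 𝓘(ℝ, E) G) (t : ℝ) (f : smoothFn E H) :
    vf X (translate (lieExp (t • X)) f) = translate (lieExp (t • X)) (vf X f) := by
  have hleft := hasDerivAt_toC_translate X (translate (lieExp (t • X)) f) 0
  have hright := (hasDerivAt_toC_translate X f (0 + t)).comp_add_const 0 t
  simp only [lieExp_add_smul, translate_mul, Module.End.mul_apply] at hright
  have heq := hleft.unique hright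
  simp only [zero_smul, lieExp_zero, translate_one, Module.End.one_apply] at heq
  ext x
  exact DFunLike.congr_fun heq x

theorem hasDerivAt_toC_wordOp_translate {ι : Type*} [Fintype ι]
    (T : Module.Basis ι ℝ (GroupLieAlgebra 𝓘(ℝ, E) G)) (φ : ι → ℝ) (w : List ι)
    (f : smoothFn E H) (t : ℝ) :
    HasDerivAt (fun t : ℝ => toC (wordOp T w (translate (lieExp (t • lieVec T φ)) f)))
      (toC (wordOp T w (translate (lieExp (t • lieVec T φ)) (vf (lieVec T φ) f)))) t := by
  classical
  induction w using List.reverseRecOn generalizing f with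
  | nil => exact hasDerivAt_toC_translate _ f t
  | append_singleton w j ih =>
    simp only [wordOp_append, wordOp_cons, wordOp_nil, mul_one, Module.End.mul_apply,
      vf_translate_lieExp, map_sum, map_smul]
    refine (HasDerivAt.fun_sum fun k _ =>
      (hasDerivAt_exp_smul_apply (-adMatrix T φ) k j t).smul (ih (vf (T k) f))).congr_deriv ?_
    simp only [vf_lieVec_vf, map_add, map_sum, map_smul, smul_add, Finset.sum_add_distrib,
      Matrix.mul_apply, Finset.sum_smul, Finset.smul_sum, smul_smul]
    rw [add_assoc, Finset.sum_comm (γ := ι), ← Finset.sum_add_distrib]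
    simp only [← Finset.sum_add_distrib, ← add_smul, Matrix.neg_apply]
    simp [mul_comm]

end SupNorm

section KillingTensor

variable {E : Type*} [NormedAddCommGroup E] [NormedSpace ℝ E]
  {G : Type*} [TopologicalSpace G] [ChartedSpace E G] [Group G]
  {ι : Type*} [Fintype ι] [DecidableEq ι] (T : Module.Basis ι ℝ (GroupLieAlgebra 𝓘(ℝ, E) G))

theorem killing_transpose : (killing T).transpose = killing T := by
  ext i j
  simp [killing, Matrix.trace_mul_comm (adMatrix T (Pi.single j 1))]

theorem killing_inv_symm (i j : ι) : (killing T)⁻¹ i j = (killing T)⁻¹ j i := by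
  have h := Matrix.transpose_nonsing_inv (killing T)
  rw [killing_transpose] at h
  exact congrFun (congrFun h j) i

variable [CompleteSpace E]

theorem adMatrix_single [LieGroup 𝓘(ℝ, E) (minSmoothness ℝ 3) G] (i : ι) :
    adMatrix T (Pi.single i 1)
      = LinearMap.toMatrix T T (LieAlgebra.ad ℝ (GroupLieAlgebra 𝓘(ℝ, E) G) (T i)) := by
  ext j l
  simp [LinearMap.toMatrix_apply, adMatrix, Pi.single_apply]

theorem killing_eq_neg_killingForm [LieGroup 𝓘(ℝ, E) (minSmoothness ℝ 3) G] (i j : ι) :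
    killing T i j = -killingForm ℝ (GroupLieAlgebra 𝓘(ℝ, E) G) (T i) (T j) := by
  simp only [killing, Matrix.of_apply, adMatrix_single, killingForm_apply_apply,
    LinearMap.trace_eq_matrix_trace ℝ T, LinearMap.toMatrix_comp T T T]

variable [LieGroup 𝓘(ℝ, E) ∞ G]

theorem killing_invariant (φ : ι → ℝ) :
    (adMatrix T φ).transpose * killing T + killing T * adMatrix T φ = 0 := by
  have : LieGroup 𝓘(ℝ, E) (minSmoothness ℝ 3) G := by simpa using lieGroup_of_infty 3
  ext i j
  have hleft : ∑ l, adMatrix T φ l i * killing T l j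
      = -killingForm ℝ (GroupLieAlgebra 𝓘(ℝ, E) G) ⁅lieVec T φ, T i⁆ (T j) := by
    rw [lieVec_bracket]
    simp [killing_eq_neg_killingForm, map_sum, LinearMap.sum_apply]
  have hright : ∑ l, killing T i l * adMatrix T φ l j
      = -killingForm ℝ (GroupLieAlgebra 𝓘(ℝ, E) G) (T i) ⁅lieVec T φ, T j⁆ := by
    rw [lieVec_bracket]
    simp [killing_eq_neg_killingForm, map_sum, mul_comm]
  simp only [Matrix.add_apply, Matrix.mul_apply, Matrix.transpose_apply, hleft, hright]
  rw [LieModule.traceForm_apply_lie_apply']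
  simp

theorem adMatrix_eq_killing_conj (hK : IsUnit (killing T).det) (φ : ι → ℝ) :
    adMatrix T φ = (killing T)⁻¹ * -(adMatrix T φ).transpose * killing T := by
  have h := eq_neg_of_add_eq_zero_right (killing_invariant T φ)
  rw [mul_assoc, neg_mul, ← h, ← mul_assoc, Matrix.nonsing_inv_mul _ hK, one_mul]

theorem exp_killing_inv (hK : IsUnit (killing T).det) (φ : ι → ℝ) (t : ℝ) :
    NormedSpace.exp (t • -adMatrix T φ) * (killing T)⁻¹
      * (NormedSpace.exp (t • -adMatrix T φ)).transpose = (killing T)⁻¹ := by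
  have hconj : t • -adMatrix T φ
      = (killing T)⁻¹ * (t • (adMatrix T φ).transpose) * ((killing T)⁻¹)⁻¹ := by
    conv_lhs => rw [adMatrix_eq_killing_conj T hK φ]
    simp [Matrix.nonsing_inv_nonsing_inv _ hK]
  have htranspose : (t • -adMatrix T φ).transpose = -(t • (adMatrix T φ).transpose) := by simp
  rw [← Matrix.exp_transpose, htranspose, hconj,
    Matrix.exp_conj _ _ ((Matrix.isUnit_iff_isUnit_det _).2 (Matrix.isUnit_nonsing_inv_det _ hK)),
    Matrix.nonsing_inv_nonsing_inv _ hK, mul_assoc _ (killing T), Matrix.mul_nonsing_inv _ hK,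
    mul_one, mul_assoc, exp_mul_exp_neg, mul_one]

end KillingTensor

section Casimir

theorem sum_reverse_four {ι N : Type*} [Fintype ι] [AddCommMonoid N] (F : ι → ι → ι → ι → N) :
    ∑ i, ∑ j, ∑ k, ∑ l, F i j k l = ∑ l, ∑ k, ∑ j, ∑ i, F i j k l := by
  have hthree (F : ι → ι → ι → N) : ∑ j, ∑ k, ∑ l, F j k l = ∑ l, ∑ k, ∑ j, F j k l :=
    (Finset.sum_congr rfl fun j _ => Finset.sum_comm).trans
      (Finset.sum_comm.trans (Finset.sum_congr rfl fun l _ => Finset.sum_comm))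
  refine (Finset.sum_congr rfl fun i _ => hthree (F i)).trans (Finset.sum_comm.trans ?_)
  exact Finset.sum_congr rfl fun l _ => Finset.sum_comm.trans
    (Finset.sum_congr rfl fun k _ => Finset.sum_comm)

variable {E : Type*} [NormedAddCommGroup E] [NormedSpace ℝ E]
  {G : Type*} [TopologicalSpace G] [ChartedSpace E G] [Group G] [LieGroup 𝓘(ℝ, E) ∞ G]
  {H : Subgroup G} {ι : Type*} [Fintype ι] [DecidableEq ι]
  (T : Module.Basis ι ℝ (GroupLieAlgebra 𝓘(ℝ, E) G))

theorem casimir_apply (f : smoothFn E H) :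
    casimir T f = ∑ i, ∑ j, (killing T)⁻¹ i j • vf (T i) (vf (T j) f) := by
  simp [casimir, LinearMap.sum_apply]

theorem casimir_apply_swap (f : smoothFn E H) :
    casimir T f = ∑ i, ∑ j, (killing T)⁻¹ i j • vf (T j) (vf (T i) f) := by
  rw [casimir_apply, Finset.sum_comm]
  exact Finset.sum_congr rfl fun i _ => Finset.sum_congr rfl fun j _ => by
    rw [killing_inv_symm]

/-- The operator `-(1/2) K^{ij} v_i v_j`, the generator of the heat semigroup on `G/H`. -/
def halfCasimir : Module.End ℝ (smoothFn E H) := (-(1 / 2) : ℝ) • casimir T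

theorem smul_casimir_pow (β : ℝ) (n : ℕ) (f : smoothFn E H) :
    (((-(1 / 2) * β) • casimir T) ^ n : Module.End ℝ (smoothFn E H)) f
      = β ^ n • (halfCasimir T ^ n) f := by
  have : (-(1 / 2) * β) • casimir (H := H) T = β • halfCasimir T := by
    rw [halfCasimir, smul_smul, mul_comm]
  rw [this, smul_pow, LinearMap.smul_apply]

theorem distGenerator_apply (J : ι → ℝ) (U : smoothFn E H →ₗ[ℝ] ℝ) (h : smoothFn E H) :
    -(distGenerator T J U h) = U (halfCasimir T h) - U (vf (lieVec T J) h) := by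
  simp only [distGenerator, distVf, LinearMap.sub_apply, LinearMap.smul_apply, LinearMap.sum_apply,
    LinearMap.neg_apply, LinearMap.comp_apply, neg_neg, smul_eq_mul, halfCasimir,
    casimir_apply_swap, vf_lieVec, map_sum, map_smul]
  simp only [mul_neg, Finset.sum_neg_distrib]
  ring

variable [CompleteSpace E] [T2Space G]

theorem casimir_translate (hK : IsUnit (killing T).det) (φ : ι → ℝ) (t : ℝ) (f : smoothFn E H) :
    casimir T (translate (lieExp (t • lieVec T φ)) f)
      = translate (lieExp (t • lieVec T φ)) (casimir T f) := by
  set g := lieExp (t • lieVec T φ) with hg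
  set X := NormedSpace.exp (t • -adMatrix T φ) with hX
  set Q := (killing T)⁻¹ with hQ
  have hvf (i j : ι) : vf (T i) (vf (T j) (translate g f))
      = ∑ k, ∑ l, (X l i * X k j) • translate g (vf (T l) (vf (T k) f)) := by
    rw [hg, vf_translate_lieExp]
    simp only [map_sum, map_smul, vf_translate_lieExp, Finset.smul_sum, smul_smul, ← hX, mul_comm]
  have hinvariant (l k : ι) : Q l k = ∑ j, ∑ i, Q i j * (X l i * X k j) := by
    refine (congrFun (congrFun (exp_killing_inv T hK φ t) l) k).symm.trans ?_
    simp only [Matrix.mul_apply, Matrix.transpose_apply, Finset.sum_mul]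
    exact Finset.sum_congr rfl fun j _ => Finset.sum_congr rfl fun i _ => by ring
  calc casimir T (translate g f)
      = ∑ i, ∑ j, ∑ k, ∑ l,
          (Q i j * (X l i * X k j)) • translate g (vf (T l) (vf (T k) f)) := by
        simp only [casimir_apply, hvf, Finset.smul_sum, smul_smul, ← hQ]
    _ = ∑ l, ∑ k, Q l k • translate g (vf (T l) (vf (T k) f)) := by
        rw [sum_reverse_four]
        exact Finset.sum_congr rfl fun l _ => Finset.sum_congr rfl fun k _ => by
          simp only [← Finset.sum_smul, ← hinvariant]
    _ = translate g (casimir T f) := by simp only [casimir_apply, map_sum, map_smul, ← hQ]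

theorem halfCasimir_translate (hK : IsUnit (killing T).det) (φ : ι → ℝ) (t : ℝ)
    (f : smoothFn E H) :
    halfCasimir T (translate (lieExp (t • lieVec T φ)) f)
      = translate (lieExp (t • lieVec T φ)) (halfCasimir T f) := by
  simp only [halfCasimir, LinearMap.smul_apply, casimir_translate T hK, map_smul]

end Casimir

section Integral

variable {M : Type*} [TopologicalSpace M] [CompactSpace M] [MeasurableSpace M]
  [OpensMeasurableSpace M] (μ : Measure M) [IsFiniteMeasure μ]

theorem integrable_continuousMap (F : C(M, ℝ)) : Integrable F μ :=
  Integrable.of_bound F.continuous.aestronglyMeasurable ‖F‖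
    (Eventually.of_forall F.norm_coe_le_norm)

/-- Integration against a finite measure as a continuous linear functional on `C(M, ℝ)`. -/
def integralCLM : C(M, ℝ) →L[ℝ] ℝ :=
  LinearMap.mkContinuous
    { toFun F := ∫ x, F x ∂μ
      map_add' F F' := integral_add (integrable_continuousMap μ F) (integrable_continuousMap μ F')
      map_smul' c F := integral_const_mul c F } (μ.real Set.univ) fun F =>
    (norm_integral_le_of_norm_le_const (Eventually.of_forall F.norm_coe_le_norm)).trans_eq
      (mul_comm _ _)

theorem integralCLM_apply (F : C(M, ℝ)) : integralCLM μ F = ∫ x, F x ∂μ := rfl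

end Integral

section Invariance

variable {E : Type*} [NormedAddCommGroup E] [NormedSpace ℝ E]
  {G : Type*} [TopologicalSpace G] [ChartedSpace E G] [Group G] [LieGroup 𝓘(ℝ, E) ∞ G]
  {H : Subgroup G} [MeasurableSpace (G ⧸ H)] [BorelSpace (G ⧸ H)]
  (μ : Measure (G ⧸ H)) [SMulInvariantMeasure G (G ⧸ H) μ]

theorem pairing_translate_translate (g : G) (h f : smoothFn E H) :
    pairing μ (translate g h) (translate g f) = pairing μ h f := by
  have : IsTopologicalGroup G := topologicalGroup_of_lieGroup 𝓘(ℝ, E) ∞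
  exact integral_smul_eq_self (μ := μ)
    (fun x => (h : G ⧸ H → ℝ) x * (f : G ⧸ H → ℝ) x) (g := g⁻¹)

theorem pairing_translate_right (g : G) (h f : smoothFn E H) :
    pairing μ h (translate g f) = pairing μ (translate g⁻¹ h) f := by
  rw [← pairing_translate_translate μ g⁻¹ h, translate_inv_translate]

end Invariance

section Pairing

variable {E : Type*} [NormedAddCommGroup E] [NormedSpace ℝ E]
  {G : Type*} [TopologicalSpace G] [ChartedSpace E G] [Group G] [CompactSpace G]
  {H : Subgroup G} [MeasurableSpace (G ⧸ H)] [BorelSpace (G ⧸ H)]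
  (μ : Measure (G ⧸ H)) [IsFiniteMeasure μ]

theorem pairing_eq (h f : smoothFn E H) : pairing μ h f = integralCLM μ (toC h * toC f) := rfl

/-- The pairing `∫ h f` as a bilinear map, so that `map_sum` and its relatives apply. -/
def pairingBilin : smoothFn E H →ₗ[ℝ] smoothFn E H →ₗ[ℝ] ℝ :=
  LinearMap.mk₂ ℝ (pairing μ)
    (fun h h' f => by simp [pairing_eq, add_mul])
    (fun c h f => by simp [pairing_eq])
    (fun h f f' => by simp [pairing_eq, mul_add])
    (fun c h f => by simp [pairing_eq])

@[simp]
theorem pairingBilin_apply (h f : smoothFn E H) : pairingBilin μ h f = pairing μ h f := rfl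

theorem abs_pairing_le (h f : smoothFn E H) :
    |pairing μ h f| ≤ ‖integralCLM μ‖ * ‖toC f‖ * ‖toC h‖ :=
  calc |pairing μ h f| ≤ ‖integralCLM μ‖ * ‖toC h * toC f‖ :=
        (integralCLM μ).le_opNorm (toC h * toC f)
    _ ≤ ‖integralCLM μ‖ * (‖toC h‖ * ‖toC f‖) := by gcongr; exact norm_mul_le _ _
    _ = ‖integralCLM μ‖ * ‖toC f‖ * ‖toC h‖ := by ring

variable [LieGroup 𝓘(ℝ, E) ∞ G] [SMulInvariantMeasure G (G ⧸ H) μ]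
  [CompleteSpace E] [T2Space G]

theorem pairing_vf (X : GroupLieAlgebra 𝓘(ℝ, E) G) (h f : smoothFn E H) :
    pairing μ h (vf X f) = -pairing μ (vf X h) f := by
  have hderiv := (integralCLM μ).hasFDerivAt.comp_hasDerivAt (0 : ℝ)
    ((hasDerivAt_toC_translate X h 0).mul (hasDerivAt_toC_translate X f 0))
  have hconst : (integralCLM μ ∘ fun t : ℝ => toC (translate (lieExp (t • X)) h)
      * toC (translate (lieExp (t • X)) f)) = fun _ => pairing μ h f :=
    funext fun t => pairing_translate_translate μ (lieExp (t • X)) h f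
  have hzero := hderiv.unique (hconst ▸ hasDerivAt_const 0 _)
  simp only [zero_smul, lieExp_zero, translate_one, Module.End.one_apply, map_add,
    ← pairing_eq] at hzero
  linarith

variable {ι : Type*} [Fintype ι] [DecidableEq ι]
  (T : Module.Basis ι ℝ (GroupLieAlgebra 𝓘(ℝ, E) G))

theorem pairing_casimir (h f : smoothFn E H) :
    pairing μ h (casimir T f) = pairing μ (casimir T h) f := by
  rw [casimir_apply, casimir_apply_swap]
  simp only [← pairingBilin_apply, map_sum, map_smul, LinearMap.sum_apply, LinearMap.smul_apply]
  simp only [pairingBilin_apply, pairing_vf, neg_neg]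

theorem pairing_halfCasimir (h f : smoothFn E H) :
    pairing μ h (halfCasimir T f) = pairing μ (halfCasimir T h) f := by
  simp only [halfCasimir, LinearMap.smul_apply, ← pairingBilin_apply, map_smul]
  simp only [pairingBilin_apply, pairing_casimir]

end Pairing

section LocalFrame

variable {E : Type*} [NormedAddCommGroup E] [NormedSpace ℝ E]
  {G : Type*} [TopologicalSpace G] [ChartedSpace E G] [Group G]

variable (E G) in
/-- The chart of `G` at the identity. -/
abbrev oneChart : PartialEquiv G E := extChartAt 𝓘(ℝ, E) (1 : G)

variable (G) in
/-- The right-invariant Maurer-Cartan form `dg g⁻¹` of `G` in the chart at the identity. -/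
def maurerCartan (y : E) : E →L[ℝ] E :=
  fderiv ℝ (fun z => oneChart E G ((oneChart E G).symm z * ((oneChart E G).symm y)⁻¹)) y

/-- A function on `G/H` in the chart of `G` at the identity, moved to `g` by right translation. -/
def localFn {H : Subgroup G} {F : Type*} (f : G ⧸ H → F) (g : G) (y : E) : F :=
  f (((oneChart E G).symm y * g : G) : G ⧸ H)

variable [LieGroup 𝓘(ℝ, E) ∞ G]

theorem contMDiffAt_oneChart_symm {y : E} (hy : y ∈ (oneChart E G).target) :
    ContMDiffAt 𝓘(ℝ, E) 𝓘(ℝ, E) ∞ (oneChart E G).symm y :=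
  (contMDiffOn_extChartAt_symm 1).contMDiffAt ((isOpen_extChartAt_target 1).mem_nhds hy)

theorem contDiffAt_oneChart_mul_inv {y : E} (hy : y ∈ (oneChart E G).target) :
    ContDiffAt ℝ ∞ (Function.uncurry fun x z : E =>
      oneChart E G ((oneChart E G).symm z * ((oneChart E G).symm x)⁻¹)) (y, y) := by
  have hsymm := contMDiffAt_oneChart_symm hy
  have hfst := hsymm.comp (y, y) (contDiff_fst (F := E)).contMDiff.contMDiffAt
  have hsnd := hsymm.comp (y, y) (contDiff_snd (E := E)).contMDiff.contMDiffAt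
  exact (ContMDiffAt.comp_of_eq contMDiffAt_extChartAt (hsnd.mul hfst.inv) (by simp)).contDiffAt

theorem contDiffAt_maurerCartan {y : E} (hy : y ∈ (oneChart E G).target) :
    ContDiffAt ℝ ∞ (maurerCartan (E := E) G) y :=
  (contDiffAt_oneChart_mul_inv hy).fderiv contDiffAt_id (by simp)

theorem hasFDerivAt_oneChart_mul_inv {y : E} (hy : y ∈ (oneChart E G).target) :
    HasFDerivAt (fun z => oneChart E G ((oneChart E G).symm z * ((oneChart E G).symm y)⁻¹))
      (maurerCartan G y) y := by
  have h : ContDiffAt ℝ ∞ _ y := (contDiffAt_oneChart_mul_inv hy).comp y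
    (contDiffAt_const.prodMk contDiffAt_id)
  exact (h.differentiableAt (by simp)).hasFDerivAt

theorem maurerCartan_oneChart_one :
    maurerCartan G (oneChart E G 1) = ContinuousLinearMap.id ℝ E := by
  refine (hasFDerivAt_oneChart_mul_inv (mem_extChartAt_target 1)).unique
    ((hasFDerivAt_id _).congr_of_eventuallyEq ?_)
  filter_upwards [extChartAt_target_mem_nhds (I := 𝓘(ℝ, E)) (1 : G)] with z hz
  simpa using (oneChart E G).right_inv hz

variable {H : Subgroup G}

/-- The derivative of `a ↦ f (a x)` at the identity, with the model space `E` in place of the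
tangent space of `G`. -/
def orbitDeriv (f : smoothFn E H) (x : G ⧸ H) : E →L[ℝ] ℝ :=
  mvfderiv 𝓘(ℝ, E) (fun a : G => (f : G ⧸ H → ℝ) (a • x)) 1

theorem orbitDeriv_apply (f : smoothFn E H) (x : G ⧸ H) (X : GroupLieAlgebra 𝓘(ℝ, E) G) :
    orbitDeriv f x X = -(vf X f : G ⧸ H → ℝ) x := by
  rw [vf_apply, neg_neg]
  rfl

theorem hasFDerivAt_orbit_oneChart (f : smoothFn E H) (x : G ⧸ H) :
    HasFDerivAt (fun z => (f : G ⧸ H → ℝ) ((oneChart E G).symm z • x))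
      (orbitDeriv f x) (oneChart E G 1) := by
  have hdiff : DifferentiableAt ℝ (fun z => (f : G ⧸ H → ℝ) ((oneChart E G).symm z • x))
      (oneChart E G 1) :=
    ((((contMDiff_orbit f x).contMDiffAt.comp _
      (contMDiffAt_oneChart_symm (mem_extChartAt_target 1))).contDiffAt).differentiableAt
      (by simp))
  refine hdiff.hasFDerivAt.congr_fderiv (ContinuousLinearMap.ext fun X => ?_)
  exact (mvfderiv_eq_fderiv_comp_extChartAt_symm (mdifferentiableAt_orbit f x 1) X).symm

theorem hasFDerivAt_localFn (f : smoothFn E H) (g : G) {y : E}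
    (hy : y ∈ (oneChart E G).target) :
    HasFDerivAt (localFn (f : G ⧸ H → ℝ) g)
      (orbitDeriv f (((oneChart E G).symm y * g : G) : G ⧸ H) ∘L maurerCartan G y) y := by
  have : IsTopologicalGroup G := topologicalGroup_of_lieGroup 𝓘(ℝ, E) ∞
  have hone : oneChart E G ((oneChart E G).symm y * ((oneChart E G).symm y)⁻¹)
      = oneChart E G 1 := by rw [mul_inv_cancel]
  have hcomp := HasFDerivAt.comp y (hone.symm ▸
    hasFDerivAt_orbit_oneChart f (((oneChart E G).symm y * g : G) : G ⧸ H))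
    (hasFDerivAt_oneChart_mul_inv hy)
  refine hcomp.congr_of_eventuallyEq ?_
  have hsource : ∀ᶠ z in 𝓝 y,
      (oneChart E G).symm z * ((oneChart E G).symm y)⁻¹ ∈ (oneChart E G).source := by
    refine ((contMDiffAt_oneChart_symm hy).continuousAt.mul continuousAt_const).eventually_mem ?_
    simpa using extChartAt_source_mem_nhds (I := 𝓘(ℝ, E)) (1 : G)
  filter_upwards [hsource] with z hz
  simp only [Function.comp_apply, localFn, (oneChart E G).left_inv hz,
    MulAction.Quotient.smul_coe, smul_eq_mul]
  group

variable [FiniteDimensional ℝ E] {ι : Type*} (T : Module.Basis ι ℝ (GroupLieAlgebra 𝓘(ℝ, E) G))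

/-- The coframe dual to the `v_i`, in the chart of `G` at the identity. -/
def coframe (i : ι) (y : E) : E →L[ℝ] ℝ :=
  -(LinearMap.toContinuousLinearMap (show E →ₗ[ℝ] ℝ from T.coord i) ∘L maurerCartan G y)

theorem contDiffOn_coframe (i : ι) : ContDiffOn ℝ ∞ (coframe T i) (oneChart E G).target :=
  fun _ hy =>
    (contDiffAt_const.clm_comp (contDiffAt_maurerCartan hy)).neg.contDiffWithinAt

theorem coframe_oneChart_one [DecidableEq ι] (i j : ι) :
    coframe T i (oneChart E G 1) (T j) = if j = i then -1 else 0 := by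
  have h : coframe T i (oneChart E G 1) (T j) = -T.coord i (T j) := by
    simp only [coframe, maurerCartan_oneChart_one]
    rfl
  rw [h, T.coord_apply, T.repr_self, Finsupp.single_apply]
  split_ifs <;> simp

theorem hasFDerivAt_localFn_coframe [Fintype ι] (f : smoothFn E H) (g : G) {y : E}
    (hy : y ∈ (oneChart E G).target) :
    HasFDerivAt (localFn (f : G ⧸ H → ℝ) g)
      (∑ i, localFn (vf (T i) f : G ⧸ H → ℝ) g y • coframe T i y) y := by
  refine (hasFDerivAt_localFn f g hy).congr_fderiv (ContinuousLinearMap.ext fun Z => ?_)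
  set Y : GroupLieAlgebra 𝓘(ℝ, E) G := maurerCartan G y Z
  set L := orbitDeriv f (((oneChart E G).symm y * g : G) : G ⧸ H)
  have hY : ∑ i, T.repr Y i • (T i : E) = Y := T.sum_repr Y
  calc L Y = ∑ i, T.repr Y i * L (T i) := by
        refine (congrArg L hY.symm).trans ((map_sum L _ _).trans ?_)
        exact Finset.sum_congr rfl fun i _ => L.map_smul _ _
    _ = ∑ i, localFn (vf (T i) f : G ⧸ H → ℝ) g y * -T.coord i Y :=
      Finset.sum_congr rfl fun i _ => by
        rw [orbitDeriv_apply, mul_neg, mul_neg, mul_comm]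
        rfl
    _ = _ := by
      simp only [sum_apply, smul_apply, smul_eq_mul]
      rfl

end LocalFrame

section LocallyUniformLimits

theorem tendstoLocallyUniformlyOn_const {α X V : Type*} [TopologicalSpace X] [UniformSpace V]
    {l : Filter α} {s : Set X} (f : X → V) :
    TendstoLocallyUniformlyOn (fun _ => f) f l s :=
  TendstoUniformlyOn.tendstoLocallyUniformlyOn fun _ hu =>
    Eventually.of_forall fun _ _ _ => refl_mem_uniformity hu

theorem tendstoLocallyUniformlyOn_sum {α X V κ : Type*} [TopologicalSpace X]
    [NormedAddCommGroup V] {l : Filter α} {s : Set X} {F : κ → α → X → V} {f : κ → X → V}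
    (t : Finset κ) (h : ∀ k, TendstoLocallyUniformlyOn (F k) (f k) l s) :
    TendstoLocallyUniformlyOn (fun n x => ∑ k ∈ t, F k n x) (fun x => ∑ k ∈ t, f k x) l s := by
  classical
  induction t using Finset.induction_on with
  | empty => simpa using tendstoLocallyUniformlyOn_const fun _ => 0
  | insert k t hk ih =>
    simp only [Finset.sum_insert hk]
    exact (h k).add ih


theorem tendstoLocallyUniformlyOn_localFn {E : Type*} [NormedAddCommGroup E] [NormedSpace ℝ E]
    {G : Type*} [TopologicalSpace G] [ChartedSpace E G] [Group G] [CompactSpace G]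
    {H : Subgroup G} {α : Type*} {l : Filter α} {F : α → C(G ⧸ H, ℝ)} {F₀ : C(G ⧸ H, ℝ)}
    (h : Tendsto F l (𝓝 F₀)) (g : G) (s : Set E) :
    TendstoLocallyUniformlyOn (fun n => localFn (E := E) (F n) g) (localFn F₀ g) l s :=
  ((ContinuousMap.tendsto_iff_tendstoUniformly.1 h).comp
    fun y => (((oneChart E G).symm y * g : G) : G ⧸ H)).tendstoUniformlyOn.tendstoLocallyUniformlyOn

end LocallyUniformLimits

section Completeness

variable {E : Type*} [NormedAddCommGroup E] [NormedSpace ℝ E] [FiniteDimensional ℝ E]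
  {G : Type*} [TopologicalSpace G] [ChartedSpace E G] [Group G] [LieGroup 𝓘(ℝ, E) ∞ G]
  {H : Subgroup G} {ι : Type*} [Fintype ι]
  (T : Module.Basis ι ℝ (GroupLieAlgebra 𝓘(ℝ, E) G))

/-- A family of functions indexed by words that satisfies, in local coordinates, the differential
equations of the family of all derivatives `v_{i_1} ⋯ v_{i_m} f` of a function `f`. -/
def IsJet (F : List ι → G ⧸ H → ℝ) : Prop :=
  ∀ w (g : G), ∀ y ∈ (oneChart E G).target, HasFDerivAt (localFn (F w) g)
    (∑ i, localFn (F (i :: w)) g y • coframe T i y) y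

variable {T}

theorem IsJet.contDiffOn_localFn {F : List ι → G ⧸ H → ℝ} (hF : IsJet T F) (w : List ι) (g : G) :
    ContDiffOn ℝ ∞ (localFn (F w) g) (oneChart E G).target := by
  refine contDiffOn_infty.2 fun n => ?_
  induction n generalizing w with
  | zero =>
    exact contDiffOn_zero.2 fun y hy => (hF w g y hy).continuousAt.continuousWithinAt
  | succ n ih =>
    rw [Nat.cast_add, Nat.cast_one, contDiffOn_succ_iff_hasFDerivWithinAt_of_uniqueDiffOn
      (isOpen_extChartAt_target 1).uniqueDiffOn]
    exact ⟨by simp, _, ContDiffOn.sum fun i _ => (ih (i :: w)).smul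
      ((contDiffOn_coframe T i).of_le (by exact_mod_cast le_top)),
      fun y hy => (hF w g y hy).hasFDerivWithinAt⟩

theorem IsJet.mem_smoothFn {F : List ι → G ⧸ H → ℝ} (hF : IsJet T F) (w : List ι) :
    F w ∈ smoothFn E H := by
  intro g
  have : IsTopologicalGroup G := topologicalGroup_of_lieGroup 𝓘(ℝ, E) ∞
  have hlocal : ContDiffAt ℝ ∞ (localFn (F w) g) (oneChart E G 1) :=
    (hF.contDiffOn_localFn w g).contDiffAt (extChartAt_target_mem_nhds 1)
  have hchart : ContMDiffAt 𝓘(ℝ, E) 𝓘(ℝ, E) ∞ (fun a : G => oneChart E G (a * g⁻¹)) g :=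
    ContMDiffAt.comp_of_eq contMDiffAt_extChartAt
      (contMDiff_mul_right (I := 𝓘(ℝ, E)) (n := ∞) (a := g⁻¹)).contMDiffAt (mul_inv_cancel g)
  have hsource : ∀ᶠ a in 𝓝 g, a * g⁻¹ ∈ (oneChart E G).source := by
    refine (continuous_mul_const g⁻¹).continuousAt.eventually_mem ?_
    rw [mul_inv_cancel]
    exact extChartAt_source_mem_nhds 1
  refine (hlocal.contMDiffAt.comp_of_eq hchart (by simp)).congr_of_eventuallyEq ?_
  filter_upwards [hsource] with a ha
  simp only [Function.comp_apply, localFn]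
  rw [(oneChart E G).left_inv ha, inv_mul_cancel_right]

theorem IsJet.vf_eq {F : List ι → G ⧸ H → ℝ} (hF : IsJet T F) (w : List ι) (i : ι) :
    (vf (T i) ⟨F w, hF.mem_smoothFn w⟩ : G ⧸ H → ℝ) = F (i :: w) := by
  classical
  ext x
  obtain ⟨g, rfl⟩ := QuotientGroup.mk_surjective x
  have horbit : HasFDerivAt (localFn (F w) g) _ (oneChart E G 1) :=
    hasFDerivAt_orbit_oneChart ⟨F w, hF.mem_smoothFn w⟩ (g : G ⧸ H)
  have h := DFunLike.congr_fun (horbit.unique (hF w g _ (mem_extChartAt_target 1))) (T i : E)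
  have hsum (c : ι → ℝ) (L : ι → E →L[ℝ] ℝ) (X : E) :
      (∑ k, c k • L k) X = ∑ k, c k * L k X := by simp
  refine neg_injective ((orbitDeriv_apply _ _ _).symm.trans (h.trans ((hsum _ _ _).trans ?_)))
  refine (Finset.sum_congr rfl fun k _ =>
    congrArg (_ * ·) (coframe_oneChart_one T k i)).trans ?_
  simp [localFn]

theorem IsJet.wordOp_eq {F : List ι → G ⧸ H → ℝ} (hF : IsJet T F) (w : List ι) :
    wordOp T w ⟨F [], hF.mem_smoothFn []⟩ = ⟨F w, hF.mem_smoothFn w⟩ := by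
  induction w with
  | nil => simp
  | cons i w ih =>
    rw [wordOp_cons, Module.End.mul_apply, ih]
    exact Subtype.ext (hF.vf_eq w i)

variable (T)

theorem isJet_wordOp (f : smoothFn E H) : IsJet T fun w => (wordOp T w f : G ⧸ H → ℝ) :=
  fun w g _ hy => by
    simpa only [wordOp_cons, Module.End.mul_apply] using
      hasFDerivAt_localFn_coframe T (wordOp T w f) g hy

variable [CompactSpace G]

theorem isJet_of_tendsto {α : Type*} {l : Filter α} [l.NeBot] {f : α → smoothFn E H}
    {F : List ι → C(G ⧸ H, ℝ)}
    (h : ∀ w, Tendsto (fun n => toC (wordOp T w (f n))) l (𝓝 (F w))) :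
    IsJet T fun w => (F w : G ⧸ H → ℝ) := by
  have : IsTopologicalGroup G := topologicalGroup_of_lieGroup 𝓘(ℝ, E) ∞
  have hcont (w : List ι) (g : G) :
      ContinuousOn (localFn (E := E) (F w) g) (oneChart E G).target :=
    (F w).continuous.comp_continuousOn (QuotientGroup.continuous_mk.comp_continuousOn
      ((continuousOn_extChartAt_symm 1).mul continuousOn_const))
  intro w g y hy
  refine hasFDerivAt_of_tendstoLocallyUniformlyOn (isOpen_extChartAt_target 1)
    (tendstoLocallyUniformlyOn_sum Finset.univ fun i =>
      (tendstoLocallyUniformlyOn_localFn (h (i :: w)) g _).smul₀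
        (tendstoLocallyUniformlyOn_const _) (hcont _ g) (contDiffOn_coframe T i).continuousOn)
    (fun n z hz => isJet_wordOp T (f n) w g z hz)
    (fun z hz => (tendstoLocallyUniformlyOn_localFn (h w) g _).tendsto_at hz) hy

theorem exists_smoothFn_of_tendsto {ι : Type*} [Finite ι]
    (T : Module.Basis ι ℝ (GroupLieAlgebra 𝓘(ℝ, E) G)) {α : Type*} {l : Filter α} [l.NeBot]
    {f : α → smoothFn E H} {F : List ι → C(G ⧸ H, ℝ)}
    (h : ∀ w, Tendsto (fun n => toC (wordOp T w (f n))) l (𝓝 (F w))) :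
    ∃ f : smoothFn E H, ∀ w, toC (wordOp T w f) = F w := by
  have := Fintype.ofFinite ι
  have hF := isJet_of_tendsto T h
  exact ⟨⟨F [], hF.mem_smoothFn []⟩, fun w =>
    ContinuousMap.ext fun x => congrFun (congrArg Subtype.val (hF.wordOp_eq w)) x⟩

end Completeness

section Words

variable {ι : Type*} [Finite ι]

theorem le_sum_length_le {a : List ι → ℝ} (ha : ∀ w, 0 ≤ a w) {m : ℕ} {w : List ι}
    (hw : w.length ≤ m) : a w ≤ ∑ v ∈ (List.finite_length_le ι m).toFinset, a v :=
  Finset.single_le_sum (fun v _ => ha v) (by simpa using hw)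

theorem exists_forall_length_le_norm_lt_mem {κ A : Type*} [NormedAddCommGroup A]
    {s : Set (List κ → A)} (hs : s ∈ 𝓝 0) :
    ∃ m : ℕ, ∃ δ > 0, ∀ p : List κ → A, (∀ w, w.length ≤ m → ‖p w‖ < δ) → p ∈ s := by
  rw [nhds_pi] at hs
  obtain ⟨⟨I, δ⟩, ⟨hI, hδ⟩, hsub⟩ := (Metric.nhds_basis_ball (x := (0 : A))).pi_self.mem_iff.1 hs
  obtain ⟨m, hm⟩ := (hI.image List.length).bddAbove
  exact ⟨m, δ, hδ, fun p hp => hsub fun w hw => by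
    simpa using hp w (hm (Set.mem_image_of_mem _ hw))⟩

end Words

section BanachSteinhaus

variable {E : Type*} [NormedAddCommGroup E] [NormedSpace ℝ E]
  {G : Type*} [TopologicalSpace G] [ChartedSpace E G] [Group G] [LieGroup 𝓘(ℝ, E) ∞ G]
  {H : Subgroup G} {ι : Type*} (T : Module.Basis ι ℝ (GroupLieAlgebra 𝓘(ℝ, E) G))

variable (H) in
/-- The jet of a smooth function on `G/H`: all its derivatives `v_{i_1} ⋯ v_{i_m} f`. -/
def jet : smoothFn E H →ₗ[ℝ] (List ι → C(G ⧸ H, ℝ)) :=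
  LinearMap.pi fun w => toC ∘ₗ wordOp T w

theorem jet_injective : Function.Injective (jet H T) := fun f f' h => by
  ext x
  exact DFunLike.congr_fun (congrFun h []) x

variable (H) in
/-- Smooth functions as a Fréchet space: they are identified with their jets, a closed subspace
of a countable product of Banach spaces. -/
def jetEquiv : smoothFn E H ≃ₗ[ℝ] LinearMap.range (jet H T) :=
  LinearEquiv.ofInjective (jet H T) (jet_injective T)

theorem toC_wordOp_jetEquiv_symm (p : LinearMap.range (jet H T)) (w : List ι) :
    toC (wordOp T w ((jetEquiv H T).symm p)) = (p : List ι → C(G ⧸ H, ℝ)) w :=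
  congrFun (congrArg Subtype.val ((jetEquiv H T).apply_symm_apply p)) w

variable [CompactSpace G]

/-- `|U h|` is at most `C` times the largest sup norm of a derivative of `h` of order at
most `m`. -/
def HasOrderBound (m : ℕ) (C : ℝ) (U : smoothFn E H →ₗ[ℝ] ℝ) : Prop :=
  ∀ (h : smoothFn E H) (B : ℝ),
    (∀ w : List ι, w.length ≤ m → ‖toC (wordOp T w h)‖ ≤ B) → |U h| ≤ C * B

theorem isDistribution_iff (U : smoothFn E H →ₗ[ℝ] ℝ) :
    IsDistribution T U ↔ ∃ m C, HasOrderBound T m C U := by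
  have hnorm (h : smoothFn E H) (B : ℝ) (w : List ι) :
      (∀ x : G ⧸ H, |((w.map fun i => vf (T i)).prod h : G ⧸ H → ℝ) x| ≤ B) ↔
        ‖toC (wordOp T w h)‖ ≤ B := by
    rw [ContinuousMap.norm_le_of_nonempty]
    rfl
  simp only [IsDistribution, HasOrderBound, hnorm]

variable {T}

theorem HasOrderBound.isDistribution {m : ℕ} {C : ℝ} {U : smoothFn E H →ₗ[ℝ] ℝ}
    (hU : HasOrderBound T m C U) : IsDistribution T U := (isDistribution_iff T U).2 ⟨m, C, hU⟩

theorem hasOrderBound_inv_of_forall_norm_lt {m : ℕ} {δ : ℝ} (hδ : 0 < δ)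
    {U : smoothFn E H →ₗ[ℝ] ℝ}
    (hU : ∀ h, (∀ w : List ι, w.length ≤ m → ‖toC (wordOp T w h)‖ < δ) → |U h| ≤ 1) :
    HasOrderBound T m δ⁻¹ U := by
  intro h B hB
  rw [← div_eq_inv_mul, le_div_iff₀' hδ]
  refine le_of_forall_gt_imp_ge_of_dense fun B' hB' => ?_
  have hpos : 0 < B' := ((norm_nonneg _).trans (hB [] (Nat.zero_le _))).trans_lt hB'
  have hle := hU ((δ / B') • h) fun w hw => by
    rw [map_smul, map_smul, norm_smul, Real.norm_of_nonneg (by positivity), div_mul_eq_mul_div,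
      div_lt_iff₀ hpos]
    gcongr
    exact (hB w hw).trans_lt hB'
  rwa [map_smul, smul_eq_mul, abs_mul, abs_of_pos (by positivity), div_mul_eq_mul_div,
    div_le_one hpos] at hle

theorem IsDistribution.continuous_comp_jetEquiv_symm [Finite ι] {U : smoothFn E H →ₗ[ℝ] ℝ}
    (hU : IsDistribution T U) : Continuous (U ∘ₗ (jetEquiv H T).symm.toLinearMap) := by
  obtain ⟨m, C, hC⟩ := (isDistribution_iff T U).1 hU
  let N : LinearMap.range (jet H T) → ℝ := fun p =>
    ∑ w ∈ (List.finite_length_le ι m).toFinset, ‖(p : List ι → C(G ⧸ H, ℝ)) w‖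
  have hN : Continuous N := continuous_finsetSum _ fun w _ =>
    ((continuous_apply w).comp continuous_subtype_val).norm
  have hbound (p : LinearMap.range (jet H T)) : ‖U ((jetEquiv H T).symm p)‖ ≤ C * N p :=
    hC _ _ fun w hw => by
      rw [toC_wordOp_jetEquiv_symm]
      exact le_sum_length_le (fun w => norm_nonneg ((p : List ι → C(G ⧸ H, ℝ)) w)) hw
  refine continuous_of_continuousAt_zero (U ∘ₗ (jetEquiv H T).symm.toLinearMap) ?_
  rw [ContinuousAt, map_zero]
  exact squeeze_zero_norm hbound (by simpa [N] using (hN.const_mul C).tendsto 0)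

variable [FiniteDimensional ℝ E]

theorem isClosed_range_jet [Finite ι] (T : Module.Basis ι ℝ (GroupLieAlgebra 𝓘(ℝ, E) G)) :
    IsClosed (LinearMap.range (jet H T) : Set (List ι → C(G ⧸ H, ℝ))) := by
  refine isClosed_of_closure_subset fun F hF => ?_
  obtain ⟨p, hp, hlim⟩ := mem_closure_iff_seq_limit.1 hF
  choose f hf using hp
  obtain rfl : (fun n => jet H T (f n)) = p := funext hf
  obtain ⟨f', hf'⟩ := exists_smoothFn_of_tendsto T (tendsto_pi_nhds.1 hlim)
  exact ⟨f', funext hf'⟩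

theorem exists_hasOrderBound [Finite ι] {κ : Type*} {V : κ → smoothFn E H →ₗ[ℝ] ℝ}
    (hV : ∀ k, IsDistribution T (V k)) (hb : ∀ h, ∃ B, ∀ k, |V k h| ≤ B) :
    ∃ m C, ∀ k, HasOrderBound T m C (V k) := by
  have : CompleteSpace (LinearMap.range (jet H T)) := (isClosed_range_jet T).completeSpace_coe
  have : IsUniformAddGroup (LinearMap.range (jet H T)) :=
    (LinearMap.range (jet H T)).toAddSubgroup.isUniformAddGroup
  have : (uniformity (LinearMap.range (jet H T))).IsCountablyGenerated :=
    Filter.comap.isCountablyGenerated _ _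
  let 𝓕 (k : κ) : LinearMap.range (jet H T) →L[ℝ] ℝ :=
    ⟨V k ∘ₗ (jetEquiv H T).symm.toLinearMap, (hV k).continuous_comp_jetEquiv_symm⟩
  have hequi : UniformEquicontinuous ((↑) ∘ 𝓕) :=
    (norm_withSeminorms ℝ ℝ).banach_steinhaus fun _ p => by
      obtain ⟨B, hB⟩ := hb ((jetEquiv H T).symm p)
      exact ⟨B, by rintro _ ⟨k, rfl⟩; exact hB k⟩
  have hsmall := Metric.equicontinuousAt_iff_right.1 (hequi.equicontinuous 0) 1 one_pos
  rw [nhds_subtype_eq_comap, Filter.eventually_comap] at hsmall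
  obtain ⟨m, δ, hδ, hmem⟩ := exists_forall_length_le_norm_lt_mem hsmall
  refine ⟨m, δ⁻¹, fun k => hasOrderBound_inv_of_forall_norm_lt hδ fun h hh => ?_⟩
  have hlt := hmem (jetEquiv H T h : List ι → C(G ⧸ H, ℝ)) hh (jetEquiv H T h) rfl k
  rw [dist_comm, Function.comp_apply, map_zero, dist_zero_right] at hlt
  simpa [𝓕] using hlt.le

end BanachSteinhaus

section Distributions

variable {E : Type*} [NormedAddCommGroup E] [NormedSpace ℝ E]
  {G : Type*} [TopologicalSpace G] [ChartedSpace E G] [Group G] [LieGroup 𝓘(ℝ, E) ∞ G]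
  [CompactSpace G] {H : Subgroup G} {ι : Type*} {T : Module.Basis ι ℝ (GroupLieAlgebra 𝓘(ℝ, E) G)}

theorem HasOrderBound.sub {m m' : ℕ} {C C' : ℝ} {U U' : smoothFn E H →ₗ[ℝ] ℝ}
    (hU : HasOrderBound T m C U) (hU' : HasOrderBound T m' C' U') :
    HasOrderBound T (max m m') (C + C') (U - U') := fun h B hB => by
  rw [LinearMap.sub_apply, add_mul]
  exact (abs_sub _ _).trans (add_le_add
    (hU h B fun w hw => hB w (hw.trans (le_max_left _ _)))
    (hU' h B fun w hw => hB w (hw.trans (le_max_right _ _))))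

theorem IsDistribution.sub {U U' : smoothFn E H →ₗ[ℝ] ℝ}
    (hU : IsDistribution T U) (hU' : IsDistribution T U') : IsDistribution T (U - U') := by
  obtain ⟨m, C, h⟩ := (isDistribution_iff T U).1 hU
  obtain ⟨m', C', h'⟩ := (isDistribution_iff T U').1 hU'
  exact (h.sub h').isDistribution

theorem HasOrderBound.of_tendsto {α : Type*} {l : Filter α} [l.NeBot] {m : ℕ} {C : ℝ}
    {V : α → smoothFn E H →ₗ[ℝ] ℝ} {U : smoothFn E H →ₗ[ℝ] ℝ}
    (hV : ∀ n, HasOrderBound T m C (V n)) (hlim : ∀ h, Tendsto (fun n => V n h) l (𝓝 (U h))) :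
    HasOrderBound T m C U :=
  fun h B hB => le_of_tendsto (hlim h).abs (Eventually.of_forall fun n => hV n h B hB)

theorem IsDistribution.of_tendsto [Finite ι] [FiniteDimensional ℝ E]
    {V : ℕ → smoothFn E H →ₗ[ℝ] ℝ} {U : smoothFn E H →ₗ[ℝ] ℝ} (hV : ∀ n, IsDistribution T (V n))
    (hlim : ∀ h, Tendsto (fun n => V n h) atTop (𝓝 (U h))) : IsDistribution T U := by
  obtain ⟨m, C, hC⟩ := exists_hasOrderBound hV fun h => by
    obtain ⟨B, hB⟩ := (hlim h).abs.bddAbove_range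
    exact ⟨B, fun n => hB ⟨n, rfl⟩⟩
  exact (HasOrderBound.of_tendsto hC hlim).isDistribution

theorem exists_hasOrderBound_of_continuousOn [Finite ι] [FiniteDimensional ℝ E]
    {X : Type*} [TopologicalSpace X] {S : Set X} (hS : IsCompact S)
    {V : X → smoothFn E H →ₗ[ℝ] ℝ} (hV : ∀ s ∈ S, IsDistribution T (V s))
    (hcont : ∀ h, ContinuousOn (fun s => V s h) S) :
    ∃ m C, ∀ s ∈ S, HasOrderBound T m C (V s) := by
  obtain ⟨m, C, hC⟩ := exists_hasOrderBound (V := fun s : S => V s) (fun s => hV s s.2) fun h => by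
    obtain ⟨B, hB⟩ := hS.exists_bound_of_continuousOn (hcont h)
    exact ⟨B, fun s => hB s s.2⟩
  exact ⟨m, C, fun s hs => hC ⟨s, hs⟩⟩

theorem HasOrderBound.comp_wordOp {m : ℕ} {C : ℝ} {U : smoothFn E H →ₗ[ℝ] ℝ}
    (hU : HasOrderBound T m C U) (v : List ι) :
    HasOrderBound T (m + v.length) C (U ∘ₗ wordOp T v) := fun h B hB =>
  hU _ B fun w hw => by
    rw [← Module.End.mul_apply, ← wordOp_append]
    exact hB _ (by simpa using hw)

theorem IsDistribution.comp_wordOp {U : smoothFn E H →ₗ[ℝ] ℝ} (hU : IsDistribution T U)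
    (v : List ι) : IsDistribution T (U ∘ₗ wordOp T v) := by
  obtain ⟨m, C, hC⟩ := (isDistribution_iff T U).1 hU
  exact (hC.comp_wordOp v).isDistribution

theorem HasOrderBound.comp_halfCasimir [Fintype ι] [DecidableEq ι] {m : ℕ} {C : ℝ}
    {U : smoothFn E H →ₗ[ℝ] ℝ} (hU : HasOrderBound T m C U) :
    HasOrderBound T (m + 2) (C * ∑ i, ∑ j, |(1 / 2) * (killing T)⁻¹ i j|)
      (U ∘ₗ halfCasimir T) := fun h B hB => by
  rw [mul_assoc]
  refine hU _ _ fun w hw => ?_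
  simp only [halfCasimir, LinearMap.smul_apply, casimir_apply, map_smul, map_sum, Finset.smul_sum,
    smul_smul, Finset.sum_mul]
  refine (norm_sum_le _ _).trans (Finset.sum_le_sum fun i _ => (norm_sum_le _ _).trans
    (Finset.sum_le_sum fun j _ => ?_))
  have hword : wordOp T w (vf (T i) (vf (T j) h)) = wordOp T (w ++ [i, j]) h := by
    simp [wordOp_append]
  rw [norm_smul, neg_mul, norm_neg, Real.norm_eq_abs, hword]
  gcongr
  exact hB _ (by simpa using hw)

theorem exists_norm_wordOp_translate_le [Finite ι]
    (T : Module.Basis ι ℝ (GroupLieAlgebra 𝓘(ℝ, E) G)) (m : ℕ) (h : smoothFn E H) :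
    ∃ B, ∀ w : List ι, w.length ≤ m → ∀ g : G, ‖toC (wordOp T w (translate g h))‖ ≤ B := by
  have hbdd (w : List ι) : ∃ B, ∀ g : G, ‖toC (wordOp T w (translate g h))‖ ≤ B := by
    obtain ⟨B, hB⟩ := (isCompact_range (continuous_toC_wordOp_translate T w h).norm).bddAbove
    exact ⟨B, fun g => hB ⟨g, rfl⟩⟩
  choose B hB using hbdd
  exact ⟨∑ w ∈ (List.finite_length_le ι m).toFinset, |B w|, fun w hw g =>
    ((hB w g).trans (le_abs_self _)).trans (le_sum_length_le (fun w => abs_nonneg (B w)) hw)⟩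

theorem tendsto_zero_of_hasOrderBound [Finite ι] {κ : Type*} {l : Filter κ} {m : ℕ} {C : ℝ}
    {V : κ → smoothFn E H →ₗ[ℝ] ℝ} (hV : ∀ᶠ k in l, HasOrderBound T m C (V k))
    {c : κ → smoothFn E H} (hc : ∀ w, Tendsto (fun k => toC (wordOp T w (c k))) l (𝓝 0)) :
    Tendsto (fun k => V k (c k)) l (𝓝 0) := by
  have hsum : Tendsto (fun k => C * ∑ w ∈ (List.finite_length_le ι m).toFinset,
      ‖toC (wordOp T w (c k))‖) l (𝓝 0) := by
    simpa using (tendsto_finsetSum (List.finite_length_le ι m).toFinset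
      fun w _ => (hc w).norm).const_mul C
  exact squeeze_zero_norm' (hV.mono fun k hk => hk _ _ fun w hw =>
    le_sum_length_le (fun w => norm_nonneg (toC (wordOp T w (c k)))) hw) hsum

theorem IsDistribution.tendsto [Finite ι] {U : smoothFn E H →ₗ[ℝ] ℝ} (hU : IsDistribution T U)
    {κ : Type*} {l : Filter κ} {c : κ → smoothFn E H} {c₀ : smoothFn E H}
    (hc : ∀ w, Tendsto (fun k => toC (wordOp T w (c k))) l (𝓝 (toC (wordOp T w c₀)))) :
    Tendsto (fun k => U (c k)) l (𝓝 (U c₀)) := by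
  obtain ⟨m, C, hC⟩ := (isDistribution_iff T U).1 hU
  have hdiff := tendsto_zero_of_hasOrderBound (V := fun _ => U) (c := fun k => c k - c₀) (l := l)
    (Eventually.of_forall fun _ => hC) fun w => by
      simpa using (hc w).sub_const (toC (wordOp T w c₀))
  simpa using hdiff.add_const (U c₀)

/- The slope of `r ↦ V r (c r)` is the slope of `r ↦ V r (c s)`, plus `V r c'`, plus `V r`
applied to the error of the slope of `c`. -/
theorem hasDerivWithinAt_distribution_apply [Finite ι] {V : ℝ → smoothFn E H →ₗ[ℝ] ℝ}
    {V' : smoothFn E H →ₗ[ℝ] ℝ} {S : Set ℝ} {s : ℝ} {m : ℕ} {C : ℝ}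
    (hb : ∀ r ∈ S, HasOrderBound T m C (V r))
    (hV : ∀ h, HasDerivWithinAt (fun r => V r h) (V' h) S s)
    {c : ℝ → smoothFn E H} {c' : smoothFn E H}
    (hc : ∀ w, HasDerivAt (fun r => toC (wordOp T w (c r))) (toC (wordOp T w c')) s) :
    HasDerivWithinAt (fun r => V r (c r)) (V' (c s) + V s c') S s := by
  rw [hasDerivWithinAt_iff_tendsto_slope]
  have hmem : ∀ᶠ r in 𝓝[S \ {s}] s, r ∈ S \ {s} := self_mem_nhdsWithin
  have hslope := hasDerivWithinAt_iff_tendsto_slope.1 (hV (c s))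
  have hval : Tendsto (fun r => V r c') (𝓝[S \ {s}] s) (𝓝 (V s c')) :=
    (hV c').continuousWithinAt.mono Set.sdiff_subset
  have herror : Tendsto (fun r => V r ((r - s)⁻¹ • (c r - c s) - c')) (𝓝[S \ {s}] s) (𝓝 0) := by
    refine tendsto_zero_of_hasOrderBound (hmem.mono fun r hr => hb r hr.1) fun w => ?_
    have hw := (hasDerivWithinAt_iff_tendsto_slope.1
      ((hc w).hasDerivWithinAt (s := S))).sub_const (toC (wordOp T w c'))
    rw [sub_self] at hw
    exact hw.congr fun r => by simp [slope_def_module]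
  refine (((hslope.add hval).add herror).congr' (hmem.mono fun r hr => ?_)).trans (by simp)
  have hne : r - s ≠ 0 := sub_ne_zero.2 hr.2
  simp only [slope_def_field, map_sub, map_smul, smul_eq_mul]
  field_simp
  ring

variable [Fintype ι] [T2Space G] [CompleteSpace E]

theorem hasDerivWithinAt_distribution_translate {V : ℝ → smoothFn E H →ₗ[ℝ] ℝ}
    {V' : smoothFn E H →ₗ[ℝ] ℝ} {S : Set ℝ} {s : ℝ} {m : ℕ} {C : ℝ}
    (hb : ∀ r ∈ S, HasOrderBound T m C (V r))
    (hV : ∀ h, HasDerivWithinAt (fun r => V r h) (V' h) S s) (φ : ι → ℝ) (h : smoothFn E H) :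
    HasDerivWithinAt (fun r => V r (translate (lieExp (r • lieVec T φ)) h))
      (V' (translate (lieExp (s • lieVec T φ)) h) +
        V s (translate (lieExp (s • lieVec T φ)) (vf (lieVec T φ) h))) S s :=
  hasDerivWithinAt_distribution_apply hb hV fun w => hasDerivAt_toC_wordOp_translate T φ w h s

theorem exists_norm_wordOp_translate_lieExp_le
    (T : Module.Basis ι ℝ (GroupLieAlgebra 𝓘(ℝ, E) G)) (φ : ι → ℝ) (t : ℝ) (w : List ι) :
    ∃ C, 0 ≤ C ∧ ∀ (h : smoothFn E H) (B : ℝ),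
      (∀ v : List ι, v.length ≤ w.length → ‖toC (wordOp T v h)‖ ≤ B) →
      ‖toC (wordOp T w (translate (lieExp (t • lieVec T φ)) h))‖ ≤ C * B := by
  classical
  induction w using List.reverseRecOn with
  | nil =>
    refine ⟨1, zero_le_one, fun h B hB => ?_⟩
    rw [one_mul, wordOp_nil, Module.End.one_apply, norm_toC_translate]
    exact hB [] le_rfl
  | append_singleton w j ih =>
    obtain ⟨C, hC0, hC⟩ := ih
    refine ⟨(∑ k, |NormedSpace.exp (t • -adMatrix T φ) k j|) * C, by positivity,
      fun h B hB => ?_⟩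
    simp only [wordOp_append, wordOp_cons, wordOp_nil, mul_one, Module.End.mul_apply,
      vf_translate_lieExp, map_sum, map_smul, Finset.sum_mul]
    refine (norm_sum_le _ _).trans (Finset.sum_le_sum fun k _ => ?_)
    rw [norm_smul, Real.norm_eq_abs, mul_assoc]
    gcongr
    refine hC _ _ fun v hv => ?_
    have hword : wordOp T v (vf (T k) h) = wordOp T (v ++ [k]) h := by simp [wordOp_append]
    rw [hword]
    exact hB _ (by simpa using hv)

theorem IsDistribution.comp_translate {U : smoothFn E H →ₗ[ℝ] ℝ} (hU : IsDistribution T U)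
    (φ : ι → ℝ) (t : ℝ) : IsDistribution T (U ∘ₗ translate (lieExp (t • lieVec T φ))) := by
  obtain ⟨m, C, hC⟩ := (isDistribution_iff T U).1 hU
  choose D hD0 hD using exists_norm_wordOp_translate_lieExp_le (H := H) T φ t
  refine (isDistribution_iff T _).2
    ⟨m, C * ∑ w ∈ (List.finite_length_le ι m).toFinset, D w, fun h B hB => ?_⟩
  rw [mul_assoc]
  refine hC _ _ fun w hw => (hD w h B fun v hv => hB v (hv.trans hw)).trans ?_
  have hB0 : 0 ≤ B := (norm_nonneg _).trans (hB [] (Nat.zero_le _))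
  gcongr
  exact le_sum_length_le hD0 hw

end Distributions

section QuadraticRemainder

variable {F : Type*} [NormedAddCommGroup F] [NormedSpace ℝ F]

theorem hasDerivWithinAt_of_norm_sub_le {y : ℝ → F} {y' : F} {S : Set ℝ} {s M : ℝ}
    (h : ∀ r ∈ S, ‖y r - y s - (r - s) • y'‖ ≤ M * |r - s| ^ 2) :
    HasDerivWithinAt y y' S s := by
  have hquadratic : (fun r => y r - y s - (r - s) • y') =O[𝓝[S] s] fun r => (r - s) ^ 2 :=
    Asymptotics.IsBigO.of_bound M (eventually_nhdsWithin_of_forall fun r hr => by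
      simpa using h r hr)
  exact hasDerivWithinAt_iff_isLittleO.2 (hquadratic.trans_isLittleO
    (((Asymptotics.isLittleO_pow_sub_sub s one_lt_two).congr_left fun r => by simp).mono
      nhdsWithin_le_nhds))

theorem norm_sub_sub_smul_le_of_hasDerivWithinAt {y y' y'' : ℝ → F} {S : Set ℝ}
    (hS : Convex ℝ S) {M : ℝ} (hy : ∀ s ∈ S, HasDerivWithinAt y (y' s) S s)
    (hy' : ∀ s ∈ S, HasDerivWithinAt y' (y'' s) S s) (hM : ∀ s ∈ S, ‖y'' s‖ ≤ M)
    {r s : ℝ} (hr : r ∈ S) (hs : s ∈ S) :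
    ‖y r - y s - (r - s) • y' s‖ ≤ M * |r - s| ^ 2 := by
  have hseg : Set.uIcc s r ⊆ S := segment_eq_uIcc s r ▸ hS.segment_subset hs hr
  have hM0 : 0 ≤ M := (norm_nonneg _).trans (hM s hs)
  have hderiv : ∀ x ∈ Set.uIcc s r, HasDerivWithinAt (fun x => y x - x • y' s) (y' x - y' s)
      (Set.uIcc s r) x := fun x hx => by
    simpa using ((hy x (hseg hx)).mono hseg).fun_sub
      ((hasDerivWithinAt_id x (Set.uIcc s r)).smul_const (y' s))
  have hbound : ∀ x ∈ Set.uIcc s r, ‖y' x - y' s‖ ≤ M * |r - s| := fun x hx =>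
    (hS.norm_image_sub_le_of_norm_hasDerivWithin_le hy' hM hs (hseg hx)).trans
      (mul_le_mul_of_nonneg_left (Set.abs_sub_left_of_mem_uIcc hx) hM0)
  have hle := (convex_uIcc s r).norm_image_sub_le_of_norm_hasDerivWithin_le hderiv hbound
    Set.left_mem_uIcc Set.right_mem_uIcc
  calc ‖y r - y s - (r - s) • y' s‖ = ‖y r - r • y' s - (y s - s • y' s)‖ := by
        rw [sub_smul]; congr 1; abel
    _ ≤ M * |r - s| * |r - s| := hle
    _ = M * |r - s| ^ 2 := by ring

theorem hasDerivWithinAt_continuousMap {M : Type*} [TopologicalSpace M] [CompactSpace M]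
    {S : Set ℝ} (hS : Convex ℝ S) {u u' : ℝ → C(M, F)} {u'' : ℝ → M → F} {B : ℝ}
    (hu : ∀ x, ∀ s ∈ S, HasDerivWithinAt (fun s => u s x) (u' s x) S s)
    (hu' : ∀ x, ∀ s ∈ S, HasDerivWithinAt (fun s => u' s x) (u'' s x) S s) (hB0 : 0 ≤ B)
    (hB : ∀ s ∈ S, ∀ x, ‖u'' s x‖ ≤ B) {s : ℝ} (hs : s ∈ S) :
    HasDerivWithinAt u (u' s) S s := by
  refine hasDerivWithinAt_of_norm_sub_le (M := B) fun r hr => ?_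
  rw [ContinuousMap.norm_le _ (by positivity)]
  exact fun x =>
    norm_sub_sub_smul_le_of_hasDerivWithinAt hS (hu x) (hu' x) (fun s hs => hB s hs x) hr hs

end QuadraticRemainder

section ExponentialSeries

variable {a : ℕ → ℝ} {β s : ℝ}

theorem summable_exp_series_of_bounded {M : ℝ}
    (h : ∀ n : ℕ, |β ^ n / (n.factorial : ℝ) * a (n + 2)| ≤ M) :
    Summable fun n : ℕ => |β| ^ n / (n.factorial : ℝ) * |a n| := by
  rw [← summable_nat_add_iff 2]
  have hsquares : Summable fun n : ℕ => |β| ^ 2 * M * (1 / ((n : ℝ) + 1) ^ 2) := by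
    refine Summable.mul_left _ ?_
    simpa using (summable_nat_add_iff 1).2 (Real.summable_one_div_nat_pow.2 one_lt_two)
  refine hsquares.of_nonneg_of_le (fun n => by positivity) fun n => ?_
  have hn := h n
  rw [abs_mul, abs_div, abs_pow, Nat.abs_cast] at hn
  have hM0 : 0 ≤ M := le_trans (by positivity) hn
  calc |β| ^ (n + 2) / ((n + 2).factorial : ℝ) * |a (n + 2)|
      = |β| ^ 2 * (|β| ^ n / (n.factorial : ℝ) * |a (n + 2)|) * (1 / ((n + 2) * (n + 1))) := by
        rw [Nat.factorial_succ, Nat.factorial_succ, pow_add]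
        push_cast
        field_simp
        ring
    _ ≤ |β| ^ 2 * M * (1 / ((n : ℝ) + 1) ^ 2) := by
        gcongr
        nlinarith [(Nat.cast_nonneg n : (0 : ℝ) ≤ n)]

theorem hasDerivAt_exp_partial_sum (a : ℕ → ℝ) (N : ℕ) (s : ℝ) :
    HasDerivAt (fun s : ℝ => ∑ n ∈ Finset.range (N + 1), s ^ n / (n.factorial : ℝ) * a n)
      (∑ n ∈ Finset.range N, s ^ n / (n.factorial : ℝ) * a (n + 1)) s := by
  simp only [Finset.sum_range_succ' _ N, pow_zero]
  refine (HasDerivAt.fun_sum fun n _ => ?_).add_const _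
  refine (((hasDerivAt_pow (n + 1) s).div_const _).mul_const _).congr_deriv ?_
  rw [Nat.factorial_succ, Nat.add_sub_cancel]
  push_cast
  field_simp

theorem norm_exp_term_le (hs : s ∈ Set.uIcc 0 β) (n : ℕ) :
    ‖s ^ n / (n.factorial : ℝ) * a n‖ ≤ |β| ^ n / (n.factorial : ℝ) * |a n| := by
  have hsβ : |s| ≤ |β| := by simpa using Set.abs_sub_left_of_mem_uIcc hs
  rw [Real.norm_eq_abs, abs_mul, abs_div, abs_pow, Nat.abs_cast]
  gcongr

theorem summable_exp_series (hs : s ∈ Set.uIcc 0 β)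
    (h : Summable fun n : ℕ => |β| ^ n / (n.factorial : ℝ) * |a n|) :
    Summable fun n : ℕ => s ^ n / (n.factorial : ℝ) * a n :=
  h.of_norm_bounded (norm_exp_term_le hs)

theorem norm_exp_partial_sum_le (hs : s ∈ Set.uIcc 0 β)
    (h : Summable fun n : ℕ => |β| ^ n / (n.factorial : ℝ) * |a n|) (N : ℕ) :
    ‖∑ n ∈ Finset.range N, s ^ n / (n.factorial : ℝ) * a n‖
      ≤ ∑' n : ℕ, |β| ^ n / (n.factorial : ℝ) * |a n| :=
  (norm_sum_le_of_le _ fun n _ => norm_exp_term_le hs n).trans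
    (h.sum_le_tsum (Finset.range N) fun n _ => by positivity)

theorem hasDerivWithinAt_exp_series {y y' : ℝ → ℝ}
    (hy : ∀ s ∈ Set.uIcc 0 β, HasSum (fun n : ℕ => s ^ n / (n.factorial : ℝ) * a n) (y s))
    (hy' : ∀ s ∈ Set.uIcc 0 β, HasSum (fun n : ℕ => s ^ n / (n.factorial : ℝ) * a (n + 1)) (y' s))
    (h : Summable fun n : ℕ => |β| ^ n / (n.factorial : ℝ) * |a (n + 2)|)
    (hs : s ∈ Set.uIcc 0 β) : HasDerivWithinAt y (y' s) (Set.uIcc 0 β) s := by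
  refine hasDerivWithinAt_of_norm_sub_le
    (M := ∑' n : ℕ, |β| ^ n / (n.factorial : ℝ) * |a (n + 2)|) fun r hr => ?_
  have hpartial (N : ℕ) := norm_sub_sub_smul_le_of_hasDerivWithinAt (convex_uIcc 0 β)
    (fun t _ => (hasDerivAt_exp_partial_sum a (N + 1) t).hasDerivWithinAt)
    (fun t _ => (hasDerivAt_exp_partial_sum (fun n => a (n + 1)) N t).hasDerivWithinAt)
    (fun t ht => norm_exp_partial_sum_le (a := fun n => a (n + 2)) ht h N) hr hs
  have hlim_r := (hy r hr).tendsto_sum_nat.comp (tendsto_add_atTop_nat 2)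
  have hlim_s := (hy s hs).tendsto_sum_nat.comp (tendsto_add_atTop_nat 2)
  have hlim' := (hy' s hs).tendsto_sum_nat.comp (tendsto_add_atTop_nat 1)
  exact le_of_tendsto ((hlim_r.sub hlim_s).sub (hlim'.const_smul (r - s))).norm
    (Eventually.of_forall hpartial)

end ExponentialSeries

theorem exists_linearMap_hasSum {R M N κ : Type*} [Semiring R] [AddCommMonoid M] [Module R M]
    [AddCommMonoid N] [Module R N] [TopologicalSpace N] [T2Space N] [ContinuousAdd N]
    [ContinuousConstSMul R N] {V : κ → M →ₗ[R] N} (hV : ∀ x, Summable fun k => V k x) :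
    ∃ U : M →ₗ[R] N, ∀ x, HasSum (fun k => V k x) (U x) :=
  ⟨linearMapOfTendsto (l := atTop) (fun x => ∑' k, V k x) (fun A => ∑ k ∈ A, V k)
    (tendsto_pi_nhds.2 fun x => by simpa using! (hV x).hasSum), fun x => (hV x).hasSum⟩

section HeatEvolution

variable {E : Type*} [NormedAddCommGroup E] [NormedSpace ℝ E]
  {G : Type*} [TopologicalSpace G] [ChartedSpace E G] [Group G] [LieGroup 𝓘(ℝ, E) ∞ G]
  {H : Subgroup G} {ι : Type*} [Fintype ι] [DecidableEq ι]
  (T : Module.Basis ι ℝ (GroupLieAlgebra 𝓘(ℝ, E) G))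

/-- A curve of distributions with `dW/ds = -(1/2) K^{ij} v_i v_j W` on `S`; the symmetric operator
`-(1/2) K^{ij} v_i v_j` is moved to the test function. -/
structure IsHeatEvolution (S : Set ℝ) (W : ℝ → smoothFn E H →ₗ[ℝ] ℝ) : Prop where
  isDistribution : ∀ s ∈ S, IsDistribution T (W s)
  evolution : ∀ s ∈ S, ∀ h, HasDerivWithinAt (fun r => W r h) (W s (halfCasimir T h)) S s

variable {T} in
theorem IsHeatEvolution.exists_hasOrderBound [CompactSpace G] [FiniteDimensional ℝ E] {S : Set ℝ}
    (hS : IsCompact S) {W : ℝ → smoothFn E H →ₗ[ℝ] ℝ} (hW : IsHeatEvolution T S W) :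
    ∃ m C, ∀ s ∈ S, HasOrderBound T m C (W s) :=
  exists_hasOrderBound_of_continuousOn hS hW.isDistribution fun h s hs =>
    (hW.evolution s hs h).continuousWithinAt

end HeatEvolution

section Existence

variable {E : Type*} [NormedAddCommGroup E] [NormedSpace ℝ E]
  {G : Type*} [TopologicalSpace G] [ChartedSpace E G] [Group G] [LieGroup 𝓘(ℝ, E) ∞ G]
  [CompactSpace G] {H : Subgroup G} [MeasurableSpace (G ⧸ H)] [BorelSpace (G ⧸ H)]
  (μ : Measure (G ⧸ H)) [IsFiniteMeasure μ] {ι : Type*}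
  (T : Module.Basis ι ℝ (GroupLieAlgebra 𝓘(ℝ, E) G))

theorem isDistribution_pairing (f : smoothFn E H) : IsDistribution T ((pairingBilin μ).flip f) :=
  HasOrderBound.isDistribution (m := 0) (C := ‖integralCLM μ‖ * ‖toC f‖) fun h B hB => by
    refine (abs_pairing_le μ h f).trans ?_
    gcongr
    exact hB [] le_rfl

variable [Fintype ι] [DecidableEq ι]

variable {μ T} in
theorem isDistribution_of_hasSum [FiniteDimensional ℝ E] {f : smoothFn E H} {s : ℝ}
    {W : smoothFn E H →ₗ[ℝ] ℝ} (hW : ∀ h, HasSum (fun n : ℕ => s ^ n / (n.factorial : ℝ) *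
      pairing μ h ((halfCasimir T ^ n) f)) (W h)) : IsDistribution T W := by
  refine IsDistribution.of_tendsto (fun N => isDistribution_pairing μ T
    (∑ n ∈ Finset.range N, (s ^ n / (n.factorial : ℝ)) • (halfCasimir T ^ n) f)) fun h => ?_
  simpa using (hW h).tendsto_sum_nat

variable [SMulInvariantMeasure G (G ⧸ H) μ]

theorem pairing_expV_smul_casimir_pow (β : ℝ) (φ : ι → ℝ) (n : ℕ) (h f : smoothFn E H) :
    pairing μ h (expV T φ ((((-(1 / 2) * β) • casimir T) ^ n : Module.End ℝ (smoothFn E H)) f))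
      / (n.factorial : ℝ) = β ^ n / (n.factorial : ℝ) *
        pairing μ (translate (lieExp (lieVec T φ))⁻¹ h) ((halfCasimir T ^ n) f) := by
  rw [smul_casimir_pow, ← pairing_translate_right, map_smul, ← pairingBilin_apply, map_smul,
    pairingBilin_apply, smul_eq_mul, expV, lieVec]
  ring

variable [T2Space G]

section Complete

variable [CompleteSpace E]

theorem pairing_halfCasimir_pow (n : ℕ) (h f : smoothFn E H) :
    pairing μ (halfCasimir T h) ((halfCasimir T ^ n) f)
      = pairing μ h ((halfCasimir T ^ (n + 1)) f) := by
  rw [← pairing_halfCasimir, pow_succ', Module.End.mul_apply]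

variable {μ T} in
/- The terms of the series tested against `halfCasimir T (halfCasimir T h)` are bounded, and they
are the terms tested against `h` shifted by two places: the quotient of the factorials makes the
latter `O(1/n²)`. -/
theorem SeriesConverges.summable {β : ℝ} {φ : ι → ℝ} {f : smoothFn E H}
    (hf : SeriesConverges T μ β φ f) (h : smoothFn E H) :
    Summable fun n : ℕ => |β| ^ n / (n.factorial : ℝ) * |pairing μ h ((halfCasimir T ^ n) f)| := by
  obtain ⟨S, -, hS⟩ := hf
  have hlim := hS (translate (lieExp (lieVec T φ)) (halfCasimir T (halfCasimir T h)))
  simp only [pairing_expV_smul_casimir_pow, translate_inv_translate, pairing_halfCasimir_pow]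
    at hlim
  have hterm := (hlim.comp (tendsto_add_atTop_nat 1)).sub hlim
  simp only [Function.comp_def, Finset.sum_range_succ, add_sub_cancel_left] at hterm
  obtain ⟨M, hM⟩ := hterm.abs.bddAbove_range
  exact summable_exp_series_of_bounded (a := fun n => pairing μ h ((halfCasimir T ^ n) f))
    fun n => hM ⟨n, rfl⟩

end Complete

variable [FiniteDimensional ℝ E] {μ T}

theorem SeriesConverges.exists_isHeatEvolution {β : ℝ} {φ : ι → ℝ} {f : smoothFn E H}
    (hf : SeriesConverges T μ β φ f) :
    ∃ W : ℝ → smoothFn E H →ₗ[ℝ] ℝ, IsHeatEvolution T (Set.uIcc 0 β) W ∧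
      ∀ s ∈ Set.uIcc 0 β, ∀ h, HasSum (fun n : ℕ => s ^ n / (n.factorial : ℝ) *
        pairing μ h ((halfCasimir T ^ n) f)) (W s h) := by
  have : CompleteSpace E := FiniteDimensional.complete ℝ E
  have hexists : ∀ s ∈ Set.uIcc 0 β, ∃ U : smoothFn E H →ₗ[ℝ] ℝ, ∀ h,
      HasSum (fun n : ℕ => s ^ n / (n.factorial : ℝ) * pairing μ h ((halfCasimir T ^ n) f))
        (U h) := fun s hs =>
    exists_linearMap_hasSum (V := fun n : ℕ =>
      (s ^ n / (n.factorial : ℝ)) • (pairingBilin μ).flip ((halfCasimir T ^ n) f)) fun h =>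
        summable_exp_series hs (hf.summable h)
  choose! W hW using hexists
  refine ⟨W, ⟨fun s hs => isDistribution_of_hasSum (hW s hs), fun s hs h => ?_⟩, hW⟩
  refine hasDerivWithinAt_exp_series (fun s hs => hW s hs h)
    (y' := fun s => W s (halfCasimir T h)) (fun s hs => ?_) ?_ hs
  · simpa only [pairing_halfCasimir_pow] using hW s hs (halfCasimir T h)
  · simpa only [pairing_halfCasimir_pow] using hf.summable (halfCasimir T (halfCasimir T h))

theorem exists_isShiftedHeatEvolution (hK : IsUnit (killing T).det) {β : ℝ} {J : ι → ℝ}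
    {f : smoothFn E H} (hf : SeriesConverges T μ β (β • J) f) :
    ∃ U, IsShiftedHeatEvolution T μ β J f U ∧ ∀ h,
      HasSum (fun n : ℕ => pairing μ h (expV T (β • J)
        ((((-(1 / 2) * β) • casimir T) ^ n : Module.End ℝ (smoothFn E H)) f)) / (n.factorial : ℝ))
        (U β h) := by
  have : CompleteSpace E := FiniteDimensional.complete ℝ E
  obtain ⟨W, hW, hsum⟩ := hf.exists_isHeatEvolution
  obtain ⟨m, C, hC⟩ := hW.exists_hasOrderBound isCompact_uIcc
  refine ⟨fun s => W s ∘ₗ translate (lieExp (s • lieVec T (-J))),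
    ⟨fun s hs => (hW.isDistribution s hs).comp_translate (-J) s, fun h => ?_, fun s hs h => ?_⟩,
    fun h => ?_⟩
  · have hzero : HasSum (fun n : ℕ => (0 : ℝ) ^ n / (n.factorial : ℝ) *
        pairing μ h ((halfCasimir T ^ n) f)) (pairing μ h f) := by
      simpa using hasSum_single (f := fun n : ℕ => (0 : ℝ) ^ n / (n.factorial : ℝ) *
        pairing μ h ((halfCasimir T ^ n) f)) 0 fun n hn => by simp [hn]
    simpa [lieExp_zero, translate_one] using (hsum 0 Set.left_mem_uIcc h).unique hzero
  · refine (hasDerivWithinAt_distribution_translate hC (V' := W s ∘ₗ halfCasimir T)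
      (fun h => hW.evolution s hs h) (-J) h).congr_deriv ?_
    have hneg : vf (H := H) (lieVec T (-J)) = -vf (lieVec T J) := by rw [lieVec_neg, vf_neg]
    simp only [distGenerator_apply, LinearMap.comp_apply, halfCasimir_translate T hK, hneg,
      LinearMap.neg_apply, map_neg, sub_eq_add_neg]
  · have hinv : (lieExp (lieVec T (β • J)))⁻¹ = lieExp (β • lieVec T (-J)) := by
      rw [← lieExp_neg, lieVec_smul, lieVec_neg, smul_neg]
    simpa only [pairing_expV_smul_casimir_pow, hinv, LinearMap.comp_apply] using
      hsum β Set.right_mem_uIcc (translate (lieExp (β • lieVec T (-J))) h)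

end Existence

section TimeReflection

variable {A : Type*} [NormedAddCommGroup A] [NormedSpace ℝ A] {B : A →L[ℝ] A →L[ℝ] ℝ}
  {q q' : ℝ → A} {a b : ℝ}

/- By symmetry of the generator, `B (q s) (q (a + b - s))` does not depend on `s`: compare its
values at `s = a` and at the midpoint. -/
theorem bilin_midpoint_self_eq_zero
    (hq : ∀ s ∈ Set.uIcc a b, HasDerivWithinAt q (q' s) (Set.uIcc a b) s)
    (hB : ∀ s ∈ Set.uIcc a b, ∀ r ∈ Set.uIcc a b, B (q' s) (q r) = B (q s) (q' r))
    (ha : q a = 0) : B (q (midpoint ℝ a b)) (q (midpoint ℝ a b)) = 0 := by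
  have hrefl : Set.MapsTo (fun s => a + b - s) (Set.uIcc a b) (Set.uIcc a b) := fun s hs => by
    rwa [← Set.mem_preimage, Set.preimage_const_sub_uIcc, add_sub_cancel_left, add_sub_cancel_right,
      Set.uIcc_comm]
  have hconst : ∀ s ∈ Set.uIcc a b,
      HasDerivWithinAt (fun s => B (q s) (q (a + b - s))) 0 (Set.uIcc a b) s := fun s hs => by
    have hq_refl := (hq _ (hrefl hs)).scomp s
      ((hasDerivWithinAt_id s (Set.uIcc a b)).const_sub (a + b)) hrefl
    refine (B.hasDerivWithinAt_of_bilinear (hq s hs) hq_refl).congr_deriv ?_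
    rw [neg_one_smul, map_neg]
    exact neg_add_eq_zero.2 (hB s hs _ (hrefl hs)).symm
  have hmem : midpoint ℝ a b ∈ Set.uIcc a b := segment_eq_uIcc a b ▸ midpoint_mem_segment a b
  have hmid : a + b - midpoint ℝ a b = midpoint ℝ a b :=
    sub_eq_of_eq_add (midpoint_add_self ℝ a b).symm
  have hdiff := (convex_uIcc a b).norm_image_sub_le_of_norm_hasDerivWithin_le (C := 0) hconst
    (fun s _ => norm_zero.le) Set.left_mem_uIcc hmem
  simpa [ha, hmid] using hdiff

theorem eq_zero_of_hasDerivWithinAt_of_symmetric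
    (hq : ∀ s ∈ Set.uIcc a b, HasDerivWithinAt q (q' s) (Set.uIcc a b) s)
    (hB : ∀ s ∈ Set.uIcc a b, ∀ r ∈ Set.uIcc a b, B (q' s) (q r) = B (q s) (q' r))
    (hdef : ∀ x, B x x = 0 → x = 0) (ha : q a = 0) : q b = 0 := by
  have hmem : ∀ n : ℕ, AffineMap.lineMap b a ((1 / 2 : ℝ) ^ n) ∈ Set.uIcc a b := fun n =>
    (convex_uIcc a b).lineMap_mem Set.right_mem_uIcc Set.left_mem_uIcc
      ⟨by positivity, pow_le_one₀ (by norm_num) (by norm_num)⟩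
  have hzero : ∀ n : ℕ, q (AffineMap.lineMap b a ((1 / 2 : ℝ) ^ n)) = 0 := fun n => by
    induction n with
    | zero => simpa using ha
    | succ n ih =>
      have hsub := Set.uIcc_subset_uIcc (hmem n) (Set.right_mem_uIcc (a := a) (b := b))
      have hmid := hdef _ (bilin_midpoint_self_eq_zero (fun s hs => (hq s (hsub hs)).mono hsub)
        (fun s hs r hr => hB s (hsub hs) r (hsub hr)) ih)
      convert hmid using 2
      simp only [AffineMap.lineMap_apply_module, midpoint_eq_smul_add, invOf_eq_inv, smul_eq_mul]
      ring
  have hlim : Tendsto (fun n : ℕ => AffineMap.lineMap b a ((1 / 2 : ℝ) ^ n)) atTop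
      (𝓝[Set.uIcc a b] b) := by
    refine tendsto_nhdsWithin_iff.2 ⟨?_, Eventually.of_forall hmem⟩
    have hpow : Tendsto (fun n : ℕ => (1 / 2 : ℝ) ^ n) atTop (𝓝 0) :=
      tendsto_pow_atTop_nhds_zero_of_lt_one (by norm_num) (by norm_num)
    have hcont := (AffineMap.lineMap_continuous (R := ℝ) (p := b) (q := a)).tendsto 0
    rw [AffineMap.lineMap_apply_zero] at hcont
    exact hcont.comp hpow
  have hqb := (hq b Set.right_mem_uIcc).continuousWithinAt.tendsto.comp hlim
  exact tendsto_nhds_unique hqb (tendsto_const_nhds.congr fun n => (hzero n).symm)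

end TimeReflection

section IntegralForm

variable {M : Type*} [TopologicalSpace M] [CompactSpace M] [MeasurableSpace M]
  [OpensMeasurableSpace M] (ν : Measure M) [IsFiniteMeasure ν]

/-- The `L²` inner product `(F, F') ↦ ∫ F F'` on the space of continuous functions. -/
def integralForm : C(M, ℝ) →L[ℝ] C(M, ℝ) →L[ℝ] ℝ :=
  (ContinuousLinearMap.compL ℝ C(M, ℝ) C(M, ℝ) ℝ (integralCLM ν)).comp
    (ContinuousLinearMap.mul ℝ C(M, ℝ))

theorem integralForm_apply (F F' : C(M, ℝ)) :
    integralForm ν F F' = integralCLM ν (F * F') := rfl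

theorem eq_zero_of_integralForm_self [ν.IsOpenPosMeasure] {F : C(M, ℝ)}
    (hF : integralForm ν F F = 0) : F = 0 := by
  rw [integralForm_apply, integralCLM_apply] at hF
  have hae := (integral_eq_zero_iff_of_nonneg (fun x => mul_self_nonneg (F x))
    (integrable_continuousMap ν (F * F))).1 hF
  have hsq := ((F * F).continuous.ae_eq_iff_eq ν continuous_const).1 hae
  ext x
  exact mul_self_eq_zero.1 (congrFun hsq x)

end IntegralForm

section ExpShift

variable {E : Type*} [NormedAddCommGroup E] [NormedSpace ℝ E]
  {G : Type*} [TopologicalSpace G] [ChartedSpace E G] [Group G] [ContinuousMul G]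

/-- Left translation of a continuous function by the one-parameter group of `X`. -/
def expShift (X : GroupLieAlgebra 𝓘(ℝ, E) G) (τ : ℝ) (F : C(G, ℝ)) : C(G, ℝ) :=
  F.comp ⟨fun g => lieExp (τ • X) * g, continuous_const_mul _⟩

theorem integralCLM_expShift [CompactSpace G] [MeasurableSpace G] [BorelSpace G] (ν : Measure G)
    [IsFiniteMeasure ν] [ν.IsMulLeftInvariant] (X : GroupLieAlgebra 𝓘(ℝ, E) G) (τ : ℝ)
    (F : C(G, ℝ)) : integralCLM ν (expShift X τ F) = integralCLM ν F := by
  rw [integralCLM_apply, integralCLM_apply]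
  exact integral_mul_left_eq_self F (lieExp (τ • X))

variable [LieGroup 𝓘(ℝ, E) ∞ G] [T2Space G] [CompleteSpace E]

theorem expShift_zero (X : GroupLieAlgebra 𝓘(ℝ, E) G) (F : C(G, ℝ)) : expShift X 0 F = F := by
  ext g
  simp [expShift, lieExp_zero]

theorem continuous_expShift (X : GroupLieAlgebra 𝓘(ℝ, E) G) (F : C(G, ℝ)) :
    Continuous fun τ => expShift X τ F :=
  ContinuousMap.continuous_of_continuous_uncurry _ <|
    F.continuous.comp (((continuous_lieExp_smul X).comp continuous_fst).mul continuous_snd)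

end ExpShift

section OrbitFunctions

variable {E : Type*} [NormedAddCommGroup E] [NormedSpace ℝ E]
  {G : Type*} [TopologicalSpace G] [ChartedSpace E G] [Group G] [LieGroup 𝓘(ℝ, E) ∞ G]
  [CompactSpace G] {H : Subgroup G} {ι : Type*}
  (T : Module.Basis ι ℝ (GroupLieAlgebra 𝓘(ℝ, E) G))

open Classical in
/-- The continuous function `g ↦ W (g · h)` on the group, for a distribution `W`. It turns the
action of vector fields on `W` into differentiation on `G`, where Haar measure is available. If `W`
is not a distribution, the value is `0`. -/
def orbitFn [Finite ι] (W : smoothFn E H →ₗ[ℝ] ℝ) (h : smoothFn E H) : C(G, ℝ) :=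
  if hW : IsDistribution T W then
    ⟨fun g => W (translate g h), continuous_iff_continuousAt.2 fun g =>
      hW.tendsto fun w => (continuous_toC_wordOp_translate T w h).tendsto g⟩
  else 0

variable {T}

theorem orbitFn_apply [Finite ι] {W : smoothFn E H →ₗ[ℝ] ℝ} (hW : IsDistribution T W)
    (h : smoothFn E H) (g : G) : orbitFn T W h g = W (translate g h) := by
  rw [orbitFn, dif_pos hW, ContinuousMap.coe_mk]

section Derivative

variable [T2Space G] [CompleteSpace E] [Finite ι]

theorem hasDerivAt_distribution_translate {W : smoothFn E H →ₗ[ℝ] ℝ} (hW : IsDistribution T W)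
    (j : ι) (h : smoothFn E H) (τ : ℝ) :
    HasDerivAt (fun τ : ℝ => W (translate (lieExp (τ • T j)) h))
      (W (vf (T j) (translate (lieExp (τ • T j)) h))) τ := by
  classical
  have := Fintype.ofFinite ι
  obtain ⟨m, C, hC⟩ := (isDistribution_iff T W).1 hW
  have hj : lieVec T (Pi.single j 1) = T j := by simp [lieVec, Pi.single_apply]
  have hderiv := hasDerivWithinAt_distribution_translate (S := Set.univ) (V := fun _ => W)
    (V' := 0) (s := τ) (fun _ _ => hC) (fun _ => hasDerivWithinAt_const _ _ _) (Pi.single j 1) h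
  rw [hasDerivWithinAt_univ, hj] at hderiv
  simpa [vf_translate_lieExp_self] using hderiv

theorem hasDerivAt_expShift_orbitFn [ContinuousMul G] {W : smoothFn E H →ₗ[ℝ] ℝ}
    (hW : IsDistribution T W) (j : ι) (h : smoothFn E H) :
    HasDerivAt (fun τ => expShift (T j) τ (orbitFn T W h)) (orbitFn T (W ∘ₗ wordOp T [j]) h) 0 := by
  refine (hasDerivAt_continuousMap (u' := fun τ => expShift (T j) τ
    (orbitFn T (W ∘ₗ wordOp T [j]) h)) (fun g τ => ?_) (continuous_expShift _ _) 0).congr_deriv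
    (expShift_zero _ _)
  simp only [expShift, ContinuousMap.comp_apply, ContinuousMap.coe_mk, orbitFn_apply hW,
    orbitFn_apply (hW.comp_wordOp [j]), translate_mul, Module.End.mul_apply]
  simpa using hasDerivAt_distribution_translate hW j (translate g h) τ

end Derivative

section Haar

variable [T2Space G] [CompleteSpace E] [IsTopologicalGroup G] [MeasurableSpace G] [BorelSpace G]
  [Finite ι] (ν : Measure G) [IsFiniteMeasure ν] [ν.IsMulLeftInvariant]

/- Integration by parts: `∫ F F'` does not change when `F` and `F'` are translated together. -/
theorem integralForm_orbitFn_vf {W W' : smoothFn E H →ₗ[ℝ] ℝ} (hW : IsDistribution T W)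
    (hW' : IsDistribution T W') (j : ι) (h : smoothFn E H) :
    integralForm ν (orbitFn T (W ∘ₗ wordOp T [j]) h) (orbitFn T W' h)
      = -integralForm ν (orbitFn T W h) (orbitFn T (W' ∘ₗ wordOp T [j]) h) := by
  have hderiv := (integralForm ν).hasDerivAt_of_bilinear
    (fun _ => hasDerivAt_expShift_orbitFn hW j h) fun _ => hasDerivAt_expShift_orbitFn hW' j h
  have hconst : ∀ τ, integralForm ν (expShift (T j) τ (orbitFn T W h))
      (expShift (T j) τ (orbitFn T W' h)) = integralForm ν (orbitFn T W h) (orbitFn T W' h) :=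
    fun τ => integralCLM_expShift ν (T j) τ (orbitFn T W h * orbitFn T W' h)
  simp only [hconst, expShift_zero] at hderiv
  rw [eq_neg_iff_add_eq_zero, add_comm]
  exact hderiv.unique (hasDerivAt_const 0 _)

end Haar

variable [Fintype ι] [DecidableEq ι]

theorem IsDistribution.comp_halfCasimir {W : smoothFn E H →ₗ[ℝ] ℝ} (hW : IsDistribution T W) :
    IsDistribution T (W ∘ₗ halfCasimir T) := by
  obtain ⟨m, C, hC⟩ := (isDistribution_iff T W).1 hW
  exact hC.comp_halfCasimir.isDistribution

theorem orbitFn_comp_halfCasimir {W : smoothFn E H →ₗ[ℝ] ℝ} (hW : IsDistribution T W)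
    (h : smoothFn E H) : orbitFn T (W ∘ₗ halfCasimir T) h
      = ∑ i, ∑ j, (-(1 / 2) * (killing T)⁻¹ i j) •
        orbitFn T ((W ∘ₗ wordOp T [i]) ∘ₗ wordOp T [j]) h := by
  ext g
  rw [orbitFn_apply hW.comp_halfCasimir]
  simp only [ContinuousMap.coe_sum, Finset.sum_apply, ContinuousMap.coe_smul, Pi.smul_apply,
    orbitFn_apply ((hW.comp_wordOp _).comp_wordOp _), LinearMap.comp_apply, halfCasimir,
    LinearMap.smul_apply, casimir_apply, map_smul, map_sum, smul_eq_mul, Finset.mul_sum]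
  simp [mul_assoc]

theorem integralForm_orbitFn_halfCasimir [T2Space G] [CompleteSpace E] [IsTopologicalGroup G]
    [MeasurableSpace G] [BorelSpace G] (ν : Measure G) [IsFiniteMeasure ν] [ν.IsMulLeftInvariant]
    {W W' : smoothFn E H →ₗ[ℝ] ℝ} (hW : IsDistribution T W) (hW' : IsDistribution T W')
    (h : smoothFn E H) :
    integralForm ν (orbitFn T (W ∘ₗ halfCasimir T) h) (orbitFn T W' h)
      = integralForm ν (orbitFn T W h) (orbitFn T (W' ∘ₗ halfCasimir T) h) := by
  rw [orbitFn_comp_halfCasimir hW, orbitFn_comp_halfCasimir hW']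
  simp only [map_sum, map_smul, sum_apply, smul_apply]
  conv_rhs => rw [Finset.sum_comm]
  refine Finset.sum_congr rfl fun i _ => Finset.sum_congr rfl fun j _ => ?_
  rw [killing_inv_symm T i j, integralForm_orbitFn_vf ν (hW.comp_wordOp _) hW',
    integralForm_orbitFn_vf ν hW (hW'.comp_wordOp _), neg_neg]

end OrbitFunctions

section Uniqueness

variable {E : Type*} [NormedAddCommGroup E] [NormedSpace ℝ E] [FiniteDimensional ℝ E]
  {G : Type*} [TopologicalSpace G] [ChartedSpace E G] [Group G] [LieGroup 𝓘(ℝ, E) ∞ G]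
  [CompactSpace G] {H : Subgroup G} {ι : Type*} [Fintype ι] [DecidableEq ι]
  {T : Module.Basis ι ℝ (GroupLieAlgebra 𝓘(ℝ, E) G)}

theorem IsHeatEvolution.hasDerivWithinAt_orbitFn {S : Set ℝ} (hS : IsCompact S)
    (hconv : Convex ℝ S) {W : ℝ → smoothFn E H →ₗ[ℝ] ℝ} (hW : IsHeatEvolution T S W)
    (h : smoothFn E H) {s : ℝ} (hs : s ∈ S) :
    HasDerivWithinAt (fun r => orbitFn T (W r) h) (orbitFn T (W s ∘ₗ halfCasimir T) h) S s := by
  obtain ⟨m, C, hC⟩ := hW.exists_hasOrderBound hS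
  have hbound := fun s hs => (hC s hs).comp_halfCasimir.comp_halfCasimir
  obtain ⟨B, hB⟩ := exists_norm_wordOp_translate_le T (m + 2 + 2) h
  have hdist := fun s hs => (hW.isDistribution s hs).comp_halfCasimir
  refine hasDerivWithinAt_continuousMap hconv (u' := fun s => orbitFn T (W s ∘ₗ halfCasimir T) h)
    (u'' := fun s g => ((W s ∘ₗ halfCasimir T) ∘ₗ halfCasimir T) (translate g h))
    (fun g s hs => ?_) (fun g s hs => ?_) (abs_nonneg _)
    (fun s hs g => (hbound s hs _ B fun w hw => hB w hw g).trans (le_abs_self _)) hs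
  · rw [orbitFn_apply (hdist s hs)]
    exact (hW.evolution s hs (translate g h)).congr_of_mem
      (fun r hr => orbitFn_apply (hW.isDistribution r hr) h g) hs
  · exact (hW.evolution s hs (halfCasimir T (translate g h))).congr_of_mem
      (fun r hr => orbitFn_apply (hdist r hr) h g) hs

variable [T2Space G]

theorem IsHeatEvolution.eq_zero {a b : ℝ} {W : ℝ → smoothFn E H →ₗ[ℝ] ℝ}
    (hW : IsHeatEvolution T (Set.uIcc a b) W) (ha : W a = 0) : W b = 0 := by
  have : CompleteSpace E := FiniteDimensional.complete ℝ E
  have : IsTopologicalGroup G := topologicalGroup_of_lieGroup 𝓘(ℝ, E) ∞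
  let _ : MeasurableSpace G := borel G
  have : BorelSpace G := ⟨rfl⟩
  ext h
  have horbit : orbitFn T (W b) h = 0 := by
    refine eq_zero_of_hasDerivWithinAt_of_symmetric (B := integralForm (Measure.haar : Measure G))
      (q := fun s => orbitFn T (W s) h)
      (fun s hs => hW.hasDerivWithinAt_orbitFn isCompact_uIcc (convex_uIcc a b) h hs)
      (fun s hs r hr => integralForm_orbitFn_halfCasimir _ (hW.isDistribution s hs)
        (hW.isDistribution r hr) h)
      (fun F hF => eq_zero_of_integralForm_self _ hF) ?_
    ext g
    rw [orbitFn_apply (hW.isDistribution a Set.left_mem_uIcc), ha]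
    rfl
  simpa [orbitFn_apply (hW.isDistribution b Set.right_mem_uIcc), translate_one] using
    DFunLike.congr_fun horbit 1

variable [MeasurableSpace (G ⧸ H)] {μ : Measure (G ⧸ H)} {β : ℝ} {J : ι → ℝ} {f : smoothFn E H}
  {U₁ U₂ : ℝ → smoothFn E H →ₗ[ℝ] ℝ}

theorem IsShiftedHeatEvolution.sub_comp_translate (hK : IsUnit (killing T).det)
    (h₁ : IsShiftedHeatEvolution T μ β J f U₁) (h₂ : IsShiftedHeatEvolution T μ β J f U₂) :
    IsHeatEvolution T (Set.uIcc 0 β)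
      fun s => (U₁ s - U₂ s) ∘ₗ translate (lieExp (s • lieVec T J)) := by
  have : CompleteSpace E := FiniteDimensional.complete ℝ E
  have hdist : ∀ s ∈ Set.uIcc 0 β, IsDistribution T (U₁ s - U₂ s) := fun s hs =>
    (h₁.isDistribution s hs).sub (h₂.isDistribution s hs)
  have hderiv : ∀ s ∈ Set.uIcc 0 β, ∀ h, HasDerivWithinAt (fun r => (U₁ r - U₂ r) h)
      (((U₁ s - U₂ s) ∘ₗ (halfCasimir T - vf (lieVec T J))) h) (Set.uIcc 0 β) s :=
    fun s hs h => by
      refine ((h₁.evolution s hs h).sub (h₂.evolution s hs h)).congr_deriv ?_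
      rw [distGenerator_apply, distGenerator_apply]
      simp only [LinearMap.comp_apply, LinearMap.sub_apply, map_sub]
      ring
  obtain ⟨m, C, hC⟩ := exists_hasOrderBound_of_continuousOn isCompact_uIcc hdist
    fun h s hs => (hderiv s hs h).continuousWithinAt
  refine ⟨fun s hs => (hdist s hs).comp_translate J s, fun s hs h => ?_⟩
  refine (hasDerivWithinAt_distribution_translate hC (hderiv s hs) J h).congr_deriv ?_
  simp only [LinearMap.comp_apply, LinearMap.sub_apply, map_sub, halfCasimir_translate T hK,
    vf_translate_lieExp_self, sub_add_cancel]

theorem IsShiftedHeatEvolution.unique (hK : IsUnit (killing T).det)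
    (h₁ : IsShiftedHeatEvolution T μ β J f U₁) (h₂ : IsShiftedHeatEvolution T μ β J f U₂) :
    U₁ β = U₂ β := by
  have hinit : U₁ 0 - U₂ 0 = 0 := by
    ext h
    simp [h₁.initial, h₂.initial]
  have hzero := (h₁.sub_comp_translate hK h₂).eq_zero (by rw [hinit, LinearMap.zero_comp])
  ext h
  have heq := LinearMap.congr_fun hzero (translate (lieExp (β • lieVec T J))⁻¹ h)
  simpa [translate_translate_inv, sub_eq_zero] using heq

end Uniqueness

theorem hasFDerivAt_of_norm_sub_sub_le_sq {V W : Type*} [NormedAddCommGroup V] [NormedSpace ℝ V]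
    [NormedAddCommGroup W] [NormedSpace ℝ W] {u : V → W} {u' : V →L[ℝ] W} {x : V} {C : ℝ}
    (hu : ∀ y, ‖u y - u x - u' (y - x)‖ ≤ C * ‖y - x‖ ^ 2) : HasFDerivAt u u' x := by
  refine .of_isLittleO (Asymptotics.IsBigO.trans_isLittleO (.of_bound C <| .of_forall fun y => ?_)
    (Asymptotics.isLittleO_pow_sub_sub x one_lt_two))
  simpa using hu y

theorem hasSum_integral_exp {𝔸 : Type*} [NormedRing 𝔸] [NormedAlgebra ℝ 𝔸] [CompleteSpace 𝔸]
    (Y : 𝔸) : HasSum (fun n : ℕ => (((n + 1).factorial : ℝ)⁻¹) • Y ^ n)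
      (∫ t in (0 : ℝ)..1, NormedSpace.exp (t • Y)) := by
  have hterm (n : ℕ) : ∫ t in (0 : ℝ)..1, t ^ n • (n.factorial : ℝ)⁻¹ • Y ^ n
      = (((n + 1).factorial : ℝ)⁻¹) • Y ^ n := by
    rw [intervalIntegral.integral_smul_const, integral_pow, smul_smul, Nat.factorial_succ]
    congr 1
    simp [mul_comm]
  have hsummable := NormedSpace.norm_expSeries_summable' (𝕂 := ℝ) Y
  simp only [← hterm]
  refine intervalIntegral.hasSum_integral_of_dominated_convergence
    (fun n _ => ‖(n.factorial : ℝ)⁻¹ • Y ^ n‖)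
    (fun n => (by fun_prop : Continuous fun t : ℝ => t ^ n • (n.factorial : ℝ)⁻¹ • Y ^ n)
      |>.aestronglyMeasurable)
    (fun n => Eventually.of_forall fun t ht => ?_) (Eventually.of_forall fun _ _ => hsummable)
    intervalIntegrable_const (Eventually.of_forall fun t _ => ?_)
  · rw [Set.uIoc_of_le zero_le_one] at ht
    rw [norm_smul, norm_pow, Real.norm_of_nonneg ht.1.le]
    exact mul_le_of_le_one_left (norm_nonneg _) (pow_le_one₀ ht.1.le ht.2)
  · refine (NormedSpace.exp_series_hasSum_exp' (𝕂 := ℝ) (t • Y)).congr_fun fun n => ?_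
    rw [smul_pow, smul_comm]

section OmegaMatrix

open scoped Matrix.Norms.Operator Matrix

theorem analyticOnNhd_tsum_pow_div_factorial_succ {𝔸 : Type*} [NormedRing 𝔸] [NormedAlgebra ℝ 𝔸]
    [CompleteSpace 𝔸] :
    AnalyticOnNhd ℝ (fun Y : 𝔸 => ∑' n : ℕ, (((n + 1).factorial : ℝ)⁻¹) • Y ^ n) Set.univ := by
  set c : ℕ → ℝ := fun n => ((n + 1).factorial : ℝ)⁻¹ with hc
  have hratio (n : ℕ) : ‖c n.succ‖ / ‖c n‖ = 1 / (((n + 1 : ℕ) : ℝ) + 1) := by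
    have : ((n + 1).factorial : ℝ) ≠ 0 := by positivity
    simp only [hc, norm_inv, Real.norm_natCast, Nat.factorial_succ (n + 1), Nat.succ_eq_add_one]
    push_cast
    field_simp
  have hradius : (FormalMultilinearSeries.ofScalars 𝔸 c).radius = ⊤ := by
    refine FormalMultilinearSeries.ofScalars_radius_eq_top_of_tendsto _ _
      (Eventually.of_forall fun n => by positivity) ?_
    simp only [hratio]
    exact (tendsto_one_div_add_atTop_nhds_zero_nat (𝕜 := ℝ)).comp (tendsto_add_atTop_nat 1)
  have hanalytic := ((FormalMultilinearSeries.ofScalars 𝔸 c).hasFPowerSeriesOnBall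
    (hradius ▸ ENNReal.zero_lt_top)).analyticOnNhd
  rw [hradius, Metric.eball_top] at hanalytic
  exact hanalytic.congr isOpen_univ fun Y _ => FormalMultilinearSeries.ofScalars_sum_eq c Y

variable {E : Type*} [NormedAddCommGroup E] [NormedSpace ℝ E]
  {G : Type*} [TopologicalSpace G] [ChartedSpace E G] [Group G] {ι : Type*} [Fintype ι]
  (T : Module.Basis ι ℝ (GroupLieAlgebra 𝓘(ℝ, E) G))

theorem isLinearMap_adMatrix : IsLinearMap ℝ (adMatrix T) where
  map_add φ ψ := by
    ext j l
    simp [adMatrix, add_mul, Finset.sum_add_distrib]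
  map_smul c φ := by
    ext j l
    simp [adMatrix, Finset.mul_sum, mul_assoc]

variable [DecidableEq ι]

theorem exists_primitive_exp_adMatrix (φ : ι → ℝ) :
    ∃ N : ℝ → Matrix ι ι ℝ, N 0 = 0 ∧ N 1 = omegaMatrix T φ ∧ ∀ t k j,
      HasDerivAt (fun t => N t k j) (NormedSpace.exp (t • -adMatrix T φ) k j) t := by
  set Y := -adMatrix T φ
  have hcont : Continuous fun t : ℝ => NormedSpace.exp (t • Y) :=
    continuous_iff_continuousAt.2 fun t => (hasDerivAt_exp_smul_const' Y t).continuousAt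
  refine ⟨fun t => ∫ s in (0 : ℝ)..t, NormedSpace.exp (s • Y), by simp,
    (hasSum_integral_exp Y).tsum_eq.symm, fun t k j => ?_⟩
  exact (LinearMap.toContinuousLinearMap (Matrix.entryLinearMap ℝ ℝ k j)).hasFDerivAt
    |>.comp_hasDerivAt t (hcont.integral_hasStrictDerivAt 0 t).hasDerivAt

theorem contDiff_omegaMatrix_apply (k j : ι) : ContDiff ℝ ω fun φ => omegaMatrix T φ k j :=
  (LinearMap.toContinuousLinearMap (Matrix.entryLinearMap ℝ ℝ k j)).contDiff.comp
    (analyticOnNhd_tsum_pow_div_factorial_succ.contDiff.comp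
      (LinearMap.toContinuousLinearMap ((isLinearMap_adMatrix T).mk' _)).contDiff.neg)

theorem contDiff_det_omegaMatrix : ContDiff ℝ ω fun φ => (omegaMatrix T φ).det := by
  simp only [Matrix.det_apply]
  exact ContDiff.sum fun σ _ => ContDiff.const_smul _
    (contDiff_prod fun i _ => contDiff_omegaMatrix_apply T _ _)

theorem isOpen_regularSet : IsOpen (regularSet T) := by
  simp only [regularSet, isUnit_iff_ne_zero]
  exact isOpen_ne_fun (contDiff_det_omegaMatrix T).continuous continuous_const

theorem omegaMatrix_zero : omegaMatrix T 0 = 1 := by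
  rw [omegaMatrix, (isLinearMap_adMatrix T).map_zero, neg_zero,
    tsum_eq_single 0 fun n hn => by rw [zero_pow hn, smul_zero]]
  simp

/- On the line through `0` and `φ` the determinant of `omegaMatrix T` is an analytic function with
value `1` at `0`, so its zeros do not accumulate. -/
theorem mem_closure_regularSet (φ : ι → ℝ) : φ ∈ closure (regularSet T) := by
  set d : ℝ → ℝ := fun s => (omegaMatrix T (s • φ)).det
  have hanalytic : AnalyticOnNhd ℝ d Set.univ := contDiff_omega_iff_analyticOnNhd.1
    ((contDiff_det_omegaMatrix T).comp (contDiff_id.smul contDiff_const))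
  have hne : ∀ᶠ s in 𝓝[≠] (1 : ℝ), d s ≠ 0 := by
    refine (hanalytic 1 trivial).eventually_eq_zero_or_eventually_ne_zero.resolve_left fun h => ?_
    have hzero := hanalytic.eqOn_zero_of_preconnected_of_eventuallyEq_zero isPreconnected_univ
      (Set.mem_univ 1) h (Set.mem_univ 0)
    simp [d, omegaMatrix_zero] at hzero
  have htendsto : Tendsto (fun s : ℝ => s • φ) (𝓝[≠] 1) (𝓝 φ) :=
    (Continuous.tendsto' (f := fun s : ℝ => s • φ) (by fun_prop) 1 φ (one_smul ℝ φ)).mono_left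
      nhdsWithin_le_nhds
  exact mem_closure_of_tendsto htendsto (hne.mono fun s hs => isUnit_iff_ne_zero.2 hs)

end OmegaMatrix

section TranslationOperators

variable {E : Type*} [NormedAddCommGroup E] [NormedSpace ℝ E]
  {G : Type*} [TopologicalSpace G] [ChartedSpace E G] [Group G] [LieGroup 𝓘(ℝ, E) ∞ G]
  {H : Subgroup G} {ι : Type*} [Fintype ι]
  (T : Module.Basis ι ℝ (GroupLieAlgebra 𝓘(ℝ, E) G))

theorem expV_smul (t : ℝ) (φ : ι → ℝ) :
    expV (H := H) T (t • φ) = translate (lieExp (t • lieVec T φ)) := by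
  rw [← lieVec_smul]
  rfl

section Compact

variable [CompactSpace G]

theorem norm_toC_expV (φ : ι → ℝ) (f : smoothFn E H) : ‖toC (expV T φ f)‖ = ‖toC f‖ :=
  norm_toC_translate _ f

theorem exists_norm_toC_vf_lieVec_expV_le (f : smoothFn E H) :
    ∃ K, 0 ≤ K ∧ ∀ φ ψ : ι → ℝ, ‖toC (vf (lieVec T ψ) (expV T φ f))‖ ≤ K * ‖ψ‖ := by
  obtain ⟨K, hK⟩ := exists_norm_wordOp_translate_le T 1 f
  have hK₀ : 0 ≤ K := (norm_nonneg _).trans (hK [] (Nat.zero_le _) 1)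
  refine ⟨Fintype.card ι * K, by positivity, fun φ ψ => ?_⟩
  have hterm (j : ι) : ‖toC ((ψ j • vf (T j)) (expV T φ f))‖ ≤ ‖ψ‖ * K := by
    have hword := hK [j] le_rfl (lieExp (lieVec T φ))
    rw [wordOp_cons, wordOp_nil, mul_one] at hword
    rw [LinearMap.smul_apply, map_smul, norm_smul]
    exact mul_le_mul (norm_le_pi_norm ψ j) hword (norm_nonneg _) (norm_nonneg _)
  rw [vf_lieVec, LinearMap.sum_apply, map_sum]
  calc ‖∑ j, toC ((ψ j • vf (T j)) (expV T φ f))‖ ≤ ∑ _j : ι, ‖ψ‖ * K :=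
        norm_sum_le_of_le _ fun j _ => hterm j
    _ = Fintype.card ι * K * ‖ψ‖ := by simp; ring

end Compact

variable [T2Space G] [CompleteSpace E]

theorem expV_zero : expV (H := H) T 0 = 1 := by
  simp [expV, lieExp_zero, translate_one]

variable [MeasurableSpace (G ⧸ H)] [BorelSpace (G ⧸ H)]
  (μ : Measure (G ⧸ H)) [SMulInvariantMeasure G (G ⧸ H) μ]

theorem pairing_expV_sub_one_smul (t : ℝ) (φ : ι → ℝ) (h f : smoothFn E H) :
    pairing μ (expV T ((t - 1) • φ) h) (expV T (t • φ) f) = pairing μ h (expV T φ f) := by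
  have hfactor : expV T φ f = translate (lieExp ((1 - t) • lieVec T φ)) (expV T (t • φ) f) := by
    rw [expV_smul, ← Module.End.mul_apply, ← translate_mul, ← lieExp_add_smul, sub_add_cancel,
      ← expV_smul, one_smul]
  rw [hfactor, pairing_translate_right, ← lieExp_neg, ← neg_smul, neg_sub, ← expV_smul]

theorem pairing_expV_neg (φ : ι → ℝ) (h f : smoothFn E H) :
    pairing μ (expV T (-φ) h) f = pairing μ h (expV T φ f) := by
  simpa [expV_zero] using pairing_expV_sub_one_smul T μ 0 φ h f

variable [IsFiniteMeasure μ] [CompactSpace G]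

/- Duhamel's formula: between `t = 0` and `t = 1` the pairing runs from `∫ h (e^{a^i v_i} f)` to
`∫ h (e^{b^i v_i} f)`. -/
theorem hasDerivAt_pairing_duhamel (a b : ι → ℝ) (h f : smoothFn E H) (t : ℝ) :
    HasDerivAt (fun t : ℝ => pairing μ (expV T ((t - 1) • a) h) (expV T (t • b) f))
      (pairing μ (expV T ((t - 1) • a) h) (vf (lieVec T (b - a)) (expV T (t • b) f))) t := by
  have hsub : vf (H := H) (lieVec T (b - a)) = vf (lieVec T b) - vf (lieVec T a) := by
    rw [sub_eq_add_neg, lieVec_add, lieVec_neg, vf_add, vf_neg]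
    ext1 f
    simp [sub_eq_add_neg]
  simp only [expV_smul]
  have hderiv := (integralCLM μ).hasFDerivAt.comp_hasDerivAt t
    (((hasDerivAt_toC_translate (lieVec T a) h (t - 1)).comp_sub_const t 1).mul
      (hasDerivAt_toC_translate (lieVec T b) f t))
  refine HasDerivAt.congr_deriv (f := fun t : ℝ => pairing μ
    (translate (lieExp ((t - 1) • lieVec T a)) h) (translate (lieExp (t • lieVec T b)) f))
    hderiv ?_
  rw [map_add, ← pairing_eq, ← pairing_eq, hsub, ← vf_translate_lieExp_self,
    ← vf_translate_lieExp_self, LinearMap.sub_apply, ← pairingBilin_apply μ _ (_ - _), map_sub,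
    pairingBilin_apply, pairingBilin_apply, pairing_vf μ (lieVec T a)]
  ring

theorem exists_abs_pairing_expV_sub_le (f : smoothFn E H) :
    ∃ K, 0 ≤ K ∧ ∀ (a b : ι → ℝ) (F : smoothFn E H),
      |pairing μ F (expV T b f) - pairing μ F (expV T a f)| ≤ K * ‖b - a‖ * ‖toC F‖ := by
  obtain ⟨K, hK₀, hK⟩ := exists_norm_toC_vf_lieVec_expV_le T f
  refine ⟨‖integralCLM μ‖ * K, by positivity, fun a b F => ?_⟩
  have hbound (t : ℝ) :
      ‖pairing μ (expV T ((t - 1) • a) F) (vf (lieVec T (b - a)) (expV T (t • b) f))‖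
        ≤ ‖integralCLM μ‖ * K * ‖b - a‖ * ‖toC F‖ := by
    refine (abs_pairing_le μ _ _).trans ?_
    rw [norm_toC_expV, mul_assoc _ K]
    gcongr
    exact hK _ _
  have hmean := norm_image_sub_le_of_norm_deriv_le_segment_01'
    (fun t _ => (hasDerivAt_pairing_duhamel T μ a b F f t).hasDerivWithinAt) fun t _ => hbound t
  simpa [expV_zero, pairing_expV_neg] using hmean

theorem exists_primitive_pairing_vf_lieVec_expV [DecidableEq ι] (b ψ : ι → ℝ) (h f : smoothFn E H) :
    ∃ q : ℝ → ℝ, q 0 = 0 ∧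
      q 1 = ∑ j, ψ j * ∑ k, omegaMatrix T b k j * pairing μ h (expV T b (vf (T k) f)) ∧
      ∀ t, HasDerivAt q
        (pairing μ (expV T ((t - 1) • b) h) (vf (lieVec T ψ) (expV T (t • b) f))) t := by
  obtain ⟨N, hN₀, hN₁, hN⟩ := exists_primitive_exp_adMatrix T b
  refine ⟨fun t => ∑ j, ψ j * ∑ k, N t k j * pairing μ h (expV T b (vf (T k) f)), by simp [hN₀],
    by simp only [hN₁], fun t => ?_⟩
  refine (HasDerivAt.fun_sum fun j _ => (HasDerivAt.fun_sum fun k _ =>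
    (hN t k j).mul_const _).const_mul (ψ j)).congr_deriv ?_
  simp only [← pairing_expV_sub_one_smul T μ t b]
  rw [vf_lieVec, LinearMap.sum_apply]
  simp only [LinearMap.smul_apply, expV_smul, vf_translate_lieExp, ← pairingBilin_apply, map_sum,
    map_smul, smul_eq_mul]

/- Both the increment and its linear part are integrals over `[0, 1]`, and the integrands differ by
a translation of the second argument, which is Lipschitz. -/
theorem exists_abs_pairing_expV_sub_sub_le [DecidableEq ι] (b : ι → ℝ) (h f : smoothFn E H) :
    ∃ C, ∀ a, |pairing μ h (expV T a f) - pairing μ h (expV T b f)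
      - ∑ j, (a - b) j * ∑ k, omegaMatrix T b k j * pairing μ h (expV T b (vf (T k) f))|
        ≤ C * ‖a - b‖ ^ 2 := by
  obtain ⟨K, -, hK⟩ := exists_norm_toC_vf_lieVec_expV_le T h
  obtain ⟨K', hK'₀, hK'⟩ := exists_abs_pairing_expV_sub_le T μ f
  refine ⟨K' * K, fun a => ?_⟩
  obtain ⟨q, hq₀, hq₁, hq⟩ := exists_primitive_pairing_vf_lieVec_expV T μ b (a - b) h f
  have hbound (t : ℝ) (ht : t ∈ Set.Ico (0 : ℝ) 1) :
      ‖pairing μ (expV T ((t - 1) • b) h) (vf (lieVec T (a - b)) (expV T (t • a) f))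
        - pairing μ (expV T ((t - 1) • b) h) (vf (lieVec T (a - b)) (expV T (t • b) f))‖
        ≤ K' * K * ‖a - b‖ ^ 2 := by
    rw [pairing_vf, pairing_vf, neg_sub_neg, norm_sub_rev]
    calc _ ≤ K' * ‖t • a - t • b‖ * ‖toC (vf (lieVec T (a - b)) (expV T ((t - 1) • b) h))‖ :=
          hK' _ _ _
      _ ≤ K' * ‖a - b‖ * (K * ‖a - b‖) := by
          gcongr
          · rw [← smul_sub, norm_smul, Real.norm_of_nonneg ht.1]
            exact mul_le_of_le_one_left (norm_nonneg _) ht.2.le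
          · exact hK _ _
      _ = K' * K * ‖a - b‖ ^ 2 := by ring
  have hmean := norm_image_sub_le_of_norm_deriv_le_segment_01'
    (fun t _ => ((hasDerivAt_pairing_duhamel T μ b a h f t).sub (hq t)).hasDerivWithinAt) hbound
  simpa [expV_zero, pairing_expV_neg, hq₀, hq₁, sub_right_comm] using hmean

theorem hasFDerivAt_pairing_expV [DecidableEq ι] (h f : smoothFn E H) (b : ι → ℝ) :
    HasFDerivAt (fun φ => pairing μ h (expV T φ f))
      (∑ j, (∑ k, omegaMatrix T b k j * pairing μ h (expV T b (vf (T k) f))) •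
        (ContinuousLinearMap.proj j : (ι → ℝ) →L[ℝ] ℝ)) b := by
  obtain ⟨C, hC⟩ := exists_abs_pairing_expV_sub_sub_le T μ b h f
  refine hasFDerivAt_of_norm_sub_sub_le_sq (C := C) fun a => ?_
  simpa only [Real.norm_eq_abs, sum_apply, smul_apply, ContinuousLinearMap.proj_apply, smul_eq_mul,
    mul_comm] using hC a

theorem fderiv_pairing_expV [DecidableEq ι] (h f : smoothFn E H) (φ : ι → ℝ) (j : ι) :
    fderiv ℝ (fun φ => pairing μ h (expV T φ f)) φ (Pi.single j 1)
      = ∑ k, omegaMatrix T φ k j * pairing μ h (expV T φ (vf (T k) f)) := by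
  rw [(hasFDerivAt_pairing_expV T μ h f φ).fderiv]
  simp [sum_apply, Pi.single_apply]

theorem contDiff_pairing_expV (h f : smoothFn E H) :
    ContDiff ℝ ∞ fun φ => pairing μ h (expV T φ f) := by
  classical
  rw [contDiff_infty]
  intro n
  induction n generalizing f with
  | zero =>
    rw [Nat.cast_zero, contDiff_zero]
    exact continuous_iff_continuousAt.2 fun φ => (hasFDerivAt_pairing_expV T μ h f φ).continuousAt
  | succ n ih =>
    rw [Nat.cast_succ, contDiff_succ_iff_hasFDerivAt]
    refine ⟨_, ?_, hasFDerivAt_pairing_expV T μ h f⟩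
    refine ContDiff.sum fun j _ => ContDiff.fun_smul (ContDiff.sum fun k _ => ?_) contDiff_const
    exact ((contDiff_omegaMatrix_apply T k j).of_le le_top).mul (ih (vf (T k) f))

end TranslationOperators

section DerivativeExpansion

variable {E : Type*} [NormedAddCommGroup E] [NormedSpace ℝ E]
  {G : Type*} [TopologicalSpace G] [ChartedSpace E G] [Group G]
  {ι : Type*} [Fintype ι] [DecidableEq ι] {T : Module.Basis ι ℝ (GroupLieAlgebra 𝓘(ℝ, E) G)}

theorem eqOn_uOp {Ψ Ψ' : (ι → ℝ) → ℝ} (hΨ : Set.EqOn Ψ Ψ' (regularSet T)) (i : ι) :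
    Set.EqOn (uOp T i Ψ) (uOp T i Ψ') (regularSet T) := fun φ hφ => by
  have hev : Ψ =ᶠ[𝓝 φ] Ψ' := hΨ.eventuallyEq_of_mem ((isOpen_regularSet T).mem_nhds hφ)
  simp only [uOp, hev.fderiv_eq]

theorem eqOn_uCasimir {Ψ Ψ' : (ι → ℝ) → ℝ} (hΨ : Set.EqOn Ψ Ψ' (regularSet T)) (β : ℝ) :
    Set.EqOn (uCasimir T β Ψ) (uCasimir T β Ψ') (regularSet T) := fun φ hφ => by
  simp only [uCasimir, eqOn_uOp (eqOn_uOp hΨ _) _ hφ]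

variable [LieGroup 𝓘(ℝ, E) ∞ G] [CompactSpace G] [T2Space G] [CompleteSpace E]
  {H : Subgroup G} [MeasurableSpace (G ⧸ H)] [BorelSpace (G ⧸ H)]
  (μ : Measure (G ⧸ H)) [IsFiniteMeasure μ] [SMulInvariantMeasure G (G ⧸ H) μ]

theorem uOp_pairing_expV (h f : smoothFn E H) (i : ι) :
    Set.EqOn (uOp T i fun φ => pairing μ h (expV T φ f))
      (fun φ => pairing μ h (expV T φ (vf (T i) f))) (regularSet T) := fun φ hφ => by
  set d : ι → ℝ := fun k => pairing μ h (expV T φ (vf (T k) f))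
  have hinv : d i = ∑ k, (omegaMatrix T φ * (omegaMatrix T φ)⁻¹) k i * d k := by
    simp [Matrix.mul_nonsing_inv _ hφ, Matrix.one_apply]
  simp only [uOp, fderiv_pairing_expV]
  change _ = d i
  rw [hinv]
  simp only [Matrix.mul_apply, Finset.mul_sum, Finset.sum_mul]
  rw [Finset.sum_comm]
  exact Finset.sum_congr rfl fun k _ => Finset.sum_congr rfl fun j _ => by ring

theorem uCasimir_pairing_expV (β : ℝ) (h f : smoothFn E H) :
    Set.EqOn (uCasimir T β fun φ => pairing μ h (expV T φ f))
      (fun φ => pairing μ h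
        (expV T φ (((-(1 / 2) * β) • casimir T : Module.End ℝ (smoothFn E H)) f)))
      (regularSet T) := fun φ hφ => by
  have hsecond (i j : ι) : uOp T i (uOp T j fun φ => pairing μ h (expV T φ f)) φ
      = pairing μ h (expV T φ (vf (T i) (vf (T j) f))) :=
    (eqOn_uOp (uOp_pairing_expV μ h f j) i).trans (uOp_pairing_expV μ h _ i) hφ
  simp only [uCasimir, hsecond, LinearMap.smul_apply, casimir_apply]
  simp only [← pairingBilin_apply, map_sum, map_smul, smul_eq_mul]

theorem iterate_uCasimir_pairing_expV (β : ℝ) (h f : smoothFn E H) (n : ℕ) :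
    Set.EqOn ((uCasimir T β)^[n] fun φ => pairing μ h (expV T φ f))
      (fun φ => pairing μ h
        (expV T φ ((((-(1 / 2) * β) • casimir T) ^ n : Module.End ℝ (smoothFn E H)) f)))
      (regularSet T) := by
  induction n with
  | zero => exact fun φ _ => rfl
  | succ n ih =>
    rw [Function.iterate_succ_apply', pow_succ']
    exact (eqOn_uCasimir ih β).trans (uCasimir_pairing_expV μ β h _)

variable {μ} in
theorem hasDerivativeExpansion_of_hasSum {β a : ℝ} {φ₀ : ι → ℝ} {h f : smoothFn E H}
    (hsum : HasSum (fun n : ℕ => pairing μ h (expV T φ₀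
      ((((-(1 / 2) * β) • casimir T) ^ n : Module.End ℝ (smoothFn E H)) f)) / (n.factorial : ℝ))
      a) : HasDerivativeExpansion T β (fun φ => pairing μ h (expV T φ f)) φ₀ a := by
  refine ⟨contDiff_pairing_expV T μ h f, _, fun n => ?_, hsum.tendsto_sum_nat⟩
  refine (((contDiff_pairing_expV T μ h _).continuous.tendsto φ₀).mono_left
    nhdsWithin_le_nhds |>.div_const (n.factorial : ℝ)).congr' ?_
  filter_upwards [self_mem_nhdsWithin] with φ hφ
  rw [iterate_uCasimir_pairing_expV μ β h f n hφ]

end DerivativeExpansion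

end HomSpace

end

theorem theorem2_general
    {E : Type*} [NormedAddCommGroup E] [NormedSpace ℝ E] [FiniteDimensional ℝ E]
    {G : Type*} [TopologicalSpace G] [ChartedSpace E G] [Group G]
    [LieGroup 𝓘(ℝ, E) ∞ G] [CompactSpace G] [T2Space G]
    (H : Subgroup G)
    [MeasurableSpace (G ⧸ H)] [BorelSpace (G ⧸ H)]
    (μ : MeasureTheory.Measure (G ⧸ H)) [MeasureTheory.IsFiniteMeasure μ]
    [MeasureTheory.SMulInvariantMeasure G (G ⧸ H) μ]
    {ι : Type*} [Fintype ι] [DecidableEq ι]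
    (T : Module.Basis ι ℝ (GroupLieAlgebra 𝓘(ℝ, E) G))
    (hK : IsUnit (HomSpace.killing T).det)
    (β : ℝ) (J : ι → ℝ) (f : HomSpace.smoothFn E H)
    (hf : HomSpace.SeriesConverges T μ β (β • J) f) :
    β • J ∈ closure (HomSpace.regularSet T) ∧
    (∃ U, HomSpace.IsShiftedHeatEvolution T μ β J f U) ∧
    ∀ U, HomSpace.IsShiftedHeatEvolution T μ β J f U →
      ∀ h : HomSpace.smoothFn E H,
        HomSpace.HasDerivativeExpansion T β
          (fun φ => HomSpace.pairing μ h (HomSpace.expV T φ f)) (β • J) (U β h) := by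
  have : CompleteSpace E := FiniteDimensional.complete ℝ E
  obtain ⟨U₀, hU₀, hsum⟩ := HomSpace.exists_isShiftedHeatEvolution hK hf
  refine ⟨HomSpace.mem_closure_regularSet T _, ⟨U₀, hU₀⟩, fun U hU h => ?_⟩
  rw [HomSpace.IsShiftedHeatEvolution.unique hK hU hU₀]
  exact HomSpace.hasDerivativeExpansion_of_hasSum (hsum h)

theorem theorem2
    {E : Type*} [NormedAddCommGroup E] [NormedSpace ℝ E] [FiniteDimensional ℝ E]
    {G : Type*} [TopologicalSpace G] [ChartedSpace E G] [Group G]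
    [LieGroup 𝓘(ℝ, E) ∞ G] [CompactSpace G] [T2Space G]
    (H : Subgroup G) (hH : IsClosed (H : Set G))
    [MeasurableSpace (G ⧸ H)] [BorelSpace (G ⧸ H)]
    (μ : MeasureTheory.Measure (G ⧸ H)) [MeasureTheory.IsFiniteMeasure μ]
    [MeasureTheory.SMulInvariantMeasure G (G ⧸ H) μ] (hμ : μ ≠ 0)
    {ι : Type*} [Fintype ι] [DecidableEq ι]
    (T : Module.Basis ι ℝ (GroupLieAlgebra 𝓘(ℝ, E) G))
    (hK : (HomSpace.killing T).PosDef)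
    (β : ℝ) (J : ι → ℝ) (f : HomSpace.smoothFn E H)
    (hf : HomSpace.SeriesConverges T μ β (β • J) f) :
    β • J ∈ closure (HomSpace.regularSet T) ∧
    (∃ U, HomSpace.IsShiftedHeatEvolution T μ β J f U) ∧
    ∀ U, HomSpace.IsShiftedHeatEvolution T μ β J f U →
      ∀ h : HomSpace.smoothFn E H,
        HomSpace.HasDerivativeExpansion T β
          (fun φ => HomSpace.pairing μ h (HomSpace.expV T φ f)) (β • J) (U β h) := by
  exact theorem2_general H μ T hK.det_pos.ne'.isUnit β J f hf
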